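/- **Setting.** Let $n\ge 1$, let $X$ be a Banach space, $Y\subset X$ a dense subspace, and $A=(A_1,\dots,A_n)$ linear operators $A_i:Y\to Y$ with $[A_i,A_j]=0$; write $A^\alpha=A_1^{\alpha_1}\cdots A_n^{\alpha_n}$ for $\alpha\in\mathbb N_0^n$. Assume that $Y$ is complete for the seminorms $y\mapsto\|A^\alpha y\|_X$: if $y_k\in Y$ and $A^\alpha y_k\to z_\alpha$ in $X$ for every $\alpha$, then there is $y\in Y$ with $A^\alpha y=z_\alpha$ for every $\alpha$. Let $L$ be the generator of a strongly continuous group $(e^{tL})_{t\in\mathbb R}$ on $X$ with $Y\subset D(L)$, $L(Y)\subset Y$, $e^{tL}Y\subset Y$, and $t\mapsto A^\alpha e^{tL}y\in X$ continuous for all $y\in Y$, $\alpha\in\mathbb N_0^n$. Put $L_0=L$, $L_{\alpha+\hat e_i}=[L_\alpha,A_i]$, and $A_{tL}^\alpha=e^{tL}A^\alpha e^{-tL}$ on $Y$. For $k\in\{0,1\}$ let $C^k_L([0,\infty);Y)$ be the set of $u:[0,\infty)\to Y$ such that $t\mapsto A^\alpha_{tL}u(t)\in C^k([0,\infty);X)$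 for all $\alpha$. Let $\|\cdot\|_{X_t}$, $t\ge0$, be norms on $Y$, each stronger than $\|\cdot\|_X$ (i.e. $\|y\|_X\le c_t\|y\|_{X_t}$ on $Y$), such that $t\mapsto\|x(t)\|_{X_t}$ is continuous for every $x\in C^0_L([0,\infty);Y)$. Let $Q_t:Y\to Y$, $t\ge0$, be maps, put $Q_{tL}(y)=e^{tL}Q_t(e^{-tL}y)$, and assume that $t\mapsto Q_{tL}(u(t))$ belongs to $C^0_L([0,\infty);Y)$ whenever $u$ does. Let $C,r,M_0,M_1,M_0',M_1'\ge0$ and $\omega>Cr$ be such that: * (H2′) for all $t\ge0$, $\alpha\in\mathbb N_0^n$, $y\in Y$: $\ \|e^{tL}L_\alpha y\|_{X_t}\le C\,\alpha!\,r^{|\alpha|}\sum_{i=1}^n\|e^{tL}A_iy\|_{X_t}$; * (H3a′) for all $t>0$, $\alpha\in\mathbb N_0^n$, $y\in Y$: $$\|e^{tL}A^\alpha Q_t(y)\|_{X_t}\le e^{-\omega t}\sum_{\gamma\le\alpha}\binom\alpha\gamma\|e^{tL}A^{\alpha-\gamma}y\|_{X_t}\sum_{|\beta|\le1}M_{|\beta|}\|e^{tL}A^{\gamma+\beta}y\|_{X_t};$$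 * (H3b′) for all $t>0$, $\alpha\in\mathbb N_0^n$, $x,y\in Y$, with $[x,y]$ the segment from $x$ to $y$: $$\|e^{tL}A^\alpha(Q_t(y)-Q_t(x))\|_{X_t}\le e^{-\omega t}\sup_{z,z'\in[x,y]}\sum_{\gamma\le\alpha}\binom\alpha\gamma\Big(\|e^{tL}A^{\alpha-\gamma}z\|_{X_t}\sum_{|\beta|\le1}M'_{|\beta|}\|e^{tL}A^{\gamma+\beta}(y-x)\|_{X_t}+\|e^{tL}A^{\alpha-\gamma}(y-x)\|_{X_t}\sum_{|\beta|\le1}M'_{|\beta|}\|e^{tL}A^{\gamma+\beta}z'\|_{X_t}\Big);$$ * (H4′) for every $x\in C^1_L([0,\infty);Y)$ whose derivative in $X$ takes values in $Y$: $\ \partial_t\|x(t)\|_{X_t}\le\|\partial_tx(t)\|_{X_t}$ for all $t\ge0$, where $\partial_t$ on the left is the upper right Dini derivative. For $\nu\ge0$, $t\ge0$, $y\in Y$ put $$\|y\|_{X_t^\nu}=\sum_{\alpha\in\mathbb N_0^n}\frac{\nu^{|\alpha|}}{\alpha!}\|A_{tL}^\alpha y\|_{X_t}\in[0,\infty].$$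 A strong solution of $\partial_tu=Q_{tL}(u)$, $u(0)=u_0\in Y$, is a $u\in C^0_L([0,\infty);Y)$ with $u(0)=u_0$ that is differentiable in $X$ on $[0,\infty)$ and satisfies the equation in $X$ for all $t\ge0$. **Theorem.** For every $\nu_0>0$ with $\nu_0<\frac1r\Big(1-\sqrt[n]{\frac{nCr}{\omega}}\Big)$ (no restriction if $r=0$) there is $\varepsilon>0$ such that the following holds for every $\nu\in[0,\nu_0]$. 1. For every $u_0\in Y$ with $\|u_0\|_{X_0^\nu}\le\varepsilon\nu$ there is a strong solution $u$ of $\partial_tu=Q_{tL}(u)$, $u(0)=u_0$, with $$\|u(t)\|_{X_t^{\nu e^{-\omega t}}}\le2\varepsilon\nu\qquad\text{for all }t\ge0.$$ 2. If $u_0,w_0\in Y$ satisfy $\|u_0\|_{X_0^\nu},\|w_0\|_{X_0^\nu}\le\varepsilon\nu$ and $u,w$ are strong solutions with $u(0)=u_0$, $w(0)=w_0$ that both satisfy the bound in 1, then $$\|u(t)-w(t)\|_{X_t^{\nu e^{-\omega t}}}\le2\|u_0-w_0\|_{X_0^\nu}\qquad\text{for all }t\ge0.$$ In particular the solution in 1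 is unique among the strong solutions satisfying that bound. -/

import Mathlib

open Set Filter Topology

namespace AnalyticEvolution

/-! ### Multi-indices and iterated operators -/

/-- The length `|α| = α₁ + ⋯ + αₙ` of a multi-index. -/
def len {n : ℕ} (α : Fin n → ℕ) : ℕ := ∑ i, α i

/-- The factorial `α! = α₁! ⋯ αₙ!`. -/
def fact {n : ℕ} (α : Fin n → ℕ) : ℕ := ∏ i, (α i).factorial

/-- The binomial coefficient `(α choose γ)`, the product of the coordinatewise ones. -/
def binom {n : ℕ} (α γ : Fin n → ℕ) : ℕ := ∏ i, (α i).choose (γ i)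

/-- The unit multi-index `eᵢ`. -/
def unit {n : ℕ} (i : Fin n) : Fin n → ℕ := Pi.single i 1

/-- The power `f^α = f₁^α₁ ⋯ fₙ^αₙ` (the order is irrelevant when the `fᵢ` commute). -/
def mpow {M : Type*} [Monoid M] {n : ℕ} (f : Fin n → M) (α : Fin n → ℕ) : M :=
  (List.ofFn fun i => f i ^ α i).prod

theorem commute_mpow {M : Type*} [Monoid M] {n : ℕ} (f : Fin n → M) (a : M)
    (h : ∀ i, Commute (f i) a) (α : Fin n → ℕ) : Commute (mpow f α) a := by
  refine (Commute.list_prod_right _ _ fun x hx => ?_).symm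
  obtain ⟨i, rfl⟩ := (List.mem_ofFn' _ _).1 hx
  exact ((h i).pow_left _).symm

theorem mpow_zero {M : Type*} [Monoid M] {n : ℕ} (f : Fin n → M) : mpow f 0 = 1 := by
  simp [mpow, List.ofFn_const]

theorem mpow_add_unit {M : Type*} [Monoid M] {n : ℕ} (f : Fin n → M)
    (h : ∀ i j, Commute (f i) (f j)) (α : Fin n → ℕ) (i : Fin n) :
    mpow f (α + unit i) = mpow f α * f i := by
  induction n with
  | zero => exact i.elim0
  | succ n ih =>
    have key : ∀ β : Fin (n + 1) → ℕ,
        mpow f β = f 0 ^ β 0 * mpow (fun j : Fin n => f j.succ) (fun j => β j.succ) := by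
      intro β
      simp [mpow, List.ofFn_succ]
    rw [key, key α]
    refine Fin.cases ?_ (fun j => ?_) i
    · have h1 : (fun j : Fin n => (α + unit (0 : Fin (n + 1)) : Fin (n + 1) → ℕ) j.succ) = fun j => α j.succ := by
        funext j
        simp [unit]
      have h2 : (α + unit (0 : Fin (n + 1)) : Fin (n + 1) → ℕ) 0 = α 0 + 1 := by simp [unit]
      rw [h1, h2, pow_succ, mul_assoc, mul_assoc,
        (commute_mpow (fun j : Fin n => f j.succ) (f 0) (fun j => h _ _) _).eq]
    · have h1 : (fun k : Fin n => (α + unit j.succ : Fin (n + 1) → ℕ) k.succ) = (fun k => α k.succ) + unit j := by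
        funext k
        simp [unit, Pi.single_apply]
      have h2 : (α + unit j.succ : Fin (n + 1) → ℕ) 0 = α 0 := by simp [unit]
      rw [h1, h2, ih _ (fun _ _ => h _ _), mul_assoc]

/-- The operator `T ↦ [T, a] = T a - a T` on endomorphisms. -/
def bracketWith {V : Type*} [AddCommGroup V] [Module ℝ V] (a : Module.End ℝ V) :
    Module.End ℝ (Module.End ℝ V) :=
  LinearMap.mulRight ℝ a - LinearMap.mulLeft ℝ a

/-- The iterated commutators `L_α`: `L_0 = L` and `L_{α + eᵢ} = [L_α, Aᵢ]`
(see `iterComm_zero` and `iterComm_add_unit`). -/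
def iterComm {V : Type*} [AddCommGroup V] [Module ℝ V] {n : ℕ}
    (A : Fin n → Module.End ℝ V) (L : Module.End ℝ V) (α : Fin n → ℕ) : Module.End ℝ V :=
  mpow (fun i => bracketWith (A i)) α L

theorem iterComm_zero {V : Type*} [AddCommGroup V] [Module ℝ V] {n : ℕ}
    (A : Fin n → Module.End ℝ V) (L : Module.End ℝ V) : iterComm A L 0 = L := by
  simp [iterComm, mpow_zero]

theorem iterComm_add_unit {V : Type*} [AddCommGroup V] [Module ℝ V] {n : ℕ}
    (A : Fin n → Module.End ℝ V) (hA : ∀ i j, Commute (A i) (A j)) (L : Module.End ℝ V)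
    (α : Fin n → ℕ) (i : Fin n) :
    iterComm A L (α + unit i) = iterComm A L α * A i - A i * iterComm A L α := by
  have hc : ∀ i j, Commute (bracketWith (A i)) (bracketWith (A j)) := by
    intro i j
    refine LinearMap.ext fun T => ?_
    have h := (hA i j).eq
    simp only [bracketWith, Module.End.mul_apply, LinearMap.sub_apply, LinearMap.mulRight_apply,
      LinearMap.mulLeft_apply, sub_mul, mul_sub]
    rw [mul_assoc T, mul_assoc T, h, ← mul_assoc (A i) (A j) T, h]
    noncomm_ring
  have hu : mpow (fun i => bracketWith (A i)) (α + unit i)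
      = bracketWith (A i) * mpow (fun i => bracketWith (A i)) α := by
    rw [mpow_add_unit _ hc, (commute_mpow _ _ (fun j => hc j i) α).eq]
  rw [iterComm, hu]
  rfl

/-! ### The functional setting -/

/-- A strongly continuous one-parameter group `(e^{tL})` of bounded operators on `X`. -/
structure C0Group (X : Type*) [NormedAddCommGroup X] [NormedSpace ℝ X] where
  /-- the operator `e^{tL}` -/
  op : ℝ → X →L[ℝ] X
  op_zero : op 0 = ContinuousLinearMap.id ℝ X
  op_add : ∀ s t, op (s + t) = (op s).comp (op t)
  strong_cont : ∀ x, Continuous fun t => op t x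

/-- The linear setting: a dense subspace `Y` of `X`, commuting operators `A₁, …, Aₙ : Y → Y`, and
a `C₀`-group `e^{tL}` on `X` whose generator `L` is defined on `Y` with `L(Y) ⊆ Y`.
`Y` carries the locally convex topology of the seminorms `y ↦ ‖A^α y‖_X`: it is complete
(a Fréchet space), and the group restricts to a strongly continuous group on it. -/
structure Setting (n : ℕ) (X : Type*) [NormedAddCommGroup X] [NormedSpace ℝ X] where
  Y : Submodule ℝ X
  dense : Dense (Y : Set X)
  A : Fin n → Module.End ℝ Y
  A_comm : ∀ i j, Commute (A i) (A j)
  /-- If `A^α y_k` converges in `X` for every `α`, then `y_k` converges in `Y`. -/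
  complete : ∀ (y : ℕ → Y) (z : (Fin n → ℕ) → X),
    (∀ α, Tendsto (fun k => (mpow A α (y k) : X)) atTop (𝓝 (z α))) →
      ∃ y' : Y, ∀ α, (mpow A α y' : X) = z α
  G : C0Group X
  /-- The restriction of the generator of the group to `Y`. -/
  L : Module.End ℝ Y
  isGenerator : ∀ y : Y, HasDerivAt (fun t => G.op t y) (L y : X) 0
  maps_Y : ∀ t, ∀ y ∈ Y, G.op t y ∈ Y
  orbit_cont : ∀ (α : Fin n → ℕ) (y : Y),
    Continuous fun t => (mpow A α ⟨G.op t y, maps_Y t y y.2⟩ : X)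

namespace Setting

variable {n : ℕ} {X : Type*} [NormedAddCommGroup X] [NormedSpace ℝ X] (S : Setting n X)

/-- The restriction of `e^{tL}` to `Y`. -/
def e (t : ℝ) : Module.End ℝ S.Y :=
  (S.G.op t : X →ₗ[ℝ] X).restrict (S.maps_Y t)

/-- `A^α = A₁^α₁ ⋯ Aₙ^αₙ` on `Y`. -/
def pw (α : Fin n → ℕ) : Module.End ℝ S.Y := mpow S.A α

/-- `A_{tL}^α = e^{tL} A^α e^{-tL}` on `Y`. -/
def conj (t : ℝ) (α : Fin n → ℕ) : Module.End ℝ S.Y := S.e t * S.pw α * S.e (-t)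

/-- `L_α`. -/
def Lc (α : Fin n → ℕ) : Module.End ℝ S.Y := iterComm S.A S.L α

/-- The class `C⁰_L([0,∞);Y)`: curves in `Y` such that every `t ↦ A_{tL}^α u(t)` is continuous
from `[0,∞)` to `X` (the values of `u` at negative times are irrelevant). -/
def CL0 (u : ℝ → S.Y) : Prop :=
  ∀ α, ContinuousOn (fun t => (S.conj t α (u t) : X)) (Ici 0)

/-- The class `C¹_L([0,∞);Y)`. -/
def CL1 (u : ℝ → S.Y) : Prop :=
  ∀ α, ContDiffOn ℝ 1 (fun t => (S.conj t α (u t) : X)) (Ici 0)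

/-- `Q_{tL}(y) = e^{tL} Q_t(e^{-tL} y)`. -/
def transf (Q : ℝ → S.Y → S.Y) (t : ℝ) (y : S.Y) : S.Y := S.e t (Q t (S.e (-t) y))

/-- The family `t ↦ ‖·‖_{X_t}`, `t ≥ 0`, is an admissible family of norms on `Y`: each is stronger
than the norm of `X`, and `t ↦ ‖x(t)‖_{X_t}` is continuous along every curve of class `C⁰_L`. -/
structure AdmissibleNorms (N : ℝ → Seminorm ℝ S.Y) : Prop where
  stronger : ∀ t, 0 ≤ t → ∃ c : ℝ, ∀ y : S.Y, ‖(y : X)‖ ≤ c * N t y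
  cont : ∀ x : ℝ → S.Y, S.CL0 x → ContinuousOn (fun t => N t (x t)) (Ici 0)

/-- The nonlinearity `t ↦ Q_{tL}(u(t))` acts in `C⁰_L([0,∞);Y)`. -/
def ActsOnCL0 (Q : ℝ → S.Y → S.Y) : Prop :=
  ∀ u : ℝ → S.Y, S.CL0 u → S.CL0 fun t => S.transf Q t (u t)

/-- The commutator bounds
`‖e^{tL} L_α y‖_{X_t} ≤ C α! r^{|α|} ∑ᵢ ‖e^{tL} Aᵢ y‖_{X_t}`. -/
def H2 (N : ℝ → Seminorm ℝ S.Y) (C r : ℝ) : Prop :=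
  ∀ t, 0 ≤ t → ∀ (α : Fin n → ℕ) (y : S.Y),
    N t (S.e t (S.Lc α y)) ≤ C * fact α * r ^ len α * ∑ i, N t (S.e t (S.A i y))

/-- `∑_{|β| ≤ 1} M_{|β|} ‖e^{tL} A^{γ+β} y‖_{X_t}`. -/
def firstOrder (N : ℝ → Seminorm ℝ S.Y) (M₀ M₁ : ℝ) (t : ℝ) (γ : Fin n → ℕ) (y : S.Y) : ℝ :=
  M₀ * N t (S.e t (S.pw γ y)) + ∑ i, M₁ * N t (S.e t (S.pw (γ + unit i) y))

/-- The growth bound on the nonlinearity. -/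
def H3a (N : ℝ → Seminorm ℝ S.Y) (Q : ℝ → S.Y → S.Y) (ω M₀ M₁ : ℝ) : Prop :=
  ∀ t, 0 < t → ∀ (α : Fin n → ℕ) (y : S.Y),
    N t (S.e t (S.pw α (Q t y))) ≤ Real.exp (-ω * t) *
      ∑ γ ∈ Finset.Icc 0 α, binom α γ *
        (N t (S.e t (S.pw (α - γ) y)) * S.firstOrder N M₀ M₁ t γ y)

/-- The expression under the supremum in the Lipschitz bound. -/
def lipTerm (N : ℝ → Seminorm ℝ S.Y) (M₀ M₁ : ℝ) (t : ℝ) (α : Fin n → ℕ)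
    (x y z z' : S.Y) : ℝ :=
  ∑ γ ∈ Finset.Icc 0 α, binom α γ *
    (N t (S.e t (S.pw (α - γ) z)) * S.firstOrder N M₀ M₁ t γ (y - x) +
      N t (S.e t (S.pw (α - γ) (y - x))) * S.firstOrder N M₀ M₁ t γ z')

/-- The Lipschitz bound on the nonlinearity:
`‖e^{tL} A^α (Q_t(y) - Q_t(x))‖_{X_t} ≤ e^{-ωt} sup_{z, z' ∈ [x,y]} lipTerm`.
That a number is at most a supremum is expressed by its being at most every upper bound. -/
def H3b (N : ℝ → Seminorm ℝ S.Y) (Q : ℝ → S.Y → S.Y) (ω M₀ M₁ : ℝ) : Prop :=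
  ∀ t, 0 < t → ∀ (α : Fin n → ℕ) (x y : S.Y) (B : ℝ),
    (∀ z ∈ segment ℝ x y, ∀ z' ∈ segment ℝ x y, S.lipTerm N M₀ M₁ t α x y z z' ≤ B) →
      N t (S.e t (S.pw α (Q t y - Q t x))) ≤ Real.exp (-ω * t) * B

/-- `∂ₜ ‖x(t)‖_{X_t} ≤ ‖∂ₜ x(t)‖_{X_t}` along curves of class `C¹_L`, with `∂ₜ` on the left
the upper right Dini derivative (a norm need not be differentiable). -/
def H4 (N : ℝ → Seminorm ℝ S.Y) : Prop :=
  ∀ x x' : ℝ → S.Y, S.CL1 x →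
    (∀ t, 0 ≤ t → HasDerivWithinAt (fun s => (x s : X)) (x' t : X) (Ici 0) t) →
    ∀ t, 0 ≤ t → ∀ m : ℝ, N t (x' t) < m →
      ∀ᶠ s in 𝓝[>] t, (N s (x s) - N t (x t)) / (s - t) < m

/-- The analytic norm `‖y‖_{X_t^ν} = ∑_α ν^{|α|} / α! ‖A_{tL}^α y‖_{X_t} ∈ [0,∞]`. -/
noncomputable def anorm (N : ℝ → Seminorm ℝ S.Y) (t ν : ℝ) (y : S.Y) : ENNReal :=
  ∑' α : Fin n → ℕ, ENNReal.ofReal (ν ^ len α / fact α * N t (S.conj t α y))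

/-- `u` is a global strong solution of `∂ₜ u = Q_{tL}(u)`, `u(0) = u₀`: it is of class
`C⁰_L([0,∞);Y)`, is differentiable in `X` on `[0,∞)`, and satisfies the equation in `X` at every
`t ≥ 0`. -/
structure IsStrongSolution (Q : ℝ → S.Y → S.Y) (u₀ : S.Y) (u : ℝ → S.Y) : Prop where
  regular : S.CL0 u
  initial : u 0 = u₀
  eqn : ∀ t, 0 ≤ t →
    HasDerivWithinAt (fun s => (u s : X)) (S.transf Q t (u t) : X) (Ici 0) t

end Setting

end AnalyticEvolution

/-! The proof is an energy estimate in analytic norms whose radius shrinks like `μ e^{-ωt}`.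
Differentiating the weight of the term of index `α` produces `-ω|α|` times that term. Summed over
`α`, this is a gain of `ω ν∂_ν‖u‖` (`gnorm`, integrated in time as `gint`), which has to pay for two
losses of a derivative.

The first loss is linear. Since `u` is measured through `A_{tL}^α u`, the commutator `[L, A^α]`
appears. Expanding it in the `L_γ`, `γ ≠ 0` (`pw_mul_L`), and using (H2′), the weights `ν^{|α|}/α!`
turn the loss into a convolution, at most `nCr/(1-rν₀)^n` times `gnorm`. The restriction on `ν₀`
says precisely that this is less than `ω`, so a fraction `δω` of the gain survives (`exists_gap`,
`tsum_add_tsum_le`, `energy_le`).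

The second loss is in `Q`, which is quadratic and of first order. By the product structure of the
norms its size is `e^{-ωt}‖u‖(M₀‖u‖ + M₁ ∂_ν‖u‖)`, and at radius `μ e^{-ωt}` the factor `e^{-ωt}`
turns `∂_ν` into `μ⁻¹ ν∂_ν` (`exp_mul_dnorm`). If `‖u‖ ≤ A ≤ ημ` with `η` small, the surviving gain
absorbs it. The integration map `u ↦ u₀ + ∫ Q_{sL}(u)` therefore preserves a ball and halves
differences, measured by norm plus integrated gain (`controlled_step`, `energy_sub_le`), and the
Picard iterates converge.

For stability the integrated gain of a given solution is not known to be finite. At radius `θν`, `θ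
< 1`, it is, because shrinking the radius buys a derivative; the contraction estimate gives the
factor 2 there, uniformly in `θ`, and `θ → 1` concludes.

Differentiating `A_{tL}^α u` requires analysis in the Fréchet space `Y`. The closed graph theorem
and uniform boundedness make the group jointly continuous and `L` continuous on `Y`, so that `C⁰_L`
is ordinary continuity into `Y`. Continuity of the norms `X_s`, `s > 0`, on `Y` is deduced from
their continuity along curves (`norm_tendsto`); it is needed to pass to the limit in the iteration.
-/

namespace AnalyticEvolution

namespace Setting

variable {n : ℕ} {X : Type*} [NormedAddCommGroup X] [NormedSpace ℝ X] (S : Setting n X)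

/-! ### The Fréchet space `Y` -/

/-- `Y` with the Fréchet topology of the seminorms `y ↦ ‖A^α y‖`. -/
def Frechet : Type _ := S.Y

instance : AddCommGroup S.Frechet := inferInstanceAs (AddCommGroup S.Y)

instance : Module ℝ S.Frechet := inferInstanceAs (Module ℝ S.Y)

/-- The embedding `y ↦ (A^α y)_α` of `Y` in a product of copies of `X`. -/
def emb : S.Frechet →ₗ[ℝ] ((Fin n → ℕ) → X) :=
  LinearMap.pi fun α => S.Y.subtype ∘ₗ S.pw α

theorem pw_zero : S.pw 0 = 1 := mpow_zero _

theorem pw_add_unit (α : Fin n → ℕ) (i : Fin n) : S.pw (α + unit i) = S.pw α * S.A i :=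
  mpow_add_unit _ S.A_comm α i

instance : UniformSpace S.Frechet := UniformSpace.comap S.emb inferInstance

theorem isUniformInducing_emb : IsUniformInducing S.emb := ⟨rfl⟩

theorem isInducing_emb : IsInducing S.emb := S.isUniformInducing_emb.isInducing

instance : IsUniformAddGroup S.Frechet := IsUniformAddGroup.comap S.emb

instance : ContinuousSMul ℝ S.Frechet := by
  refine ⟨S.isInducing_emb.continuous_iff.2 ?_⟩
  have : (S.emb ∘ fun p : ℝ × S.Frechet => p.1 • p.2) = fun p => p.1 • S.emb p.2 := by
    funext p; simp
  rw [this]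
  exact continuous_fst.smul (S.isInducing_emb.continuous.comp continuous_snd)

theorem emb_injective : Function.Injective S.emb := by
  intro x y h
  have h0 := congrFun h 0
  have h1 : ((S.pw 0 x : S.Y) : X) = (S.pw 0 y : S.Y) := h0
  rw [pw_zero] at h1
  exact Subtype.ext h1

theorem tendsto_iff {ι : Type*} {l : Filter ι} {v : ι → S.Y} {y : S.Y} :
    Tendsto (β := S.Frechet) v l (@nhds S.Frechet _ y) ↔
      ∀ α, Tendsto (fun i => (S.pw α (v i) : X)) l (𝓝 (S.pw α y : X)) :=
  (IsInducing.tendsto_nhds_iff (Y := S.Frechet) (f := v) (y := y) S.isInducing_emb).trans tendsto_pi_nhds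

/-- The completeness axiom of `Setting` speaks of sequences; that is enough because a countable
product of copies of `X` is first countable. -/
theorem isClosed_range_emb : IsClosed (range S.emb) := by
  refine IsSeqClosed.isClosed fun z x hz hx => ?_
  choose y hy using hz
  obtain ⟨y', hy'⟩ := S.complete y x (fun α => by
    have := (tendsto_pi_nhds.1 hx) α
    refine this.congr fun k => ?_
    rw [← hy k]; rfl)
  exact ⟨y', funext hy'⟩

theorem isClosedEmbedding_emb : IsClosedEmbedding S.emb :=
  ⟨⟨S.isInducing_emb, S.emb_injective⟩, S.isClosed_range_emb⟩

instance [CompleteSpace X] : TopologicalSpace.IsCompletelyMetrizableSpace S.Frechet :=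
  S.isClosedEmbedding_emb.IsCompletelyMetrizableSpace

/-- Baire's theorem gives barrelledness, hence uniform boundedness for families of operators on `Y`.
-/
instance [CompleteSpace X] : BarrelledSpace ℝ S.Frechet := inferInstance

/-- The increasing sequence of seminorms `y ↦ ∑ ‖A^α y‖`, the sum over `α ≤ (k, …, k)`. -/
noncomputable def sn (k : ℕ) : Seminorm ℝ S.Y :=
  ∑ α ∈ Finset.Icc (0 : Fin n → ℕ) (fun _ => k), (normSeminorm ℝ X).comp (S.Y.subtype ∘ₗ S.pw α)

theorem sn_apply (k : ℕ) (y : S.Y) :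
    S.sn k y = ∑ α ∈ Finset.Icc (0 : Fin n → ℕ) (fun _ => k), ‖(S.pw α y : X)‖ := by
  have h : ∀ s : Finset (Fin n → ℕ), (∑ α ∈ s, (normSeminorm ℝ X).comp
      (S.Y.subtype ∘ₗ S.pw α)) y = ∑ α ∈ s, ‖(S.pw α y : X)‖ := by
    intro s
    induction s using Finset.cons_induction with
    | empty => simp
    | cons a s ha ih => rw [Finset.sum_cons, Finset.sum_cons, add_apply, ih]; rfl
  exact h _

theorem sn_mono {k m : ℕ} (h : k ≤ m) (y : S.Y) : S.sn k y ≤ S.sn m y := by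
  rw [sn_apply, sn_apply]
  refine Finset.sum_le_sum_of_subset_of_nonneg ?_ fun _ _ _ => norm_nonneg _
  exact Finset.Icc_subset_Icc_right fun _ => h

theorem norm_pw_le_sn {α : Fin n → ℕ} {k : ℕ} (h : ∀ i, α i ≤ k) (y : S.Y) :
    ‖(S.pw α y : X)‖ ≤ S.sn k y := by
  rw [sn_apply]
  exact Finset.single_le_sum (f := fun α => ‖(S.pw α y : X)‖) (fun _ _ => norm_nonneg _)
    (Finset.mem_Icc.2 ⟨zero_le, h⟩)

theorem exists_norm_pw_le_sn (α : Fin n → ℕ) :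
    ∃ k, ∀ m, k ≤ m → ∀ y : S.Y, ‖(S.pw α y : X)‖ ≤ S.sn m y :=
  ⟨∑ i, α i, fun _ hm y => S.norm_pw_le_sn (fun i =>
    (Finset.single_le_sum (f := α) (fun _ _ => zero_le) (Finset.mem_univ i)).trans hm) y⟩

theorem continuous_sn (k : ℕ) : Continuous (X := S.Frechet) (S.sn k) := by
  have : (S.sn k : S.Frechet → ℝ) = fun y =>
      ∑ α ∈ Finset.Icc (0 : Fin n → ℕ) (fun _ => k), ‖S.emb y α‖ := by
    funext y; exact S.sn_apply k y
  rw [this]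
  exact continuous_finsetSum _ fun α _ =>
    ((continuous_apply α).comp S.isInducing_emb.continuous).norm

theorem tendsto_of_sn {ι : Type*} {l : Filter ι} {v : ι → S.Y} {y : S.Y}
    (h : ∀ k, Tendsto (fun i => S.sn k (v i - y)) l (𝓝 0)) (α : Fin n → ℕ) :
    Tendsto (fun i => (S.pw α (v i) : X)) l (𝓝 (S.pw α y : X)) := by
  obtain ⟨k, hk⟩ := S.exists_norm_pw_le_sn α
  rw [tendsto_iff_norm_sub_tendsto_zero]
  refine squeeze_zero (fun _ => norm_nonneg _) (fun i => ?_) (h k)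
  simpa using hk k le_rfl (v i - y)

/-- Every neighbourhood in the Fréchet topology contains a seminorm ball. -/
theorem exists_sn_ball {U : Set S.Frechet} {x : S.Y} (hU : U ∈ @nhds S.Frechet _ x) :
    ∃ m : ℕ, ∃ δ : ℝ, 0 < δ ∧ ∀ y : S.Y, S.sn m (y - x) < δ → y ∈ U := by
  by_contra! H
  choose y hy hyU using fun m : ℕ => H m (1 / ((m : ℝ) + 1)) (by positivity)
  have hlim : Tendsto (β := S.Frechet) y atTop (@nhds S.Frechet _ x) := by
    rw [tendsto_iff]
    refine S.tendsto_of_sn fun k => ?_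
    refine squeeze_zero' (Eventually.of_forall fun _ => apply_nonneg _ _) ?_
      tendsto_one_div_add_atTop_nhds_zero_nat
    filter_upwards [eventually_ge_atTop k] with m hm
    exact (S.sn_mono hm _).trans (hy m).le
  obtain ⟨m, hm⟩ := (hlim.eventually hU).exists
  exact hyU m hm

/-- Sequences that are Cauchy for all seminorms converge. -/
theorem exists_tendsto_of_summable [CompleteSpace X] (x : ℕ → S.Y) (b : ℕ → ℝ) (hb : Summable b)
    (k₀ : ℕ) (hx : ∀ j, S.sn (k₀ + j) (x j) ≤ b j) :
    ∃ z : S.Y, (∀ α, Tendsto (fun m => (S.pw α (∑ j ∈ Finset.range m, x j) : X)) atTop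
      (𝓝 (S.pw α z : X))) := by
  have hs : ∀ α, Summable fun j => (S.pw α (x j) : X) := by
    intro α
    obtain ⟨k, hk⟩ := S.exists_norm_pw_le_sn α
    refine Summable.of_norm_bounded_eventually_nat hb ?_
    filter_upwards [eventually_ge_atTop k] with j hj
    exact (hk (k₀ + j) (by omega) _).trans (hx j)
  obtain ⟨z, hz⟩ := S.complete (fun m => ∑ j ∈ Finset.range m, x j)
    (fun α => ∑' j, (S.pw α (x j) : X)) (fun α => by
      have := (hs α).hasSum.tendsto_sum_nat
      refine this.congr fun m => ?_
      change _ = ((S.pw α (∑ j ∈ Finset.range m, x j) : S.Y) : X)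
      rw [map_sum, Submodule.coe_sum])
  refine ⟨z, fun α => ?_⟩
  have h1 : ((S.pw α z : S.Y) : X) = ∑' j, (S.pw α (x j) : X) := hz α
  rw [h1]
  refine (hs α).hasSum.tendsto_sum_nat.congr fun m => ?_
  rw [map_sum, Submodule.coe_sum]

/-- The Baire half of the closed graph theorem. The closures of the sets `{sn k (T y) ≤ j}` cover
`Y`, so one of them contains a ball about some `x₀`; taking differences moves the ball to the
origin. Membership in a closure gives only approximants, but in any prescribed seminorm `sn M` and
with any error `η`. -/
theorem baire_approx [CompleteSpace X] (T : Module.End ℝ S.Y) (k : ℕ) :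
    ∃ m : ℕ, ∃ c : ℝ, 0 < c ∧ ∀ ε : ℝ, 0 < ε → ∀ y : S.Y, S.sn m y ≤ c * ε →
      ∀ M : ℕ, ∀ η : ℝ, 0 < η → ∃ y' : S.Y, S.sn k (T y') ≤ ε ∧ S.sn M (y - y') < η := by
  let F : ℕ → Set S.Frechet := fun j => closure {y | S.sn k (T y) ≤ j}
  have hcov : (⋃ j, F j) = univ := by
    refine eq_univ_of_forall fun y => mem_iUnion.2 ?_
    obtain ⟨j, hj⟩ := exists_nat_ge (S.sn k (T y))
    exact ⟨j, subset_closure hj⟩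
  obtain ⟨j, x₁, hx₁⟩ := nonempty_interior_of_iUnion_of_closed
    (fun j => isClosed_closure (X := S.Frechet)) hcov
  obtain ⟨x₀, hx₀⟩ : ∃ x₀ : S.Y, F j ∈ @nhds S.Frechet _ x₀ :=
    ⟨x₁, mem_interior_iff_mem_nhds.1 hx₁⟩
  obtain ⟨m, δ, hδ, hball⟩ := S.exists_sn_ball hx₀
  have approx : ∀ x : S.Y, x ∈ F j → ∀ M : ℕ, ∀ η : ℝ, 0 < η →
      ∃ y' : S.Y, S.sn k (T y') ≤ j ∧ S.sn M (x - y') < η := by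
    intro x hx M η hη
    have hc : Continuous (X := S.Frechet) fun y : S.Y => S.sn M (x - y) :=
      (S.continuous_sn M).comp
        ((continuous_const (X := S.Frechet) (Y := S.Frechet) (y := x)).sub continuous_id)
    have hopen : IsOpen (X := S.Frechet) {y : S.Y | S.sn M (x - y) < η} :=
      isOpen_lt hc continuous_const
    obtain ⟨y', h1, h2⟩ := (mem_closure_iff (X := S.Frechet)).1 hx _ hopen (by
      change S.sn M ((x : S.Y) - x) < η
      rw [sub_self, map_zero]; exact hη)
    exact ⟨y', h2, h1⟩
  -- With `s = ε / (2(j+1))` the vector `s⁻¹ y` has size at most `δ/2`, inside the ball, and the two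
  -- approximants contribute at most `2j ≤ ε/s` to the bound on `T`.
  refine ⟨m, δ / (4 * (j + 1)), by positivity, fun ε hε y hy M η hη => ?_⟩
  set s : ℝ := ε / (2 * (j + 1)) with hs
  have hs0 : 0 < s := by positivity
  have hsy : S.sn m (s⁻¹ • y) < δ := by
    rw [map_smul_eq_mul, Real.norm_of_nonneg (by positivity)]
    have : s⁻¹ * S.sn m y ≤ s⁻¹ * (δ / (4 * (j + 1)) * ε) := by gcongr
    refine this.trans_lt ?_
    rw [hs]
    have : (ε / (2 * ((j : ℝ) + 1)))⁻¹ * (δ / (4 * (j + 1)) * ε) = δ / 2 := by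
      field_simp; ring
    rw [this]; linarith
  obtain ⟨a, ha, ha'⟩ := approx (x₀ + s⁻¹ • y : S.Y) (hball (x₀ + s⁻¹ • y : S.Y) (by
    have : ((x₀ + s⁻¹ • y : S.Y) - x₀ : S.Y) = s⁻¹ • y := add_sub_cancel_left _ _
    rw [this]; exact hsy)) M (η / (2 * s)) (by positivity)
  obtain ⟨b, hb, hb'⟩ := approx x₀ (hball x₀ (by
    have : ((x₀ : S.Y) - x₀ : S.Y) = 0 := sub_self _
    rw [this, map_zero]; exact hδ)) M (η / (2 * s)) (by positivity)
  refine ⟨s • (a - b), ?_, ?_⟩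
  · rw [map_smul, map_smul_eq_mul, Real.norm_of_nonneg hs0.le, map_sub]
    have h1 : S.sn k (T a - T b) ≤ j + j := (map_sub_le_add _ _ _).trans (add_le_add ha hb)
    calc s * S.sn k (T a - T b) ≤ s * (2 * (j + 1)) := by
          gcongr; linarith
      _ = ε := by rw [hs]; field_simp
  · have h2 : y - s • (a - b) = s • (((x₀ + s⁻¹ • y : S.Y) - a) - ((x₀ : S.Y) - b)) := by
      have : s • s⁻¹ • y = y := smul_inv_smul₀ hs0.ne' y
      have e1 : (((x₀ + s⁻¹ • y : S.Y) - a) - ((x₀ : S.Y) - b)) = s⁻¹ • y - (a - b) := by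
        abel
      rw [e1, smul_sub s (s⁻¹ • y), this]
    rw [h2, map_smul_eq_mul, Real.norm_of_nonneg hs0.le]
    have h3 := map_sub_le_add (S.sn M) ((x₀ + s⁻¹ • y : S.Y) - a) ((x₀ : S.Y) - b)
    calc s * _ ≤ s * (S.sn M ((x₀ + s⁻¹ • y : S.Y) - a) + S.sn M ((x₀ : S.Y) - b)) := by gcongr
      _ < s * (η / (2 * s) + η / (2 * s)) := by gcongr
      _ = η := by field_simp; ring

/-- The closed graph theorem for the Fréchet space `Y`. -/
theorem closed_graph [CompleteSpace X] (T : Module.End ℝ S.Y)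
    (hT : ∀ (x : ℕ → S.Y) (y z : S.Y),
      (∀ α, Tendsto (fun k => (S.pw α (x k) : X)) atTop (𝓝 (S.pw α y : X))) →
      (∀ α, Tendsto (fun k => (S.pw α (T (x k)) : X)) atTop (𝓝 (S.pw α z : X))) → T y = z)
    (k : ℕ) : ∃ m : ℕ, ∃ c : ℝ, 0 < c ∧ ∀ y : S.Y, S.sn m y ≤ c → S.sn k (T y) ≤ 2 := by
  choose m c hc hm using fun k => S.baire_approx T k
  refine ⟨m k, c k, hc k, fun y hy => ?_⟩
  -- Successive approximation: `R` is the residual after `j` corrections. The new residual must be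
  -- small in two seminorms, in `sn (m (k + (j + 1)))` so that the next step applies, and in `sn j`
  -- so that the corrections sum to `y`.
  have step : ∀ j : ℕ, ∀ R : S.Y, S.sn (m (k + j)) R ≤ c (k + j) * (1 / 2) ^ j →
      ∃ x : S.Y, S.sn (k + j) (T x) ≤ (1 / 2) ^ j ∧
        S.sn (m (k + (j + 1))) (R - x) ≤ c (k + (j + 1)) * (1 / 2) ^ (j + 1) ∧
        S.sn j (R - x) ≤ (1 / 2) ^ j := by
    intro j R hR
    have hp := hc (k + (j + 1))
    obtain ⟨x, h1, h2⟩ := hm (k + j) _ (by positivity) R hR (max (m (k + (j + 1))) j)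
      (min (c (k + (j + 1)) * (1 / 2) ^ (j + 1)) ((1 / 2) ^ j)) (by positivity)
    exact ⟨x, h1, (S.sn_mono (le_max_left _ _) _).trans (h2.le.trans (min_le_left _ _)),
      (S.sn_mono (le_max_right _ _) _).trans (h2.le.trans (min_le_right _ _))⟩
  choose! f hf1 hf2 hf3 using step
  let R : ℕ → S.Y := fun j => Nat.rec y (fun j R => R - f j R) j
  have hR : ∀ j, S.sn (m (k + j)) (R j) ≤ c (k + j) * (1 / 2) ^ j := by
    intro j
    induction j with
    | zero => simpa [R] using hy
    | succ j ih => exact hf2 j (R j) ih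
  let x : ℕ → S.Y := fun j => f j (R j)
  have hRs : ∀ j, R (j + 1) = R j - x j := fun j => rfl
  have hsum : ∀ j, ∑ i ∈ Finset.range j, x i = y - R j := by
    intro j
    induction j with
    | zero => simp [R]
    | succ j ih => rw [Finset.sum_range_succ, ih, hRs]; abel
  have hgeo : Summable fun j : ℕ => (1 / 2 : ℝ) ^ j := summable_geometric_two
  obtain ⟨z, hz⟩ := S.exists_tendsto_of_summable (fun j => T (x j)) _ hgeo k
    (fun j => hf1 j (R j) (hR j))
  have hlim : ∀ α, Tendsto (fun j => (S.pw α (∑ i ∈ Finset.range j, x i) : X)) atTop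
      (𝓝 (S.pw α y : X)) := by
    refine S.tendsto_of_sn fun i => ?_
    rw [← tendsto_add_atTop_iff_nat 1]
    refine squeeze_zero' (Eventually.of_forall fun _ => apply_nonneg _ _) ?_
      (tendsto_pow_atTop_nhds_zero_of_lt_one (r := (1 / 2 : ℝ)) (by norm_num) (by norm_num))
    filter_upwards [eventually_ge_atTop i] with j hj
    rw [hsum, sub_sub_cancel_left, map_neg_eq_map]
    exact (S.sn_mono hj _).trans (hf3 j (R j) (hR j))
  -- The only use of the closed graph: the partial sums tend to `y`, their images to `z`.
  have hTy : T y = z := hT _ y z hlim (fun α => by simpa only [map_sum] using hz α)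
  rw [hTy]
  have hzlim : Tendsto (β := S.Frechet) (fun j => ∑ i ∈ Finset.range j, T (x i)) atTop
      (@nhds S.Frechet _ z) := S.tendsto_iff.2 hz
  refine le_of_tendsto' (((S.continuous_sn k).tendsto _).comp hzlim) fun j => ?_
  calc S.sn k (∑ i ∈ Finset.range j, T (x i))
      ≤ ∑ i ∈ Finset.range j, S.sn k (T (x i)) :=
        Finset.le_sum_of_subadditive (S.sn k) (map_zero _).le (map_add_le_add _) _ _
    _ ≤ ∑ i ∈ Finset.range j, (1 / 2 : ℝ) ^ i := by
        gcongr with i _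
        exact (S.sn_mono (by omega) _).trans (hf1 i (R i) (hR i))
    _ ≤ 2 := sum_geometric_two_le j

theorem closed_graph_tendsto [CompleteSpace X] (T : Module.End ℝ S.Y)
    (hT : ∀ (x : ℕ → S.Y) (y z : S.Y),
      (∀ α, Tendsto (fun k => (S.pw α (x k) : X)) atTop (𝓝 (S.pw α y : X))) →
      (∀ α, Tendsto (fun k => (S.pw α (T (x k)) : X)) atTop (𝓝 (S.pw α z : X))) → T y = z) :
    Continuous (X := S.Frechet) (Y := S.Frechet) T := by
  refine (@continuous_iff_continuousAt S.Frechet S.Frechet _ _ _).2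
    (show ∀ x : S.Y, Tendsto (β := S.Frechet) T (@nhds S.Frechet _ x) (@nhds S.Frechet _ (T x))
      from fun x => ?_)
  refine (S.tendsto_iff (ι := S.Frechet) (v := T) (y := T x)).2 (S.tendsto_of_sn fun k => ?_)
  obtain ⟨m, c, hc, h⟩ := S.closed_graph T hT k
  have hbound : ∀ y : S.Y, S.sn k (T y) ≤ 2 / c * S.sn m y := by
    intro y
    refine le_of_forall_pos_le_add fun e he => ?_
    -- The summand `c * e / 2` keeps the denominator positive when `sn m y = 0` and contributes
    -- exactly the error `e` to `2 / a`.
    set a : ℝ := c / (S.sn m y + c * e / 2) with ha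
    have h0 : 0 ≤ S.sn m y := apply_nonneg _ _
    have ha0 : 0 < a := by positivity
    have := h (a • y) (by
      rw [map_smul_eq_mul, Real.norm_of_nonneg ha0.le, ha, div_mul_eq_mul_div,
        div_le_iff₀ (by positivity)]
      gcongr
      linarith [show 0 < c * e / 2 by positivity])
    rw [map_smul, map_smul_eq_mul, Real.norm_of_nonneg ha0.le] at this
    have h2 : S.sn k (T y) ≤ 2 / a := by rw [le_div_iff₀ ha0]; linarith
    refine h2.trans (le_of_eq ?_)
    rw [ha]; field_simp
  have hc' : Continuous (X := S.Frechet) fun y : S.Y => 2 / c * S.sn m (y - x : S.Y) :=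
    continuous_const.mul ((S.continuous_sn m).comp
      (continuous_id.sub (continuous_const (X := S.Frechet) (Y := S.Frechet) (y := x))))
  have h0 : Tendsto (fun y : S.Y => 2 / c * S.sn m (y - x : S.Y)) (@nhds S.Frechet _ x) (𝓝 0) := by
    have h1 := hc'.tendsto x
    have hz : 2 / c * S.sn m ((x : S.Y) - x : S.Y) = 0 := by
      have : ((x : S.Y) - x : S.Y) = 0 := sub_self _
      rw [this, map_zero, mul_zero]
    rwa [hz] at h1
  refine squeeze_zero (fun _ => apply_nonneg _ _) (fun y => ?_) h0
  exact (congrArg (S.sn k) (map_sub T y x)).symm.trans_le (hbound _)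

end Setting

end AnalyticEvolution

/-! ### Induction on multi-indices and powers of the operators. -/

namespace AnalyticEvolution

namespace Setting

variable {n : ℕ} {X : Type*} [NormedAddCommGroup X] [NormedSpace ℝ X] (S : Setting n X)

theorem unit_le {i : Fin n} {β : Fin n → ℕ} (h : 1 ≤ β i) : unit i ≤ β := by
  intro j
  by_cases hj : j = i
  · subst hj; simpa [unit] using h
  · simp [unit, hj]

theorem len_add (α β : Fin n → ℕ) : len (α + β) = len α + len β := by
  simp [len, Finset.sum_add_distrib]

theorem len_unit (i : Fin n) : len (unit i) = 1 := by simp [len, unit]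

theorem multi_induction {P : (Fin n → ℕ) → Prop} (h0 : P 0)
    (hs : ∀ α i, P α → P (α + unit i)) (β : Fin n → ℕ) : P β := by
  induction hm : len β generalizing β with
  | zero =>
    have : β = 0 := funext fun i => Finset.sum_eq_zero_iff.1 hm i (Finset.mem_univ i)
    rwa [this]
  | succ m ih =>
    obtain ⟨i, hi⟩ : ∃ i, 1 ≤ β i := by
      by_contra! hcon
      have : len β = 0 := Finset.sum_eq_zero fun i _ => by have := hcon i; omega
      omega
    have hβ : (β - unit i) + unit i = β := tsub_add_cancel_of_le (unit_le hi)
    rw [← hβ]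
    refine hs _ _ (ih _ ?_)
    have h2 : len β = len (β - unit i) + 1 := by
      conv_lhs => rw [← hβ]
      rw [len_add, len_unit]
    omega

theorem pw_add (α β : Fin n → ℕ) : S.pw (α + β) = S.pw α * S.pw β := by
  induction β using multi_induction with
  | h0 => rw [add_zero, pw_zero, mul_one]
  | hs β i ih => rw [← add_assoc, pw_add_unit, pw_add_unit, ih, mul_assoc]

/-! ### The group on `X` and on `Y` -/

theorem e_coe (t : ℝ) (y : S.Y) : (S.e t y : X) = S.G.op t y := rfl

theorem e_zero : S.e 0 = 1 := by
  ext y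
  simp [e_coe, S.G.op_zero]

theorem e_add (s t : ℝ) : S.e (s + t) = S.e s * S.e t := by
  ext y
  simp [e_coe, S.G.op_add]

theorem e_e_neg (t : ℝ) (y : S.Y) : S.e t (S.e (-t) y) = y := by
  rw [← Module.End.mul_apply, ← e_add, add_neg_cancel, e_zero, Module.End.one_apply]

theorem e_neg_e (t : ℝ) (y : S.Y) : S.e (-t) (S.e t y) = y := by
  rw [← Module.End.mul_apply, ← e_add, neg_add_cancel, e_zero, Module.End.one_apply]

theorem conj_apply (t : ℝ) (α : Fin n → ℕ) (y : S.Y) :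
    S.conj t α y = S.e t (S.pw α (S.e (-t) y)) := rfl

theorem conj_zero_right (t : ℝ) (y : S.Y) : S.conj t 0 y = y := by
  rw [conj_apply, pw_zero, Module.End.one_apply, e_e_neg]

theorem continuous_orbit (α : Fin n → ℕ) (y : S.Y) :
    Continuous fun t => (S.pw α (S.e t y) : X) := S.orbit_cont α y

/-- By Banach–Steinhaus the group is bounded uniformly on compact time intervals, which upgrades
strong continuity to joint continuity. -/
theorem op_tendsto [CompleteSpace X] {ι : Type*} {l : Filter ι} {τ : ι → ℝ} {τ₀ : ℝ} {v : ι → X}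
    {v₀ : X} (hτ : Tendsto τ l (𝓝 τ₀)) (hv : Tendsto v l (𝓝 v₀)) :
    Tendsto (fun i => S.G.op (τ i) (v i)) l (𝓝 (S.G.op τ₀ v₀)) := by
  obtain ⟨K, hK⟩ := banach_steinhaus (g := fun t : Icc (τ₀ - 1) (τ₀ + 1) => S.G.op t) (fun x => by
    obtain ⟨K, hK⟩ := isCompact_Icc.exists_bound_of_continuousOn
      ((S.G.strong_cont x).continuousOn (s := Icc (τ₀ - 1) (τ₀ + 1)))
    exact ⟨K, fun t => hK t t.2⟩)
  have h1 : Tendsto (fun i => S.G.op (τ i) v₀) l (𝓝 (S.G.op τ₀ v₀)) :=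
    ((S.G.strong_cont v₀).tendsto τ₀).comp hτ
  have h2 : Tendsto (fun i => S.G.op (τ i) (v i - v₀)) l (𝓝 0) := by
    have hz : Tendsto (fun i => K * ‖v i - v₀‖) l (𝓝 0) := by
      have := (tendsto_iff_norm_sub_tendsto_zero.1 hv).const_mul K
      simpa using this
    rw [tendsto_zero_iff_norm_tendsto_zero]
    refine squeeze_zero' (Eventually.of_forall fun _ => norm_nonneg _) ?_ hz
    filter_upwards [hτ.eventually (Icc_mem_nhds (sub_one_lt τ₀) (lt_add_one τ₀))] with i hi
    exact (S.G.op (τ i)).le_of_opNorm_le (hK ⟨τ i, hi⟩) _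
  have := h2.add h1
  rw [zero_add] at this
  refine this.congr fun i => ?_
  rw [map_sub, sub_add_cancel]

/-- The graph is closed because convergence in `Y` implies convergence in `X`, where `e^{tL}` is
continuous and limits are unique. -/
theorem continuous_e [CompleteSpace X] (t : ℝ) :
    Continuous (X := S.Frechet) (Y := S.Frechet) (S.e t) := by
  refine S.closed_graph_tendsto _ fun x y z hx hTx => ?_
  have h0 := hx 0
  have h1 := hTx 0
  simp only [pw_zero, Module.End.one_apply] at h0 h1
  exact Subtype.ext (tendsto_nhds_unique (((S.G.op t).continuous.tendsto _).comp h0) h1)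

/-- The group acts jointly continuously on the Fréchet space `Y`. -/
theorem e_tendsto [CompleteSpace X] {ι : Type*} {l : Filter ι} {τ : ι → ℝ} {τ₀ : ℝ} {v : ι → S.Y}
    {v₀ : S.Y} (hτ : Tendsto τ l (𝓝 τ₀))
    (hv : ∀ α, Tendsto (fun i => (S.pw α (v i) : X)) l (𝓝 (S.pw α v₀ : X))) (α : Fin n → ℕ) :
    Tendsto (fun i => (S.pw α (S.e (τ i) (v i)) : X)) l (𝓝 (S.pw α (S.e τ₀ v₀) : X)) := by
  -- Continuous orbits make the seminorms `y ↦ ‖A^α e^{tL} y‖`, for `t` in a compact interval,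
  -- pointwise bounded. As `Y` is barrelled their supremum is continuous, which gives the uniformity
  -- in `t`.
  let p : Icc (τ₀ - 1) (τ₀ + 1) → Seminorm ℝ S.Frechet := fun t =>
    (normSeminorm ℝ X).comp (S.Y.subtype ∘ₗ S.pw α ∘ₗ S.e t : S.Y →ₗ[ℝ] X)
  have hp : ∀ t, Continuous (p t) := fun t =>
    continuous_norm.comp (((continuous_apply α).comp S.isInducing_emb.continuous).comp
      (S.continuous_e t))
  have hbdd : BddAbove (range p) := by
    rw [Seminorm.bddAbove_range_iff]
    intro y
    obtain ⟨K, hK⟩ := isCompact_Icc.exists_bound_of_continuousOn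
      ((S.continuous_orbit α y).continuousOn (s := Icc (τ₀ - 1) (τ₀ + 1)))
    exact ⟨K, by rintro _ ⟨t, rfl⟩; exact hK t t.2⟩
  have hq : Continuous fun y => (⨆ i, p i) y := by
    have := Seminorm.continuous_iSup p hp hbdd
    rwa [← Seminorm.coe_iSup_eq hbdd] at this
  have hle : ∀ t y, p t y ≤ (⨆ i, p i) y := fun t y => le_ciSup hbdd t y
  have h1 : Tendsto (fun i => (S.pw α (S.e (τ i) v₀) : X)) l (𝓝 (S.pw α (S.e τ₀ v₀) : X)) :=
    ((S.continuous_orbit α v₀).tendsto τ₀).comp hτ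
  have h2 : Tendsto (fun i => (S.pw α (S.e (τ i) (v i - v₀)) : X)) l (𝓝 0) := by
    have hv0 : Tendsto (β := S.Frechet) (fun i => v i - v₀) l (@nhds S.Frechet _ (0 : S.Y)) := by
      rw [tendsto_iff]
      intro β
      have := (hv β).sub_const (S.pw β v₀ : X)
      simpa using this
    have hz : Tendsto (fun i => (⨆ i, p i) (v i - v₀ : S.Y)) l (𝓝 0) := by
      have := (hq.tendsto (0 : S.Frechet)).comp hv0
      rw [map_zero] at this
      exact this
    rw [tendsto_zero_iff_norm_tendsto_zero]
    refine squeeze_zero' (Eventually.of_forall fun _ => norm_nonneg _) ?_ hz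
    filter_upwards [hτ.eventually (Icc_mem_nhds (sub_one_lt τ₀) (lt_add_one τ₀))] with i hi
    exact hle ⟨τ i, hi⟩ (v i - v₀ : S.Y)
  have := h2.add h1
  rw [zero_add] at this
  refine this.congr fun i => ?_
  rw [map_sub, map_sub, Submodule.coe_sub, sub_add_cancel]

/-- A curve is of class `C⁰_L` iff it is continuous into the Fréchet space `Y`. -/
theorem CL0_iff [CompleteSpace X] {u : ℝ → S.Y} :
    S.CL0 u ↔ ∀ α, ContinuousOn (fun t => (S.pw α (u t) : X)) (Ici 0) := by
  constructor
  · intro h α t ht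
    -- Applying `e^{-sL}` in `X` to `A_{sL}^β u(s)` shows that `e^{-sL} u(s)` is continuous into
    -- `Y`; applying `e^{sL}` in `Y` then recovers `u`.
    have h1 : ∀ β, Tendsto (fun s => (S.pw β (S.e (-s) (u s)) : X)) (𝓝[Ici 0] t)
        (𝓝 (S.pw β (S.e (-t) (u t)) : X)) := by
      intro β
      have hid : Tendsto (fun s : ℝ => -s) (𝓝[Ici 0] t) (𝓝 (-t)) :=
        (continuous_neg.tendsto t).mono_left nhdsWithin_le_nhds
      have := S.op_tendsto hid (h β t ht)
      simp only [← e_coe, conj_apply, e_neg_e] at this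
      exact this
    have := S.e_tendsto (tendsto_id.mono_left nhdsWithin_le_nhds : Tendsto id (𝓝[Ici 0] t) (𝓝 t))
      h1 α
    simp only [id, e_e_neg] at this
    exact this
  · intro h α t ht
    have hid : Tendsto (fun s : ℝ => -s) (𝓝[Ici 0] t) (𝓝 (-t)) :=
      (continuous_neg.tendsto t).mono_left nhdsWithin_le_nhds
    exact S.op_tendsto (tendsto_id.mono_left nhdsWithin_le_nhds : Tendsto id (𝓝[Ici 0] t) (𝓝 t))
      (S.e_tendsto hid (fun β => h β t ht) α)

/-! ### Integration and differentiation of curves in `Y` -/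

/-- For finitely many `α` the integral of `(A^α h)_α` lies in the closure of the range of `y ↦ (A^α
y)_α`, so it is approximated by elements of `Y`. Letting the finite set grow and the error vanish,
completeness of `Y` produces the integral. -/
theorem exists_integral [CompleteSpace X] (h : ℝ → S.Y)
    (hc : ∀ α, ContinuousOn (fun t => (S.pw α (h t) : X)) (Ici 0)) {t : ℝ} (ht : 0 ≤ t) :
    ∃ z : S.Y, ∀ α, (S.pw α z : X) = ∫ s in (0 : ℝ)..t, (S.pw α (h s) : X) := by
  have approx : ∀ k : ℕ, ∃ y : S.Y, ∀ α : Fin n → ℕ, (∀ i, α i ≤ k) →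
      ‖(S.pw α y : X) - ∫ s in (0 : ℝ)..t, (S.pw α (h s) : X)‖ < 1 / ((k : ℝ) + 1) := by
    intro k
    let J := Finset.Icc (0 : Fin n → ℕ) (fun _ => k)
    let P : S.Y →ₗ[ℝ] (J → X) := LinearMap.pi fun α => S.Y.subtype ∘ₗ S.pw α
    let K : Submodule ℝ (J → X) := (LinearMap.range P).topologicalClosure
    have hK : IsClosed (K : Set (J → X)) := Submodule.isClosed_topologicalClosure _
    have : CompleteSpace K := hK.completeSpace_coe
    let g : ℝ → K := fun s => ⟨P (h s), Submodule.le_topologicalClosure _ ⟨h s, rfl⟩⟩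
    have hg : ContinuousOn g (uIcc 0 t) := by
      rw [uIcc_of_le ht, continuousOn_iff_continuous_domRestrict]
      refine Continuous.subtype_mk (continuous_pi fun α => ?_) _
      exact continuousOn_iff_continuous_domRestrict.1 ((hc α).mono Icc_subset_Ici_self)
    have hgi : IntervalIntegrable g MeasureTheory.volume 0 t := hg.intervalIntegrable
    have key : ∀ α : J, ((∫ s in (0 : ℝ)..t, g s : K) : J → X) α
        = ∫ s in (0 : ℝ)..t, (S.pw α (h s) : X) := by
      intro α
      have := (((ContinuousLinearMap.proj (R := ℝ) (φ := fun _ : J => X) α).comp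
        K.subtypeL).intervalIntegral_comp_comm hgi)
      exact this.symm
    have hmem := (∫ s in (0 : ℝ)..t, g s : K).2
    have hmem' : ((∫ s in (0 : ℝ)..t, g s : K) : J → X) ∈ closure (range P) := hmem
    obtain ⟨_, ⟨y, rfl⟩, hy⟩ := Metric.mem_closure_iff.1 hmem' (1 / ((k : ℝ) + 1)) (by positivity)
    refine ⟨y, fun α hα => ?_⟩
    have hαJ : α ∈ J := Finset.mem_Icc.2 ⟨zero_le, hα⟩
    rw [← key ⟨α, hαJ⟩, ← dist_eq_norm, dist_comm]
    exact (dist_le_pi_dist _ _ (⟨α, hαJ⟩ : J)).trans_lt hy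
  choose y hy using approx
  refine S.complete y _ fun α => ?_
  rw [tendsto_iff_norm_sub_tendsto_zero]
  refine squeeze_zero' (Eventually.of_forall fun _ => norm_nonneg _) ?_
    tendsto_one_div_add_atTop_nhds_zero_nat
  filter_upwards [eventually_ge_atTop (∑ i, α i)] with k hk
  exact (hy k α fun i => (Finset.single_le_sum (f := α) (fun _ _ => zero_le)
    (Finset.mem_univ i)).trans hk).le

theorem hasDerivWithinAt_integral [CompleteSpace X] {g : ℝ → X} (hg : ContinuousOn g (Ici 0))
    {t : ℝ} (ht : 0 ≤ t) :
    HasDerivWithinAt (fun t => ∫ s in (0 : ℝ)..t, g s) (g t) (Ici 0) t := by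
  -- Constant extension to negative times makes the two-sided fundamental theorem applicable at `t =
  -- 0`.
  have hc : Continuous fun s => g (max 0 s) := by
    refine hg.comp_continuous (by fun_prop) fun s => mem_Ici.2 (le_max_left _ _)
  have h1 := (hc.integral_hasStrictDerivAt 0 t).hasDerivAt.hasDerivWithinAt (s := Ici 0)
  rw [max_eq_right ht] at h1
  have heq : ∀ s ∈ Ici (0 : ℝ), ∫ r in (0 : ℝ)..s, g r = ∫ r in (0 : ℝ)..s, g (max 0 r) := by
    intro s hs
    refine intervalIntegral.integral_congr fun r hr => ?_
    rw [uIcc_of_le hs] at hr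
    simp only [max_eq_right hr.1]
  exact h1.congr heq (heq t ht)

theorem eq_add_integral [CompleteSpace X] {g g' : ℝ → X}
    (h : ∀ t, 0 ≤ t → HasDerivWithinAt g (g' t) (Ici 0) t) (hg : ContinuousOn g' (Ici 0))
    {t : ℝ} (ht : 0 ≤ t) : g t = g 0 + ∫ s in (0 : ℝ)..t, g' s := by
  rw [intervalIntegral.integral_eq_sub_of_hasDeriv_right_of_le ht (f := g)]
  · abel
  · exact fun s hs => (h s hs.1).continuousWithinAt.mono Icc_subset_Ici_self
  · exact fun s hs => (h s hs.1.le).mono fun r hr => (hs.1.trans hr).le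
  · refine (hg.mono ?_).intervalIntegrable
    rw [uIcc_of_le ht]
    exact Icc_subset_Ici_self

/-- The curve `v` in `Y` is differentiable on `[0,∞)` for the Fréchet topology, with
derivative `v'`. -/
def FDeriv (v v' : ℝ → S.Y) : Prop :=
  ∀ α t, 0 ≤ t → HasDerivWithinAt (fun s => (S.pw α (v s) : X)) (S.pw α (v' t) : X) (Ici 0) t

/-- The increment of `v` is the integral of `v'` in `X`; that integral exists in `Y` and commutes
with every `A^α`. Hence differentiability in `X` with a derivative continuous into `Y` is
differentiability in `Y`. -/
theorem FDeriv.of_hasDeriv [CompleteSpace X] {v v' : ℝ → S.Y}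
    (h : ∀ t, 0 ≤ t → HasDerivWithinAt (fun s => (v s : X)) (v' t : X) (Ici 0) t)
    (hc : ∀ α, ContinuousOn (fun t => (S.pw α (v' t) : X)) (Ici 0)) : S.FDeriv v v' := by
  intro α t ht
  have hc0 : ContinuousOn (fun t => (v' t : X)) (Ici 0) := by
    have := hc 0
    simpa only [pw_zero, Module.End.one_apply] using this
  have key : ∀ t, 0 ≤ t → (S.pw α (v t) : X)
      = S.pw α (v 0) + ∫ s in (0 : ℝ)..t, (S.pw α (v' s) : X) := by
    intro t ht
    obtain ⟨z, hz⟩ := S.exists_integral v' hc ht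
    have hz0 := hz 0
    simp only [pw_zero, Module.End.one_apply] at hz0
    have : v t = v 0 + z := by
      refine Subtype.ext ?_
      rw [Submodule.coe_add, hz0]
      exact eq_add_integral h hc0 ht
    rw [this, map_add, Submodule.coe_add, hz α]
  exact ((hasDerivWithinAt_integral (hc α) ht).const_add (S.pw α (v 0) : X)).congr
    (fun s hs => key s hs) (key t ht)

theorem hasDerivAt_op (t : ℝ) (y : S.Y) :
    HasDerivAt (fun s => S.G.op s y) (S.G.op t (S.L y)) t := by
  have h1 : HasDerivAt (fun s => S.G.op (s - t) y) (S.L y : X) t := by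
    have := HasDerivAt.comp_sub_const (x := t) t (f := fun s => S.G.op s y) (f' := (S.L y : X))
      (by rw [sub_self]; exact S.isGenerator y)
    exact this
  have h2 := (S.G.op t).hasFDerivAt.comp_hasDerivAt t h1
  refine h2.congr_of_eventuallyEq (Eventually.of_forall fun s => ?_)
  simp only [Function.comp]
  rw [← ContinuousLinearMap.comp_apply, ← S.G.op_add, add_sub_cancel]

/-- Differentiate `e^{sL} e^{tL} y = e^{tL} e^{sL} y` at `s = 0`. -/
theorem L_e (t : ℝ) (y : S.Y) : S.L (S.e t y) = S.e t (S.L y) := by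
  refine Subtype.ext ?_
  have h1 := S.isGenerator (S.e t y)
  have h2 : HasDerivAt (fun s => S.G.op s (S.e t y : X)) (S.G.op t (S.L y)) 0 := by
    have := (S.G.op t).hasFDerivAt.comp_hasDerivAt 0 (S.isGenerator y)
    refine this.congr_of_eventuallyEq (Eventually.of_forall fun s => ?_)
    simp only [Function.comp, e_coe]
    rw [← ContinuousLinearMap.comp_apply, ← ContinuousLinearMap.comp_apply, ← S.G.op_add,
      ← S.G.op_add, add_comm]
  exact h1.unique h2

theorem fderiv_orbit [CompleteSpace X] (σ : ℝ) (y : S.Y) :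
    S.FDeriv (fun t => S.e (σ * t) y) (fun t => S.e (σ * t) (σ • S.L y)) := by
  refine FDeriv.of_hasDeriv S (fun t _ => ?_) fun α => ?_
  · have h := (S.hasDerivAt_op (σ * t) y).scomp t ((hasDerivAt_id t).const_mul σ)
    refine HasDerivAt.hasDerivWithinAt ?_
    refine h.congr_deriv ?_
    simp [e_coe]
  · exact ((S.continuous_orbit α _).comp (continuous_const.mul continuous_id)).continuousOn

/-- `L` is continuous on the Fréchet space `Y`. -/
theorem L_tendsto [CompleteSpace X] {ι : Type*} {l : Filter ι} {v : ι → S.Y} {v₀ : S.Y}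
    (hv : ∀ α, Tendsto (fun i => (S.pw α (v i) : X)) l (𝓝 (S.pw α v₀ : X))) (α : Fin n → ℕ) :
    Tendsto (fun i => (S.pw α (S.L (v i)) : X)) l (𝓝 (S.pw α (S.L v₀) : X)) := by
  have hcont : Continuous (X := S.Frechet) (Y := X) fun y : S.Y => (S.pw α (S.L y) : X) := by
    -- `A^α L` is the pointwise limit of the continuous operators `A^α (k+1)(e^{L/(k+1)} - 1)`, and
    -- pointwise limits of continuous operators on a barrelled space are continuous.
    let F : ℕ → S.Frechet →L[ℝ] X := fun k =>
      { toLinearMap := ((k : ℝ) + 1) • (S.Y.subtype ∘ₗ S.pw α ∘ₗ (S.e (1 / ((k : ℝ) + 1)) - 1)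
          : S.Y →ₗ[ℝ] X)
        cont := by
          have h1 : Continuous (X := S.Frechet) fun y : S.Y => ((k : ℝ) + 1) •
              (S.emb (S.e (1 / ((k : ℝ) + 1)) y) α - S.emb y α) :=
            (((continuous_apply α).comp S.isInducing_emb.continuous).comp
              (S.continuous_e _) |>.sub ((continuous_apply α).comp
                S.isInducing_emb.continuous)).const_smul ((k : ℝ) + 1)
          refine h1.congr (show ∀ y : S.Y, _ from fun y => ?_)
          change _ = ((k : ℝ) + 1) • ((S.pw α (S.e (1 / ((k : ℝ) + 1)) y - y) : S.Y) : X)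
          rw [map_sub, Submodule.coe_sub]
          rfl }
    have hF : Tendsto (fun k y => F k y) atTop (𝓝 fun y : S.Y => (S.pw α (S.L y) : X)) := by
      refine tendsto_pi_nhds.2 (show ∀ y : S.Y, _ from fun y => ?_)
      have h := S.fderiv_orbit 1 y α 0 le_rfl
      rw [hasDerivWithinAt_iff_tendsto_slope] at h
      have hk : Tendsto (fun k : ℕ => 1 / ((k : ℝ) + 1)) atTop (𝓝[Ici 0 \ {0}] 0) := by
        refine tendsto_nhdsWithin_iff.2 ⟨tendsto_one_div_add_atTop_nhds_zero_nat, ?_⟩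
        refine Eventually.of_forall fun k => ?_
        have : (0 : ℝ) < 1 / ((k : ℝ) + 1) := by positivity
        exact ⟨this.le, this.ne'⟩
      have h2 := h.comp hk
      simp only [one_mul, e_zero, one_smul, Module.End.one_apply] at h2
      refine h2.congr fun k => ?_
      simp only [Function.comp, slope_def_module, e_zero, Module.End.one_apply, sub_zero, one_div,
        inv_inv]
      change _ = ((k : ℝ) + 1) • ((S.pw α (S.e (1 / ((k : ℝ) + 1)) y - y) : S.Y) : X)
      rw [map_sub, Submodule.coe_sub, one_div]
    exact (continuousLinearMapOfTendsto F hF).cont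
  exact (hcont.tendsto _).comp (S.tendsto_iff.2 hv)

/-- The product rule for `t ↦ e^{σtL} v(t)`. -/
theorem FDeriv.e_mul [CompleteSpace X] {v v' : ℝ → S.Y} (h : S.FDeriv v v') (σ : ℝ) :
    S.FDeriv (fun t => S.e (σ * t) (v t)) (fun t => S.e (σ * t) (v' t + σ • S.L (v t))) := by
  intro α t ht
  rw [hasDerivWithinAt_iff_tendsto_slope]
  have hτ : Tendsto (fun s : ℝ => σ * s) (𝓝[Ici 0 \ {t}] t) (𝓝 (σ * t)) :=
    ((continuous_const.mul continuous_id).tendsto t).mono_left nhdsWithin_le_nhds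
  -- The difference quotient splits into `e^{σsL}` applied to that of `v`, which needs joint
  -- continuity of the group on `Y`, and that of the orbit of the fixed vector `v t`.
  have h1 := S.e_tendsto (v := fun s => (s - t)⁻¹ • (v s - v t)) (v₀ := v' t) hτ (fun β => by
    have := hasDerivWithinAt_iff_tendsto_slope.1 (h β t ht)
    refine this.congr fun s => ?_
    simp [slope_def_module]) α
  have h2 := hasDerivWithinAt_iff_tendsto_slope.1 (S.fderiv_orbit σ (v t) α t ht)
  have h3 := h1.add h2
  simp only [map_add, Submodule.coe_add] at h3 ⊢
  refine h3.congr fun s => ?_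
  simp only [slope_def_module, map_smul, map_sub, Submodule.coe_smul, Submodule.coe_sub]
  rw [← smul_add]
  congr 1
  abel

/-- The derivative of `A_{tL}^α u(t)`. -/
theorem fderiv_conj [CompleteSpace X] {u f : ℝ → S.Y} (hf : S.CL0 f)
    (hu : ∀ t, 0 ≤ t → HasDerivWithinAt (fun s => (u s : X)) (f t : X) (Ici 0) t)
    (α : Fin n → ℕ) :
    S.FDeriv (fun t => S.conj t α (u t))
      (fun t => S.conj t α (f t) + S.e t ((S.L * S.pw α - S.pw α * S.L) (S.e (-t) (u t)))) := by
  have h1 := FDeriv.of_hasDeriv S hu (S.CL0_iff.1 hf)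
  -- The factors of `e^{tL} A^α e^{-tL}` are treated one at a time. The two contributions of `L`
  -- combine into the commutator `[L, A^α]`.
  have h2 := FDeriv.e_mul S h1 (-1)
  have h3 : S.FDeriv (fun t => S.pw α (S.e (-1 * t) (u t)))
      (fun t => S.pw α (S.e (-1 * t) (f t + (-1 : ℝ) • S.L (u t)))) := by
    intro β t ht
    simp only [← Module.End.mul_apply (S.pw β), ← pw_add]
    exact h2 (β + α) t ht
  have h4 := FDeriv.e_mul S h3 1
  intro β t ht
  have h5 := h4 β t ht
  simp only [one_mul, neg_mul, one_smul, neg_smul] at h5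
  refine h5.congr_deriv ?_
  congr 2
  simp only [conj_apply, LinearMap.sub_apply, Module.End.mul_apply, L_e, map_add, map_neg, map_sub]
  abel

/-- Conjugation by the group of an operator that is continuous on the Fréchet space `Y`
preserves the class `C⁰_L`. -/
theorem CL0.conj_op [CompleteSpace X] {u : ℝ → S.Y} (hu : S.CL0 u) (B : Module.End ℝ S.Y)
    (hB : ∀ (l : Filter ℝ) (v : ℝ → S.Y) (v₀ : S.Y),
      (∀ α, Tendsto (fun i => (S.pw α (v i) : X)) l (𝓝 (S.pw α v₀ : X))) →
      ∀ α, Tendsto (fun i => (S.pw α (B (v i)) : X)) l (𝓝 (S.pw α (B v₀) : X))) :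
    S.CL0 fun t => S.e t (B (S.e (-t) (u t))) := by
  rw [CL0_iff] at hu ⊢
  intro α t ht
  have hid : Tendsto (fun s : ℝ => -s) (𝓝[Ici 0] t) (𝓝 (-t)) :=
    (continuous_neg.tendsto t).mono_left nhdsWithin_le_nhds
  exact S.e_tendsto (tendsto_id.mono_left nhdsWithin_le_nhds : Tendsto id (𝓝[Ici 0] t) (𝓝 t))
    (hB _ _ _ (S.e_tendsto hid fun β => hu β t ht)) α

theorem pw_tendsto {l : Filter ℝ} {v : ℝ → S.Y} {v₀ : S.Y}
    (h : ∀ α, Tendsto (fun i => (S.pw α (v i) : X)) l (𝓝 (S.pw α v₀ : X))) (β α : Fin n → ℕ) :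
    Tendsto (fun i => (S.pw α (S.pw β (v i)) : X)) l (𝓝 (S.pw α (S.pw β v₀) : X)) := by
  simp only [← Module.End.mul_apply (S.pw α), ← pw_add]
  exact h _

theorem CL0.conj [CompleteSpace X] {u : ℝ → S.Y} (hu : S.CL0 u) (α : Fin n → ℕ) :
    S.CL0 fun t => S.conj t α (u t) :=
  CL0.conj_op S hu (S.pw α) fun _ _ _ h => S.pw_tendsto h α

theorem CL0.add {u v : ℝ → S.Y} (hu : S.CL0 u) (hv : S.CL0 v) : S.CL0 fun t => u t + v t := by
  intro α
  simp only [map_add, Submodule.coe_add]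
  exact (hu α).add (hv α)

theorem CL0.sub {u v : ℝ → S.Y} (hu : S.CL0 u) (hv : S.CL0 v) : S.CL0 fun t => u t - v t := by
  intro α
  simp only [map_sub, Submodule.coe_sub]
  exact (hu α).sub (hv α)

theorem CL0_const [CompleteSpace X] (y : S.Y) : S.CL0 fun _ => y :=
  S.CL0_iff.2 fun _ => continuousOn_const

/-- The derivative of `A_{tL}^α u(t)` is of class `C⁰_L`. -/
theorem CL0_deriv_conj [CompleteSpace X] {u f : ℝ → S.Y} (hf : S.CL0 f) (hu : S.CL0 u)
    (α : Fin n → ℕ) :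
    S.CL0 fun t => S.conj t α (f t)
      + S.e t ((S.L * S.pw α - S.pw α * S.L) (S.e (-t) (u t))) := by
  refine CL0.add S (CL0.conj S hf α) (CL0.conj_op S hu _ fun l v v₀ h β => ?_)
  simp only [LinearMap.sub_apply, Module.End.mul_apply, map_sub, Submodule.coe_sub]
  exact (S.L_tendsto (S.pw_tendsto h α) β).sub (S.pw_tendsto (S.L_tendsto h) α β)

theorem CL0_of_hasDeriv [CompleteSpace X] {u f : ℝ → S.Y} (hf : S.CL0 f)
    (hu : ∀ t, 0 ≤ t → HasDerivWithinAt (fun s => (u s : X)) (f t : X) (Ici 0) t) : S.CL0 u :=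
  S.CL0_iff.2 fun α t ht =>
    (FDeriv.of_hasDeriv S hu (S.CL0_iff.1 hf) α t ht).continuousWithinAt

/-- Supplies the regularity that (H4′) asks for: `fderiv_conj` gives the derivative of each
`A_{tL}^α u`, and `CL0_deriv_conj` its continuity. -/
theorem CL1_of_hasDeriv [CompleteSpace X] {u f : ℝ → S.Y} (hf : S.CL0 f)
    (hu : ∀ t, 0 ≤ t → HasDerivWithinAt (fun s => (u s : X)) (f t : X) (Ici 0) t) : S.CL1 u := by
  intro α
  have hd := S.fderiv_conj hf hu α 0
  have hc := (S.CL0_iff.1 (S.CL0_deriv_conj hf (S.CL0_of_hasDeriv hf hu) α)) 0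
  simp only [pw_zero, Module.End.one_apply] at hd hc
  rw [contDiffOn_one_iff_derivWithin (uniqueDiffOn_Ici 0)]
  refine ⟨fun t ht => (hd t ht).differentiableWithinAt, hc.congr fun t ht => ?_⟩
  exact (hd t ht).derivWithin (uniqueDiffOn_Ici 0 t ht)

end Setting

end AnalyticEvolution

namespace AnalyticEvolution

/-! ### Multi-index algebra -/

theorem binom_zero {n : ℕ} (α : Fin n → ℕ) : binom α 0 = 1 := by simp [binom]

theorem binom_eq_zero {n : ℕ} {α γ : Fin n → ℕ} (h : ¬ γ ≤ α) : binom α γ = 0 := by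
  obtain ⟨i, hi⟩ : ∃ i, α i < γ i := by simpa [Pi.le_def] using h
  exact Finset.prod_eq_zero (Finset.mem_univ i) (Nat.choose_eq_zero_of_lt hi)

/-- Pascal's rule in the coordinate `i`. The case distinction is needed because `γ - unit i` is
truncated to `γ` when `γ i = 0`. -/
theorem binom_succ {n : ℕ} (α : Fin n → ℕ) (i : Fin n) (γ : Fin n → ℕ) :
    binom (α + unit i) γ
      = binom α γ + (if 1 ≤ γ i then binom α (γ - unit i) else 0) := by
  have key : ∀ β δ : Fin n → ℕ, binom β δ
      = (β i).choose (δ i) * ∏ j ∈ Finset.univ.erase i, (β j).choose (δ j) := fun β δ =>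
    (Finset.mul_prod_erase _ _ (Finset.mem_univ i)).symm
  have h1 : ∏ j ∈ Finset.univ.erase i, ((α + unit i) j).choose (γ j)
      = ∏ j ∈ Finset.univ.erase i, (α j).choose (γ j) :=
    Finset.prod_congr rfl fun j hj => by simp [unit, Finset.ne_of_mem_erase hj]
  have h2 : ∏ j ∈ Finset.univ.erase i, (α j).choose ((γ - unit i) j)
      = ∏ j ∈ Finset.univ.erase i, (α j).choose (γ j) :=
    Finset.prod_congr rfl fun j hj => by simp [unit, Finset.ne_of_mem_erase hj]
  rw [key (α + unit i), key α γ, key α (γ - unit i), h1, h2]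
  have h3 : (α + unit i) i = α i + 1 := by simp [unit]
  have h4 : (γ - unit i) i = γ i - 1 := by simp [unit]
  rw [h3, h4]
  split_ifs with h
  · obtain ⟨m, hm⟩ := Nat.exists_eq_add_of_le' h
    rw [hm, Nat.choose_succ_succ, Nat.add_sub_cancel]
    ring
  · have : γ i = 0 := by omega
    rw [this]
    simp

theorem sum_binom_succ {n : ℕ} {M : Type*} [AddCommMonoid M] (α : Fin n → ℕ) (i : Fin n)
    (F : (Fin n → ℕ) → M) :
    ∑ γ ∈ Finset.Icc 0 (α + unit i), binom (α + unit i) γ • F γ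
      = ∑ γ ∈ Finset.Icc 0 α, binom α γ • F γ
        + ∑ γ ∈ Finset.Icc 0 α, binom α γ • F (γ + unit i) := by
  simp only [binom_succ, add_smul, Finset.sum_add_distrib]
  congr 1
  · refine (Finset.sum_subset (Finset.Icc_subset_Icc_right le_self_add) fun γ _ h2 => ?_).symm
    rw [binom_eq_zero fun h => h2 (Finset.mem_Icc.2 ⟨zero_le, h⟩), zero_smul]
  · simp only [ite_smul, zero_smul]
    rw [← Finset.sum_filter]
    symm
    refine Finset.sum_nbij' (fun γ => γ + unit i) (fun γ => γ - unit i) ?_ ?_ ?_ ?_ ?_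
    · intro γ hγ
      rw [Finset.mem_Icc] at hγ
      refine Finset.mem_filter.2 ⟨Finset.mem_Icc.2 ⟨zero_le, ?_⟩, by simp [unit]⟩
      exact add_le_add_left hγ.2 _
    · intro γ hγ
      rw [Finset.mem_filter, Finset.mem_Icc] at hγ
      exact Finset.mem_Icc.2 ⟨zero_le, tsub_le_iff_right.2 hγ.1.2⟩
    · intro γ _
      exact add_tsub_cancel_right _ _
    · intro γ hγ
      rw [Finset.mem_filter] at hγ
      exact tsub_add_cancel_of_le (Setting.unit_le hγ.2)
    · intro γ _
      rw [add_tsub_cancel_right]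

theorem fact_pos {n : ℕ} (α : Fin n → ℕ) : 0 < fact α :=
  Finset.prod_pos fun _ _ => Nat.factorial_pos _

theorem binom_mul_fact {n : ℕ} {α γ : Fin n → ℕ} (h : γ ≤ α) :
    binom α γ * fact γ * fact (α - γ) = fact α := by
  simp only [binom, fact, ← Finset.prod_mul_distrib]
  exact Finset.prod_congr rfl fun i _ => Nat.choose_mul_factorial_mul_factorial (h i)

theorem fact_add_unit {n : ℕ} (α : Fin n → ℕ) (i : Fin n) :
    fact (α + unit i) = (α i + 1) * fact α := by
  have key : ∀ β : Fin n → ℕ, fact β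
      = (β i).factorial * ∏ j ∈ Finset.univ.erase i, (β j).factorial := fun β =>
    (Finset.mul_prod_erase _ _ (Finset.mem_univ i)).symm
  have h1 : ∏ j ∈ Finset.univ.erase i, ((α + unit i) j).factorial
      = ∏ j ∈ Finset.univ.erase i, (α j).factorial :=
    Finset.prod_congr rfl fun j hj => by simp [unit, Finset.ne_of_mem_erase hj]
  have h3 : (α + unit i) i = α i + 1 := by simp [unit]
  rw [key, key α, h1, h3, Nat.factorial_succ, mul_assoc]

/-! ### Expansion of the commutator of `L` with `A^α`. -/

namespace Setting

variable {n : ℕ} {X : Type*} [NormedAddCommGroup X] [NormedSpace ℝ X] (S : Setting n X)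

theorem A_mul_Lc (i : Fin n) (γ : Fin n → ℕ) :
    S.A i * S.Lc γ = S.Lc γ * S.A i - S.Lc (γ + unit i) := by
  rw [Lc, Lc, iterComm_add_unit _ S.A_comm, sub_sub_cancel]

theorem pw_unit (i : Fin n) : S.pw (unit i) = S.A i := by
  have := S.pw_add_unit 0 i
  rwa [zero_add, pw_zero, one_mul] at this

/-- Commuting `L` to the left through `A^α`. -/
theorem pw_mul_L (α : Fin n → ℕ) :
    S.pw α * S.L = ∑ γ ∈ Finset.Icc 0 α,
      binom α γ • ((-1 : ℝ) ^ len γ • (S.Lc γ * S.pw (α - γ))) := by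
  induction α using multi_induction with
  | h0 =>
    simp [pw_zero, binom_zero, len, Lc, iterComm_zero]
  | hs α i ih =>
    -- A new factor `Aᵢ` on the left passes `L_γ` by `Aᵢ L_γ = L_γ Aᵢ - L_{γ+eᵢ}`; the two terms
    -- match the two sums of Pascal's rule.
    rw [sum_binom_succ, add_comm α, pw_add, pw_unit, mul_assoc, ih, Finset.mul_sum,
      ← Finset.sum_add_distrib]
    refine Finset.sum_congr rfl fun γ hγ => ?_
    have hγ' := (Finset.mem_Icc.1 hγ).2
    have h1 : unit i + α - γ = (α - γ) + unit i := by
      rw [add_tsub_assoc_of_le hγ', add_comm]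
    have h2 : unit i + α - (γ + unit i) = α - γ := by
      rw [add_comm γ, add_tsub_add_eq_tsub_left]
    rw [h1, h2, mul_smul_comm, mul_smul_comm, ← mul_assoc, A_mul_Lc, ← smul_add, sub_mul,
      len_add, len_unit, pow_succ, mul_neg_one, mul_assoc, ← pw_unit, ← pw_add,
      add_comm (unit i)]
    congr 1
    module

/-- In the expansion of `A^α L` the term `γ = 0` is `L A^α`, so the commutator consists of the terms
`γ ≠ 0`. (H2′) bounds each `L_γ` at the price of one further `Aᵢ`. -/
theorem norm_commutator_le {N : ℝ → Seminorm ℝ S.Y} {C r : ℝ} (h2 : S.H2 N C r) {t : ℝ}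
    (ht : 0 ≤ t) (α : Fin n → ℕ) (y : S.Y) :
    N t (S.e t ((S.L * S.pw α - S.pw α * S.L) y)) ≤
      ∑ γ ∈ (Finset.Icc 0 α).erase 0, binom α γ * (C * fact γ * r ^ len γ *
        ∑ i, N t (S.e t (S.pw (α - γ + unit i) y))) := by
  have h0 : (0 : Fin n → ℕ) ∈ Finset.Icc 0 α := Finset.mem_Icc.2 ⟨le_rfl, zero_le⟩
  have hz : binom α 0 • ((-1 : ℝ) ^ len (0 : Fin n → ℕ) • (S.Lc 0 * S.pw (α - 0)))
      = S.L * S.pw α := by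
    simp [binom_zero, len, Lc, iterComm_zero]
  rw [pw_mul_L, ← Finset.add_sum_erase _ _ h0, hz, sub_add_cancel_left, LinearMap.neg_apply,
    map_neg, map_neg_eq_map, LinearMap.sum_apply, map_sum]
  refine (Finset.le_sum_of_subadditive (N t) (map_zero _).le (map_add_le_add _) _ _).trans ?_
  refine Finset.sum_le_sum fun γ _ => ?_
  have hsm : (binom α γ • ((-1 : ℝ) ^ len γ • (S.Lc γ * S.pw (α - γ)))) y
      = ((binom α γ : ℝ) * (-1) ^ len γ) • S.Lc γ (S.pw (α - γ) y) := by
    rw [mul_smul, Nat.cast_smul_eq_nsmul]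
    rfl
  rw [hsm, map_smul, map_smul_eq_mul, norm_mul, norm_pow, norm_neg, norm_one, one_pow, mul_one,
    Real.norm_of_nonneg (Nat.cast_nonneg _)]
  gcongr
  refine (h2 t ht γ _).trans (le_of_eq ?_)
  congr 1
  refine Finset.sum_congr rfl fun i _ => ?_
  rw [add_comm, pw_add, pw_unit]
  rfl

/-! ### The family of norms -/

variable [CompleteSpace X]

/-- `t ↦ ‖y‖_{X_t}` is nonincreasing. -/
theorem norm_antitone {N : ℝ → Seminorm ℝ S.Y} (hN : S.AdmissibleNorms N) (h4 : S.H4 N)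
    {s t : ℝ} (hs : 0 ≤ s) (hst : s ≤ t) (y : S.Y) : N t y ≤ N s y := by
  -- For the constant curve (H4′) says that the Dini derivative of `t ↦ ‖y‖_{X_t}` is at most `0`.
  have hd : ∀ t : ℝ, 0 ≤ t → HasDerivWithinAt (fun _ : ℝ => (y : X)) ((0 : S.Y) : X) (Ici 0) t :=
    fun t _ => hasDerivWithinAt_const _ _ _
  have h := h4 (fun _ => y) (fun _ => 0) (S.CL1_of_hasDeriv (S.CL0_const 0) hd) hd
  refine image_le_of_liminf_slope_right_le_deriv_boundary (f := fun τ => N τ y) (a := s) (b := t)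
    (B := fun _ => N s y) (B' := fun _ => 0)
    ((hN.cont _ (S.CL0_const y)).mono fun x hx => hs.trans hx.1) le_rfl continuousOn_const
    (fun x _ => hasDerivWithinAt_const _ _ _) (fun x hx r hr => ?_) ⟨hst, le_rfl⟩
  refine ((h x (hs.trans hx.1) r (by simpa using hr)).mono fun z hz => ?_).frequently
  rw [slope_def_field]
  exact hz

/-- No uniformity in `t` is assumed of the constants `c_t`; monotonicity of the norms lets the
constant at time `T` serve on all of `[0, T]`. -/
theorem norm_le_uniform {N : ℝ → Seminorm ℝ S.Y} (hN : S.AdmissibleNorms N) (h4 : S.H4 N)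
    {T : ℝ} (hT : 0 ≤ T) :
    ∃ c : ℝ, 0 ≤ c ∧ ∀ t, 0 ≤ t → t ≤ T → ∀ y : S.Y, ‖(y : X)‖ ≤ c * N t y := by
  obtain ⟨c, hc⟩ := hN.stronger T hT
  refine ⟨max c 0, le_max_right _ _, fun t ht htT y => (hc y).trans ?_⟩
  calc c * N T y ≤ max c 0 * N T y := by gcongr; exact le_max_left _ _
    _ ≤ max c 0 * N t y := by gcongr; exact S.norm_antitone hN h4 ht htT y

/-- There is a curve in `Y`, continuous for the Fréchet topology, that vanishes at `s` and takes
the values `y_k`, a rapidly decreasing sequence, at the times `s - s / 2^(k+1)`. -/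
theorem exists_interpolating_curve {s : ℝ} (hs : 0 < s) (y : ℕ → S.Y)
    (hy : ∀ k, S.sn k (y k) ≤ (1 / 2) ^ k) :
    ∃ x : ℝ → S.Y, S.CL0 x ∧ x s = 0 ∧ ∀ k : ℕ, x (s - s * (1 / 2) ^ (k + 1)) = y k := by
  -- A tent of height 1 with peak at `s - s / 2^(k+1)`. At the peak of another index `j` the scaled
  -- distance `2^(k+1)(s-τ)/s` is `2^(k-j)`, at most `1/2` or at least `2`, where the tent vanishes.
  let ρ : ℕ → ℝ → ℝ := fun k τ => max 0 (1 - 4 * |2 ^ (k + 1) * ((s - τ) / s) - 1|)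
  have hρ0 : ∀ k τ, 0 ≤ ρ k τ := fun k τ => le_max_left _ _
  have hρ1 : ∀ k τ, ρ k τ ≤ 1 := fun k τ => max_le zero_le_one <| by
    have := abs_nonneg (2 ^ (k + 1) * ((s - τ) / s) - 1)
    linarith
  have hρc : ∀ k, Continuous (ρ k) := fun k => by fun_prop
  have hρs : ∀ k, ρ k s = 0 := by
    intro k
    simp only [ρ, sub_self, zero_div, mul_zero, zero_sub, abs_neg, abs_one]
    norm_num
  have hρj : ∀ k j : ℕ, ρ k (s - s * (1 / 2) ^ (j + 1)) = if k = j then 1 else 0 := by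
    intro k j
    have h1 : (s - (s - s * (1 / 2) ^ (j + 1))) / s = (1 / 2 : ℝ) ^ (j + 1) := by
      field_simp; ring
    simp only [ρ, h1]
    have hpos : ∀ i : ℕ, (2 : ℝ) ^ i * (1 / 2) ^ i = 1 := fun i => by
      rw [← mul_pow]; norm_num
    split_ifs with h
    · rw [h, hpos]; norm_num
    · refine max_eq_left ?_
      suffices 1 / 2 ≤ |(2 : ℝ) ^ (k + 1) * (1 / 2) ^ (j + 1) - 1| by linarith
      rcases lt_or_gt_of_ne h with h | h
      · have : (2 : ℝ) ^ (k + 1) * (1 / 2) ^ (j + 1) ≤ 1 / 2 := by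
          have hj : j + 1 = (k + 1) + ((j - k - 1) + 1) := by omega
          rw [hj, pow_add (1 / 2 : ℝ) (k + 1), ← mul_assoc, hpos, one_mul, pow_succ]
          have := pow_le_one₀ (n := j - k - 1) (by norm_num : (0 : ℝ) ≤ 1 / 2) (by norm_num)
          linarith
        rw [abs_sub_comm]
        exact le_trans (by linarith) (le_abs_self _)
      · have : 2 ≤ (2 : ℝ) ^ (k + 1) * (1 / 2) ^ (j + 1) := by
          have hj : k + 1 = ((k - j - 1) + 1) + (j + 1) := by omega
          rw [hj, pow_add (2 : ℝ) _ (j + 1), mul_assoc, hpos, mul_one, pow_succ]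
          have := one_le_pow₀ (n := k - j - 1) (by norm_num : (1 : ℝ) ≤ 2)
          linarith
        exact le_trans (by linarith) (le_abs_self _)
  have hgeo : Summable fun j : ℕ => (1 / 2 : ℝ) ^ j := summable_geometric_two
  have hex : ∀ τ, ∃ z : S.Y, ∀ α, Tendsto (fun m =>
      (S.pw α (∑ j ∈ Finset.range m, ρ j τ • y j) : X)) atTop (𝓝 (S.pw α z : X)) := by
    intro τ
    refine S.exists_tendsto_of_summable (fun j => ρ j τ • y j) _ hgeo 0 fun j => ?_
    rw [map_smul_eq_mul, Real.norm_of_nonneg (hρ0 _ _), zero_add]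
    calc ρ j τ * S.sn j (y j) ≤ 1 * S.sn j (y j) := by gcongr; exact hρ1 _ _
      _ ≤ _ := by rw [one_mul]; exact hy j
  choose x hx using hex
  have hsum : ∀ α τ, Summable fun j => ρ j τ • (S.pw α (y j) : X) := by
    intro α τ
    obtain ⟨k, hk⟩ := S.exists_norm_pw_le_sn α
    refine Summable.of_norm_bounded_eventually_nat hgeo ?_
    filter_upwards [eventually_ge_atTop k] with j hj
    rw [norm_smul, Real.norm_of_nonneg (hρ0 _ _)]
    calc ρ j τ * ‖(S.pw α (y j) : X)‖ ≤ 1 * S.sn j (y j) := by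
          gcongr
          · exact hρ1 _ _
          · exact hk j hj _
      _ ≤ _ := by rw [one_mul]; exact hy j
  have hval : ∀ α τ, (S.pw α (x τ) : X) = ∑' j, ρ j τ • (S.pw α (y j) : X) := by
    intro α τ
    refine tendsto_nhds_unique (hx τ α) ?_
    refine (hsum α τ).hasSum.tendsto_sum_nat.congr fun m => ?_
    simp
  have hval0 : ∀ τ, (x τ : X) = ∑' j, ρ j τ • (y j : X) := by
    intro τ
    have := hval 0 τ
    simpa only [pw_zero, Module.End.one_apply] using this
  refine ⟨x, S.CL0_iff.2 fun α => ?_, ?_, fun k => ?_⟩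
  · refine Continuous.continuousOn ?_
    simp only [hval]
    refine continuous_tsum (u := fun j => ‖(S.pw α (y j) : X)‖)
      (fun j => (hρc j).smul continuous_const) ?_ fun j τ => ?_
    · obtain ⟨k, hk⟩ := S.exists_norm_pw_le_sn α
      refine Summable.of_norm_bounded_eventually_nat hgeo ?_
      filter_upwards [eventually_ge_atTop k] with j hj
      rw [norm_norm]
      exact (hk j hj _).trans (hy j)
    · rw [norm_smul, Real.norm_of_nonneg (hρ0 _ _)]
      exact mul_le_of_le_one_left (norm_nonneg _) (hρ1 _ _)
  · refine Subtype.ext ?_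
    rw [hval0]
    simp [hρs]
  · refine Subtype.ext ?_
    rw [hval0]
    simp only [hρj, ite_smul, one_smul, zero_smul]
    exact tsum_ite_eq k _

/-- For `s > 0` the norm of `X_s` is continuous on the Fréchet space `Y`. -/
theorem norm_tendsto {N : ℝ → Seminorm ℝ S.Y} (hN : S.AdmissibleNorms N) (h4 : S.H4 N)
    {s : ℝ} (hs : 0 < s) {ι : Type*} {l : Filter ι} {v : ι → S.Y} {v₀ : S.Y}
    (hv : ∀ α, Tendsto (fun i => (S.pw α (v i) : X)) l (𝓝 (S.pw α v₀ : X))) :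
    Tendsto (fun i => N s (v i)) l (𝓝 (N s v₀)) := by
  obtain ⟨k, hk⟩ : ∃ k : ℕ, ∀ y : S.Y, N s y ≤ 2 ^ k * S.sn k y := by
    -- Otherwise vectors of unit `X_s` norm that tend to zero rapidly in `Y` can be placed along a
    -- `C⁰_L` curve vanishing at `s`, at times increasing to `s`. Earlier norms are larger, so the
    -- norm along the curve is at least 1 at those times, against its continuity. Times below `s`
    -- are needed, hence `s > 0`.
    by_contra! H
    choose z hz using H
    have hpos : ∀ k, 0 < N s (z k) := fun k => lt_of_le_of_lt (by positivity) (hz k)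
    obtain ⟨x, hx, hxs, hxk⟩ := S.exists_interpolating_curve hs
      (fun k => (N s (z k))⁻¹ • z k) (fun k => by
        rw [map_smul_eq_mul, norm_inv, Real.norm_of_nonneg (hpos k).le,
          inv_mul_le_iff₀ (hpos k), one_div, inv_pow, ← div_eq_mul_inv, le_div_iff₀' (by positivity)]
        exact (hz k).le)
    have hτ : Tendsto (fun k : ℕ => s - s * (1 / 2 : ℝ) ^ (k + 1)) atTop (𝓝[Ici 0] s) := by
      refine tendsto_nhdsWithin_iff.2 ⟨?_, Eventually.of_forall fun k => ?_⟩
      · have h1 : Tendsto (fun k : ℕ => (1 / 2 : ℝ) ^ (k + 1)) atTop (𝓝 0) :=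
          (tendsto_pow_atTop_nhds_zero_of_lt_one (by norm_num) (by norm_num)).comp
            (tendsto_add_atTop_nat 1)
        have := (h1.const_mul s).const_sub s
        simpa using this
      · have := pow_le_one₀ (n := k + 1) (by norm_num : (0 : ℝ) ≤ 1 / 2) (by norm_num)
        rw [mem_Ici, sub_nonneg]
        exact mul_le_of_le_one_right hs.le this
    have hlim := (hN.cont x hx s hs.le).tendsto.comp hτ
    rw [hxs, map_zero] at hlim
    refine absurd (ge_of_tendsto' hlim (b := 1) fun k => ?_) (by norm_num)
    simp only [Function.comp, hxk]
    have hmem : 0 ≤ s - s * (1 / 2 : ℝ) ^ (k + 1) := by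
      have := pow_le_one₀ (n := k + 1) (by norm_num : (0 : ℝ) ≤ 1 / 2) (by norm_num)
      rw [sub_nonneg]
      exact mul_le_of_le_one_right hs.le this
    have h1 := S.norm_antitone hN h4 hmem (sub_le_self s (by positivity)) ((N s (z k))⁻¹ • z k)
    refine le_trans ?_ h1
    rw [map_smul_eq_mul, norm_inv, Real.norm_of_nonneg (hpos k).le, inv_mul_cancel₀ (hpos k).ne']
  have h0 : Tendsto (fun i => S.sn k (v i - v₀)) l (𝓝 0) := by
    simp only [sn_apply, map_sub, Submodule.coe_sub]
    have := tendsto_finsetSum (Finset.Icc (0 : Fin n → ℕ) (fun _ => k)) fun α _ =>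
      tendsto_iff_norm_sub_tendsto_zero.1 (hv α)
    simpa using this
  have h1 : Tendsto (fun i => N s (v i - v₀)) l (𝓝 0) :=
    squeeze_zero (fun _ => apply_nonneg _ _) (fun i => hk _) (by simpa using h0.const_mul (2 ^ k))
  rw [tendsto_iff_norm_sub_tendsto_zero]
  refine squeeze_zero (fun _ => norm_nonneg _) (fun i => ?_) h1
  exact abs_sub_map_le_sub (N s) _ _

end Setting

end AnalyticEvolution

/-! ### The integrated estimate for a single term of the analytic norm. -/

namespace AnalyticEvolution

/-- Integrated form of a differential inequality `φ' ≤ ψ` (right upper Dini derivative), with an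
exponentially decreasing weight. -/
theorem exp_weight_integral_le {φ ψ : ℝ → ℝ} (hφ : ContinuousOn φ (Ici 0))
    (hψ : ContinuousOn ψ (Ici 0))
    (hD : ∀ t, 0 ≤ t → ∀ m : ℝ, ψ t < m → ∀ᶠ s in 𝓝[>] t, (φ s - φ t) / (s - t) < m)
    {w c : ℝ} (hw : 0 ≤ w) {t : ℝ} (ht : 0 ≤ t) :
    w * Real.exp (-c * t) * φ t + ∫ s in (0 : ℝ)..t, c * (w * Real.exp (-c * s) * φ s)
      ≤ w * φ 0 + ∫ s in (0 : ℝ)..t, w * Real.exp (-c * s) * ψ s := by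
  have hE : ∀ s, HasDerivAt (fun s => w * Real.exp (-c * s)) (-c * (w * Real.exp (-c * s))) s := by
    intro s
    have := (((hasDerivAt_id s).const_mul (-c)).exp).const_mul w
    refine this.congr_deriv ?_
    simp only [id, mul_one]
    ring
  have hEc : Continuous fun s => w * Real.exp (-c * s) := by fun_prop
  have hg1 : ContinuousOn (fun s => w * Real.exp (-c * s) * ψ s) (Ici 0) := hEc.continuousOn.mul hψ
  have hg2 : ContinuousOn (fun s => c * (w * Real.exp (-c * s) * φ s)) (Ici 0) :=
    continuousOn_const.mul (hEc.continuousOn.mul hφ)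
  have hi : ∀ g : ℝ → ℝ, ContinuousOn g (Ici 0) →
      IntervalIntegrable g MeasureTheory.volume 0 t := by
    intro g hg
    refine (hg.mono ?_).intervalIntegrable
    rw [uIcc_of_le ht]
    exact Icc_subset_Ici_self
  have main := image_le_of_liminf_slope_right_le_deriv_boundary
    (f := fun s => w * Real.exp (-c * s) * φ s) (a := 0) (b := t)
    (B := fun x => w * φ 0 + ∫ s in (0 : ℝ)..x,
      (w * Real.exp (-c * s) * ψ s - c * (w * Real.exp (-c * s) * φ s)))
    (B' := fun s => w * Real.exp (-c * s) * ψ s - c * (w * Real.exp (-c * s) * φ s))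
    ((hEc.continuousOn.mul hφ).mono Icc_subset_Ici_self) (by simp)
    (fun x hx => (((Setting.hasDerivWithinAt_integral (hg1.sub hg2) hx.1).const_add
      (w * φ 0)).continuousWithinAt).mono Icc_subset_Ici_self)
    (fun x hx => ((Setting.hasDerivWithinAt_integral (hg1.sub hg2) hx.1).const_add
      (w * φ 0)).mono (Ici_subset_Ici.2 hx.1)) (fun x hx r hr => ?_)
    (show t ∈ Icc 0 t from ⟨ht, le_rfl⟩)
  · rw [intervalIntegral.integral_sub (hi _ hg1) (hi _ hg2)] at main
    linarith
  · obtain ⟨m, hm1, hm2⟩ : ∃ m, ψ x < m ∧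
        w * Real.exp (-c * x) * m - c * (w * Real.exp (-c * x) * φ x) < r := by
      have hc : Continuous fun m : ℝ =>
          w * Real.exp (-c * x) * m - c * (w * Real.exp (-c * x) * φ x) := by fun_prop
      have h1 : ∀ᶠ m in 𝓝[>] (ψ x),
          w * Real.exp (-c * x) * m - c * (w * Real.exp (-c * x) * φ x) < r :=
        ((hc.tendsto (ψ x)).mono_left nhdsWithin_le_nhds).eventually_lt_const hr
      obtain ⟨m, h2, h3⟩ := (h1.and self_mem_nhdsWithin).exists
      exact ⟨m, h3, h2⟩
    -- The slope of the product is the weight at `z` times the slope of `φ`, plus the slope of the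
    -- weight times `φ x`. As the weight is nonnegative, the slope of `φ` may be replaced by its
    -- bound `m`.
    have h1 : Tendsto (fun z => w * Real.exp (-c * z) * m
        + slope (fun s => w * Real.exp (-c * s)) x z * φ x) (𝓝[>] x)
        (𝓝 (w * Real.exp (-c * x) * m + -c * (w * Real.exp (-c * x)) * φ x)) := by
      refine (((hEc.tendsto x).mono_left nhdsWithin_le_nhds).mul_const m).add
        (Tendsto.mul_const _ ?_)
      exact (hasDerivAt_iff_tendsto_slope.1 (hE x)).mono_left
        (nhdsWithin_mono _ fun y hy => (ne_of_gt hy : y ≠ x))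
    have h2 := h1.eventually_lt_const (u := r) (by linarith)
    refine Eventually.frequently ?_
    filter_upwards [h2, hD x hx.1 m hm1, self_mem_nhdsWithin] with z hz1 hz2 hz3
    have hzx : 0 < z - x := sub_pos.2 hz3
    refine lt_of_le_of_lt ?_ hz1
    have hw' : 0 ≤ w * Real.exp (-c * z) := by positivity
    have hs : slope (fun s => w * Real.exp (-c * s) * φ s) x z
        = w * Real.exp (-c * z) * ((φ z - φ x) / (z - x))
          + slope (fun s => w * Real.exp (-c * s)) x z * φ x := by
      rw [slope_def_field, slope_def_field]
      field_simp
      ring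
    rw [hs]
    gcongr

theorem ofReal_intervalIntegral {g : ℝ → ℝ} (hg : ContinuousOn g (Ici 0))
    (h0 : ∀ s, 0 ≤ s → 0 ≤ g s) {t : ℝ} (ht : 0 ≤ t) :
    ENNReal.ofReal (∫ s in (0 : ℝ)..t, g s) = ∫⁻ s in Ioc 0 t, ENNReal.ofReal (g s) := by
  rw [intervalIntegral.integral_of_le ht]
  refine MeasureTheory.ofReal_integral_eq_lintegral_ofReal ?_ ?_
  · have : IntervalIntegrable g MeasureTheory.volume 0 t := by
      refine (hg.mono ?_).intervalIntegrable
      rw [uIcc_of_le ht]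
      exact Icc_subset_Ici_self
    exact (intervalIntegrable_iff_integrableOn_Ioc_of_le ht).1 this
  · exact (MeasureTheory.ae_restrict_iff' measurableSet_Ioc).2
      (Eventually.of_forall fun s hs => h0 s hs.1.le)

namespace Setting

variable {n : ℕ} {X : Type*} [NormedAddCommGroup X] [NormedSpace ℝ X] (S : Setting n X)

/-- The terms of the series defining the analytic norm. -/
noncomputable def term (N : ℝ → Seminorm ℝ S.Y) (t ν : ℝ) (α : Fin n → ℕ) (y : S.Y) : ENNReal :=
  ENNReal.ofReal (ν ^ len α / fact α * N t (S.conj t α y))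

theorem anorm_eq (N : ℝ → Seminorm ℝ S.Y) (t ν : ℝ) (y : S.Y) :
    S.anorm N t ν y = ∑' α, S.term N t ν α y := rfl

/-- The integral in time of a term of the analytic norm of shrinking radius. -/
noncomputable def termInt (N : ℝ → Seminorm ℝ S.Y) (μ ω t : ℝ) (u : ℝ → S.Y)
    (α : Fin n → ℕ) : ENNReal :=
  ∫⁻ s in Ioc 0 t, S.term N s (μ * Real.exp (-ω * s)) α (u s)

variable [CompleteSpace X]

theorem continuousOn_norm_conj {N : ℝ → Seminorm ℝ S.Y} (hN : S.AdmissibleNorms N)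
    {u : ℝ → S.Y} (hu : S.CL0 u) (α : Fin n → ℕ) :
    ContinuousOn (fun s => N s (S.conj s α (u s))) (Ici 0) :=
  hN.cont _ (CL0.conj S hu α)

theorem continuousOn_weighted {N : ℝ → Seminorm ℝ S.Y} (hN : S.AdmissibleNorms N)
    {u : ℝ → S.Y} (hu : S.CL0 u) (μ ω : ℝ) (α : Fin n → ℕ) :
    ContinuousOn (fun s => (μ * Real.exp (-ω * s)) ^ len α / fact α * N s (S.conj s α (u s)))
      (Ici 0) := by
  have : Continuous fun s : ℝ => (μ * Real.exp (-ω * s)) ^ len α / fact α := by fun_prop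
  exact this.continuousOn.mul (S.continuousOn_norm_conj hN hu α)

theorem aemeasurable_term {N : ℝ → Seminorm ℝ S.Y} (hN : S.AdmissibleNorms N)
    {u : ℝ → S.Y} (hu : S.CL0 u) (μ ω t : ℝ) (α : Fin n → ℕ) :
    AEMeasurable (fun s => S.term N s (μ * Real.exp (-ω * s)) α (u s))
      (MeasureTheory.volume.restrict (Ioc 0 t)) := by
  refine (AEMeasurable.ennreal_ofReal ?_)
  exact ((S.continuousOn_weighted hN hu μ ω α).mono fun s hs => hs.1.le).aemeasurable
    measurableSet_Ioc

theorem termInt_eq {N : ℝ → Seminorm ℝ S.Y} (hN : S.AdmissibleNorms N)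
    {u : ℝ → S.Y} (hu : S.CL0 u) {μ : ℝ} (hμ : 0 ≤ μ) (ω : ℝ) {t : ℝ} (ht : 0 ≤ t)
    (α : Fin n → ℕ) :
    S.termInt N μ ω t u α = ENNReal.ofReal (∫ s in (0 : ℝ)..t,
      (μ * Real.exp (-ω * s)) ^ len α / fact α * N s (S.conj s α (u s))) := by
  rw [ofReal_intervalIntegral (S.continuousOn_weighted hN hu μ ω α) (fun s _ => by positivity) ht]
  rfl

theorem termInt_ne_top {N : ℝ → Seminorm ℝ S.Y} (hN : S.AdmissibleNorms N)
    {u : ℝ → S.Y} (hu : S.CL0 u) {μ : ℝ} (hμ : 0 ≤ μ) (ω : ℝ) {t : ℝ} (ht : 0 ≤ t)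
    (α : Fin n → ℕ) : S.termInt N μ ω t u α ≠ ⊤ := by
  rw [S.termInt_eq hN hu hμ ω ht]
  exact ENNReal.ofReal_ne_top

omit [CompleteSpace X] in
/-- The contribution of the commutators, at a fixed time. -/
theorem weighted_deriv_le {N : ℝ → Seminorm ℝ S.Y} {C r : ℝ} (hC : 0 ≤ C) (hr : 0 ≤ r)
    (h2 : S.H2 N C r) {s ν μ : ℝ} (hs : 0 ≤ s) (hν : 0 < ν) (hνμ : ν ≤ μ) (α : Fin n → ℕ)
    (y z : S.Y) :
    ENNReal.ofReal (ν ^ len α / fact α * N s (S.conj s α z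
        + S.e s ((S.L * S.pw α - S.pw α * S.L) (S.e (-s) y)))) ≤
      S.term N s ν α z + ∑ γ ∈ (Finset.Icc 0 α).erase 0,
        ENNReal.ofReal (C * (r * μ) ^ len γ / μ) *
          ∑ i, ((((α - γ) i + 1 : ℕ) : ENNReal) * S.term N s ν (α - γ + unit i) y) := by
  have hμ : 0 < μ := hν.trans_le hνμ
  have hreal : ν ^ len α / fact α * N s (S.conj s α z
        + S.e s ((S.L * S.pw α - S.pw α * S.L) (S.e (-s) y))) ≤
      ν ^ len α / fact α * N s (S.conj s α z) + ∑ γ ∈ (Finset.Icc 0 α).erase 0,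
        C * (r * μ) ^ len γ / μ * ∑ i, (((α - γ) i + 1 : ℕ) : ℝ) *
          (ν ^ len (α - γ + unit i) / fact (α - γ + unit i) *
            N s (S.conj s (α - γ + unit i) y)) := by
    calc _ ≤ ν ^ len α / fact α * (N s (S.conj s α z)
          + ∑ γ ∈ (Finset.Icc 0 α).erase 0, binom α γ * (C * fact γ * r ^ len γ *
            ∑ i, N s (S.e s (S.pw (α - γ + unit i) (S.e (-s) y))))) := by
          gcongr
          exact (map_add_le_add _ _ _).trans (by gcongr; exact S.norm_commutator_le h2 hs _ _)
      _ ≤ _ := by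
          rw [mul_add, Finset.mul_sum]
          refine add_le_add le_rfl (Finset.sum_le_sum fun γ hγ => ?_)
          rw [Finset.mem_erase, Finset.mem_Icc] at hγ
          obtain ⟨hγ0, -, hγα⟩ := hγ
          obtain ⟨k, hk⟩ : ∃ k, len γ = k + 1 := by
            refine Nat.exists_eq_add_of_le' (Nat.one_le_iff_ne_zero.2 fun h => hγ0 ?_)
            exact funext fun i => Finset.sum_eq_zero_iff.1 h i (Finset.mem_univ i)
          have hlen : len α = len (α - γ) + len γ := by
            rw [← len_add, tsub_add_cancel_of_le hγα]
          rw [Finset.mul_sum, Finset.mul_sum, Finset.mul_sum, Finset.mul_sum]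
          refine Finset.sum_le_sum fun i _ => ?_
          rw [← conj_apply]
          set P := N s (S.conj s (α - γ + unit i) y)
          have hP : 0 ≤ P := apply_nonneg _ _
          have hfb : (fact α : ℝ) = binom α γ * fact γ * fact (α - γ) := by
            exact_mod_cast (binom_mul_fact hγα).symm
          have hb0 : (0 : ℝ) < binom α γ := by
            have : 0 < binom α γ := Finset.prod_pos fun i _ => Nat.choose_pos (hγα i)
            exact_mod_cast this
          have hg0 : (0 : ℝ) < fact γ := by exact_mod_cast fact_pos γ
          have hd0 : (0 : ℝ) < fact (α - γ) := by exact_mod_cast fact_pos (α - γ)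
          -- As `γ ≠ 0`, one of its `|γ| = k + 1` factors `ν` can raise the weight from `α - γ` to
          -- `α - γ + eᵢ`. The other `k` are bounded by powers of the fixed `μ`, which makes the
          -- coefficients independent of time.
          have e1 : ν ^ len α / fact α * (binom α γ * (C * fact γ * r ^ len γ * P))
              = C * r ^ len γ * ν ^ k * (ν ^ (len (α - γ) + 1) / fact (α - γ) * P) := by
            rw [hlen, hfb, hk]
            field_simp
            ring
          have e2 : C * (r * μ) ^ len γ / μ * ((((α - γ) i + 1 : ℕ) : ℝ) *
              (ν ^ len (α - γ + unit i) / fact (α - γ + unit i) * P))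
              = C * r ^ len γ * μ ^ k * (ν ^ (len (α - γ) + 1) / fact (α - γ) * P) := by
            rw [len_add, len_unit, fact_add_unit, hk]
            push_cast
            field_simp
            ring
          rw [e1, e2]
          gcongr
  refine (ENNReal.ofReal_le_ofReal hreal).trans (le_of_eq ?_)
  rw [ENNReal.ofReal_add (by positivity) (Finset.sum_nonneg fun γ _ => by positivity),
    ENNReal.ofReal_sum_of_nonneg fun γ _ => by positivity]
  congr 1
  refine Finset.sum_congr rfl fun γ _ => ?_
  rw [ENNReal.ofReal_mul (by positivity), ENNReal.ofReal_sum_of_nonneg fun i _ => by positivity]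
  congr 1
  refine Finset.sum_congr rfl fun i _ => ?_
  rw [ENNReal.ofReal_mul (by positivity), ENNReal.ofReal_natCast]
  rfl

/-- The integrated estimate for one term of the analytic norm of shrinking radius
`μ e^{-ωt}`. -/
theorem term_add_termInt_le {N : ℝ → Seminorm ℝ S.Y} (hN : S.AdmissibleNorms N) (h4 : S.H4 N)
    {C r : ℝ} (hC : 0 ≤ C) (hr : 0 ≤ r) (h2 : S.H2 N C r) {u f : ℝ → S.Y} (hf : S.CL0 f)
    (hu : ∀ t, 0 ≤ t → HasDerivWithinAt (fun s => (u s : X)) (f t : X) (Ici 0) t)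
    {μ ω : ℝ} (hμ : 0 < μ) (hω : 0 ≤ ω) {t : ℝ} (ht : 0 ≤ t) (α : Fin n → ℕ) :
    S.term N t (μ * Real.exp (-ω * t)) α (u t)
        + ENNReal.ofReal ω * ((len α : ENNReal) * S.termInt N μ ω t u α) ≤
      (S.term N 0 μ α (u 0) + S.termInt N μ ω t f α)
        + ∑ γ ∈ (Finset.Icc 0 α).erase 0, ENNReal.ofReal (C * (r * μ) ^ len γ / μ) *
          ∑ i, ((((α - γ) i + 1 : ℕ) : ENNReal) * S.termInt N μ ω t u (α - γ + unit i)) := by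
  have hu0 := S.CL0_of_hasDeriv hf hu
  set f' : ℝ → S.Y := fun t => S.conj t α (f t)
      + S.e t ((S.L * S.pw α - S.pw α * S.L) (S.e (-t) (u t))) with hf'
  have hf'0 : S.CL0 f' := S.CL0_deriv_conj hf hu0 α
  have hud : ∀ t, 0 ≤ t →
      HasDerivWithinAt (fun s => (S.conj s α (u s) : X)) (f' t : X) (Ici 0) t := by
    intro t ht
    have := S.fderiv_conj hf hu α 0 t ht
    simpa only [pw_zero, Module.End.one_apply] using this
  have hD := h4 _ f' (S.CL1_of_hasDeriv hf'0 hud) hud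
  have hw : ∀ s, μ ^ len α / fact α * Real.exp (-(ω * len α) * s)
      = (μ * Real.exp (-ω * s)) ^ len α / fact α := by
    intro s
    rw [mul_pow, ← Real.exp_nat_mul]
    have : (len α : ℝ) * (-ω * s) = -(ω * len α) * s := by ring
    rw [this]; ring
  -- The decay rate `ω|α|` makes the exponential weight that of the radius `μ e^{-ωs}`; its
  -- derivative is the source of the gain.
  have key := exp_weight_integral_le (S.continuousOn_norm_conj hN hu0 α)
    (hN.cont _ hf'0) hD (w := μ ^ len α / fact α) (c := ω * len α) (by positivity) ht
  simp only [hw, intervalIntegral.integral_const_mul] at key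
  have hcf : ContinuousOn (fun s => (μ * Real.exp (-ω * s)) ^ len α / fact α * N s (f' s))
      (Ici 0) := by
    have : Continuous fun s : ℝ => (μ * Real.exp (-ω * s)) ^ len α / fact α := by fun_prop
    exact this.continuousOn.mul (hN.cont _ hf'0)
  have hint : ∀ g : ℝ → ℝ, (∀ s, 0 ≤ s → 0 ≤ g s) → 0 ≤ ∫ s in (0 : ℝ)..t, g s := fun g hg =>
    intervalIntegral.integral_nonneg ht fun s hs => hg s hs.1
  have key2 := ENNReal.ofReal_le_ofReal key
  rw [ENNReal.ofReal_add (by positivity)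
      (mul_nonneg (by positivity) (hint _ fun s _ => by positivity)),
    ENNReal.ofReal_add (by positivity) (hint _ fun s _ => by positivity),
    ENNReal.ofReal_mul (p := ω * len α) (by positivity), ENNReal.ofReal_mul hω,
    ENNReal.ofReal_natCast, ← S.termInt_eq hN hu0 hμ.le ω ht, ofReal_intervalIntegral hcf (fun s _ => by positivity) ht,
    mul_assoc] at key2
  refine key2.trans ?_
  rw [add_assoc]
  refine add_le_add le_rfl ?_
  calc _ ≤ ∫⁻ s in Ioc 0 t, (S.term N s (μ * Real.exp (-ω * s)) α (f s)
        + ∑ γ ∈ (Finset.Icc 0 α).erase 0, ENNReal.ofReal (C * (r * μ) ^ len γ / μ) *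
          ∑ i, ((((α - γ) i + 1 : ℕ) : ENNReal)
            * S.term N s (μ * Real.exp (-ω * s)) (α - γ + unit i) (u s))) := by
        refine MeasureTheory.lintegral_mono_ae ((MeasureTheory.ae_restrict_iff'
          measurableSet_Ioc).2 (Eventually.of_forall fun s hs => ?_))
        refine S.weighted_deriv_le hC hr h2 hs.1.le (by positivity) ?_ α _ _
        refine mul_le_of_le_one_right hμ.le (Real.exp_le_one_iff.2 ?_)
        rw [neg_mul, neg_nonpos]
        exact mul_nonneg hω hs.1.le
    _ = _ := by
        have hm := fun β => S.aemeasurable_term hN hu0 μ ω t β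
        have hm2 : ∀ γ : Fin n → ℕ, AEMeasurable (fun s => ∑ i, ((((α - γ) i + 1 : ℕ) : ENNReal)
            * S.term N s (μ * Real.exp (-ω * s)) (α - γ + unit i) (u s)))
            (MeasureTheory.volume.restrict (Ioc 0 t)) := fun γ =>
          Finset.aemeasurable_fun_sum _ fun i _ => (hm _).const_mul _
        rw [MeasureTheory.lintegral_add_left' (S.aemeasurable_term hN hf μ ω t α),
          MeasureTheory.lintegral_finsetSum' _ fun γ _ => (hm2 γ).const_mul _]
        congr 1
        refine Finset.sum_congr rfl fun γ _ => ?_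
        rw [MeasureTheory.lintegral_const_mul'' _ (hm2 γ),
          MeasureTheory.lintegral_finsetSum' _ fun i _ => (hm _).const_mul _]
        congr 1
        refine Finset.sum_congr rfl fun i _ => ?_
        rw [MeasureTheory.lintegral_const_mul'' _ (hm _)]
        rfl

end Setting

end AnalyticEvolution

namespace AnalyticEvolution

/-! ### Sums over multi-indices -/

theorem tsum_convolution {n : ℕ} (F : (Fin n → ℕ) → (Fin n → ℕ) → ENNReal) :
    ∑' α : Fin n → ℕ, ∑ γ ∈ Finset.Icc 0 α, F γ (α - γ) = ∑' γ, ∑' β, F γ β := by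
  classical
  have h1 : ∀ α : Fin n → ℕ, ∑ γ ∈ Finset.Icc 0 α, F γ (α - γ)
      = ∑' γ, if γ ≤ α then F γ (α - γ) else 0 := by
    intro α
    rw [tsum_eq_sum (s := Finset.Icc 0 α)]
    · exact Finset.sum_congr rfl fun γ hγ => (if_pos (Finset.mem_Icc.1 hγ).2).symm
    · intro γ hγ
      exact if_neg fun h => hγ (Finset.mem_Icc.2 ⟨zero_le, h⟩)
  simp only [h1]
  rw [ENNReal.tsum_comm]
  refine tsum_congr fun γ => ?_
  have hinj : Function.Injective fun β : Fin n → ℕ => γ + β := add_right_injective γ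
  rw [← hinj.tsum_eq]
  · refine tsum_congr fun β => ?_
    rw [if_pos le_self_add, add_tsub_cancel_left]
  · intro α hα
    rw [Function.mem_support] at hα
    have hle : γ ≤ α := by
      by_contra h
      exact hα (if_neg h)
    exact ⟨α - γ, add_tsub_cancel_of_le hle⟩

/-- Substitute `α = β + eᵢ`: the factor becomes `αᵢ`, the missing indices have `αᵢ = 0`, and summing
over `i` gives `|α|`. -/
theorem tsum_shift {n : ℕ} (h : (Fin n → ℕ) → ENNReal) :
    ∑' β : Fin n → ℕ, ∑ i, (((β i + 1 : ℕ) : ENNReal) * h (β + unit i))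
      = ∑' α, (len α : ENNReal) * h α := by
  have h1 : ∀ α : Fin n → ℕ, (len α : ENNReal) * h α = ∑ i, (α i : ENNReal) * h α := by
    intro α
    rw [len, Nat.cast_sum, Finset.sum_mul]
  simp only [h1]
  rw [Summable.tsum_finsetSum fun _ _ => ENNReal.summable,
    Summable.tsum_finsetSum fun _ _ => ENNReal.summable]
  refine Finset.sum_congr rfl fun i _ => ?_
  have hinj : Function.Injective fun β : Fin n → ℕ => β + unit i := add_left_injective _
  rw [← hinj.tsum_eq (f := fun α => (α i : ENNReal) * h α)]
  · refine tsum_congr fun β => ?_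
    have : (β + unit i) i = β i + 1 := by simp [unit]
    rw [this]
  · intro α hα
    rw [Function.mem_support] at hα
    have hle : 1 ≤ α i := by
      by_contra h
      have : α i = 0 := by omega
      exact hα (by simp only [this, Nat.cast_zero, zero_mul])
    exact ⟨α - unit i, tsub_add_cancel_of_le (Setting.unit_le hle)⟩

theorem tsum_pow_len {n : ℕ} {x : ℝ} (hx : 0 ≤ x) (hx1 : x < 1) :
    ∑' γ : Fin n → ℕ, ENNReal.ofReal (x ^ len γ) = ENNReal.ofReal (((1 - x)⁻¹) ^ n) := by
  induction n with
  | zero =>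
    rw [tsum_eq_single (0 : Fin 0 → ℕ) fun b hb => absurd (Subsingleton.elim b 0) hb]
    simp [len]
  | succ n ih =>
    rw [← (Fin.consEquiv fun _ : Fin (n + 1) => ℕ).tsum_eq,
      ENNReal.tsum_prod (f := fun k γ => ENNReal.ofReal
        (x ^ len ((Fin.consEquiv fun _ : Fin (n + 1) => ℕ) (k, γ))))]
    have h1 : ∀ (k : ℕ) (γ : Fin n → ℕ), ENNReal.ofReal
        (x ^ len ((Fin.consEquiv fun _ : Fin (n + 1) => ℕ) (k, γ)))
        = ENNReal.ofReal (x ^ k) * ENNReal.ofReal (x ^ len γ) := by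
      intro k γ
      rw [← ENNReal.ofReal_mul (by positivity), ← pow_add]
      congr 2
      simp [len, Fin.consEquiv, Fin.sum_univ_succ]
    simp only [h1, ENNReal.tsum_mul_left, ENNReal.tsum_mul_right, ih]
    rw [← ENNReal.ofReal_tsum_of_nonneg (fun k => by positivity)
      (summable_geometric_of_lt_one hx hx1), tsum_geometric_of_lt_one hx hx1,
      ← ENNReal.ofReal_mul (by rw [inv_nonneg]; linarith), pow_succ']

/-- The sum is `(1-x)^{-n} - 1`, and Bernoulli's inequality `(1-x)^n ≥ 1 - nx` bounds it. This is
the origin of the constant `nCr` in the condition on `ν₀`. -/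
theorem tsum_pow_len_ne_zero_le {n : ℕ} {x : ℝ} (hx : 0 ≤ x) (hx1 : x < 1) :
    ∑' γ : Fin n → ℕ, (if γ = 0 then 0 else ENNReal.ofReal (x ^ len γ))
      ≤ ENNReal.ofReal (n * x / (1 - x) ^ n) := by
  have hpos : 0 < (1 - x) ^ n := pow_pos (by linarith) n
  have h1 := tsum_pow_len (n := n) hx hx1
  rw [ENNReal.tsum_eq_add_tsum_ite 0] at h1
  have h0 : ENNReal.ofReal (x ^ len (0 : Fin n → ℕ)) = 1 := by simp [len]
  rw [h0] at h1
  have h2 : ENNReal.ofReal (((1 - x)⁻¹) ^ n) ≤ 1 + ENNReal.ofReal (n * x / (1 - x) ^ n) := by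
    rw [← ENNReal.ofReal_one, ← ENNReal.ofReal_add zero_le_one (by positivity)]
    refine ENNReal.ofReal_le_ofReal ?_
    have hb := one_add_mul_le_pow (a := -x) (by linarith) n
    rw [inv_pow, ← one_div, div_le_iff₀ hpos, add_mul, div_mul_cancel₀ _ hpos.ne', one_mul]
    have : (1 + -x) ^ n = (1 - x) ^ n := by ring
    rw [this] at hb
    linarith
  rw [← h1] at h2
  convert! (ENNReal.add_le_add_iff_left ENNReal.one_ne_top).1 h2

/-- Summation of the termwise estimates. -/
theorem tsum_add_tsum_le {n : ℕ} {a b I c : (Fin n → ℕ) → ENNReal} (hI : ∀ α, I α ≠ ⊤)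
    {ω κ : ENNReal} (hω : ω ≠ ⊤)
    (h : ∀ α, a α + ω * ((len α : ENNReal) * I α) ≤ b α
      + ∑ γ ∈ (Finset.Icc 0 α).erase 0, c γ *
        ∑ i, ((((α - γ) i + 1 : ℕ) : ENNReal) * I (α - γ + unit i)))
    (hc : ∑' γ, (if γ = 0 then 0 else c γ) + κ ≤ ω) :
    ∑' α, a α + κ * ∑' α, (len α : ENNReal) * I α ≤ ∑' α, b α := by
  set c' : (Fin n → ℕ) → ENNReal := fun γ => if γ = 0 then 0 else c γ with hc'
  have hcfin : ∑' γ, c' γ ≠ ⊤ := ne_top_of_le_ne_top hω (le_self_add.trans hc)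
  rw [← ENNReal.tsum_mul_left, ← ENNReal.tsum_add]
  rw [ENNReal.tsum_eq_iSup_sum]
  refine iSup_le fun s => ?_
  -- The full sums may be infinite and cannot be subtracted. The truncation `|α| ≤ m` makes them
  -- finite and is stable under the commutator terms, since `|α - γ + eᵢ| ≤ |α|` for `γ ≠ 0`. This
  -- `m` is merely large enough for the truncation to contain `s`.
  set m := ∑ α ∈ s, len α with hm
  let T : Finset (Fin n → ℕ) := (Finset.Icc 0 fun _ => m).filter fun α => len α ≤ m
  have hT : ∀ α, α ∈ T ↔ len α ≤ m := by
    intro α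
    refine ⟨fun hα => (Finset.mem_filter.1 hα).2, fun hα => Finset.mem_filter.2
      ⟨Finset.mem_Icc.2 ⟨zero_le, fun i => ?_⟩, hα⟩⟩
    exact (Finset.single_le_sum (f := α) (fun _ _ => zero_le) (Finset.mem_univ i)).trans hα
  have hsT : s ⊆ T := fun α hα => (hT α).2
    (Finset.single_le_sum (f := fun α => len α) (fun _ _ => zero_le) hα)
  refine (Finset.sum_le_sum_of_subset hsT).trans ?_
  set I' : (Fin n → ℕ) → ENNReal := fun α => if α ∈ T then I α else 0 with hI'
  set D : ENNReal := ∑ α ∈ T, (len α : ENNReal) * I α with hD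
  have hDfin : D ≠ ⊤ := ENNReal.sum_ne_top.2 fun α _ =>
    ENNReal.mul_ne_top (ENNReal.natCast_ne_top _) (hI α)
  have hDI : ∑' α, (len α : ENNReal) * I' α = D := by
    rw [tsum_eq_sum (s := T)]
    · exact Finset.sum_congr rfl fun α hα => by rw [hI']; simp only [if_pos hα]
    · intro α hα
      simp only [hI', if_neg hα, mul_zero]
  have hlin : ∑ α ∈ T, ∑ γ ∈ (Finset.Icc 0 α).erase 0, c γ *
        ∑ i, ((((α - γ) i + 1 : ℕ) : ENNReal) * I (α - γ + unit i)) ≤ (∑' γ, c' γ) * D := by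
    calc _ ≤ ∑ α ∈ T, ∑ γ ∈ Finset.Icc 0 α, c' γ *
        ∑ i, ((((α - γ) i + 1 : ℕ) : ENNReal) * I' (α - γ + unit i)) := by
          refine Finset.sum_le_sum fun α hα => ?_
          refine le_trans (le_of_eq ?_) (Finset.sum_le_sum_of_subset (Finset.erase_subset 0 _))
          refine Finset.sum_congr rfl fun γ hγ => ?_
          rw [Finset.mem_erase, Finset.mem_Icc] at hγ
          have h1 : c' γ = c γ := if_neg hγ.1
          rw [h1]
          congr 1
          refine Finset.sum_congr rfl fun i _ => ?_
          have h2 : α - γ + unit i ∈ T := by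
            rw [hT, Setting.len_add, Setting.len_unit]
            have h3 : len α = len (α - γ) + len γ := by
              rw [← Setting.len_add, tsub_add_cancel_of_le hγ.2.2]
            have h4 : len γ ≠ 0 := fun h => hγ.1
              (funext fun i => Finset.sum_eq_zero_iff.1 h i (Finset.mem_univ i))
            have := (hT α).1 hα
            omega
          simp only [hI', if_pos h2]
      _ ≤ ∑' α, ∑ γ ∈ Finset.Icc 0 α, c' γ *
        ∑ i, ((((α - γ) i + 1 : ℕ) : ENNReal) * I' (α - γ + unit i)) := ENNReal.sum_le_tsum _
      _ = _ := by
          rw [tsum_convolution fun γ β => c' γ * ∑ i, (((β i + 1 : ℕ) : ENNReal)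
            * I' (β + unit i))]
          simp only [ENNReal.tsum_mul_left, tsum_shift, hDI, ENNReal.tsum_mul_right]
  have hsum : ∑ α ∈ T, a α + ω * D ≤ ∑' α, b α + (∑' γ, c' γ) * D := by
    calc _ = ∑ α ∈ T, (a α + ω * ((len α : ENNReal) * I α)) := by
          rw [Finset.sum_add_distrib, ← Finset.mul_sum]
      _ ≤ _ := Finset.sum_le_sum fun α _ => h α
      _ ≤ _ := by
          rw [Finset.sum_add_distrib]
          exact add_le_add (ENNReal.sum_le_tsum _) hlin
  rw [Finset.sum_add_distrib, ← Finset.mul_sum]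
  have hfin : (∑' γ, c' γ) * D ≠ ⊤ := ENNReal.mul_ne_top hcfin hDfin
  refine (ENNReal.add_le_add_iff_right hfin).1 (le_trans ?_ hsum)
  rw [add_assoc, ← add_mul, add_comm κ]
  gcongr

end AnalyticEvolution

/-! ### The nonlinearity in the analytic norms, and the energy estimate. -/

namespace AnalyticEvolution

/-- The weighted sums turn multi-index convolutions into products. -/
theorem tsum_weighted_convolution {n : ℕ} {ν : ℝ} (hν : 0 ≤ ν) {p q : (Fin n → ℕ) → ℝ}
    (hp : ∀ α, 0 ≤ p α) (hq : ∀ α, 0 ≤ q α) :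
    ∑' α : Fin n → ℕ, ENNReal.ofReal (ν ^ len α / fact α *
        ∑ γ ∈ Finset.Icc 0 α, binom α γ * (p (α - γ) * q γ))
      = (∑' α : Fin n → ℕ, ENNReal.ofReal (ν ^ len α / fact α * p α))
        * ∑' α : Fin n → ℕ, ENNReal.ofReal (ν ^ len α / fact α * q α) := by
  have h1 : ∀ α : Fin n → ℕ, ENNReal.ofReal (ν ^ len α / fact α *
        ∑ γ ∈ Finset.Icc 0 α, binom α γ * (p (α - γ) * q γ))
      = ∑ γ ∈ Finset.Icc 0 α, ENNReal.ofReal (ν ^ len (α - γ) / fact (α - γ) * p (α - γ)) *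
          ENNReal.ofReal (ν ^ len γ / fact γ * q γ) := by
    intro α
    rw [Finset.mul_sum, ENNReal.ofReal_sum_of_nonneg fun γ _ => by
      have := hp (α - γ); have := hq γ; positivity]
    refine Finset.sum_congr rfl fun γ hγ => ?_
    have hγ' := (Finset.mem_Icc.1 hγ).2
    rw [← ENNReal.ofReal_mul (by have := hp (α - γ); positivity)]
    congr 1
    have hlen : len α = len (α - γ) + len γ := by
      rw [← Setting.len_add, tsub_add_cancel_of_le hγ']
    have hfb : (fact α : ℝ) = binom α γ * fact γ * fact (α - γ) := by
      exact_mod_cast (binom_mul_fact hγ').symm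
    have hb0 : (binom α γ : ℝ) ≠ 0 := by
      have : 0 < binom α γ := Finset.prod_pos fun i _ => Nat.choose_pos (hγ' i)
      exact_mod_cast this.ne'
    have hg0 : (fact γ : ℝ) ≠ 0 := by exact_mod_cast (fact_pos γ).ne'
    have hd0 : (fact (α - γ) : ℝ) ≠ 0 := by exact_mod_cast (fact_pos (α - γ)).ne'
    rw [hlen, hfb, pow_add]
    field_simp
  simp only [h1]
  rw [tsum_convolution fun γ β => ENNReal.ofReal (ν ^ len β / fact β * p β) *
          ENNReal.ofReal (ν ^ len γ / fact γ * q γ)]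
  simp only [ENNReal.tsum_mul_right, ENNReal.tsum_mul_left]

theorem lintegral_exp_neg_le {ω : ℝ} (hω : 0 < ω) (t : ℝ) :
    ∫⁻ s in Ioc 0 t, ENNReal.ofReal (Real.exp (-ω * s)) ≤ ENNReal.ofReal (1 / ω) := by
  calc _ ≤ ∫⁻ s in Ioi 0, ENNReal.ofReal (Real.exp (-ω * s)) :=
        MeasureTheory.lintegral_mono_set Ioc_subset_Ioi_self
    _ = ENNReal.ofReal (∫ s in Ioi 0, Real.exp (-ω * s)) :=
        (MeasureTheory.ofReal_integral_eq_lintegral_ofReal (integrableOn_exp_mul_Ioi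
          (neg_lt_zero.2 hω) 0) (Eventually.of_forall fun s => (Real.exp_pos _).le)).symm
    _ ≤ _ := by
        rw [integral_exp_mul_Ioi (neg_lt_zero.2 hω)]
        simp

namespace Setting

variable {n : ℕ} {X : Type*} [NormedAddCommGroup X] [NormedSpace ℝ X] (S : Setting n X)

/-- The weighted derivative `ν ∂_ν ‖y‖_{X_t^ν}` of the analytic norm. -/
noncomputable def gnorm (N : ℝ → Seminorm ℝ S.Y) (t ν : ℝ) (y : S.Y) : ENNReal :=
  ∑' α, (len α : ENNReal) * S.term N t ν α y

/-- The derivative `∂_ν ‖y‖_{X_t^ν}` of the analytic norm. -/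
noncomputable def dnorm (N : ℝ → Seminorm ℝ S.Y) (t ν : ℝ) (y : S.Y) : ENNReal :=
  ∑' α : Fin n → ℕ, ∑ i, ENNReal.ofReal (ν ^ len α / fact α * N t (S.conj t (α + unit i) y))

/-- The time integral of `gnorm`. -/
noncomputable def gint (N : ℝ → Seminorm ℝ S.Y) (μ ω t : ℝ) (u : ℝ → S.Y) : ENNReal :=
  ∑' α, (len α : ENNReal) * S.termInt N μ ω t u α

theorem ofReal_mul_dnorm (N : ℝ → Seminorm ℝ S.Y) (t : ℝ) {ν : ℝ} (hν : 0 ≤ ν) (y : S.Y) :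
    ENNReal.ofReal ν * S.dnorm N t ν y = S.gnorm N t ν y := by
  rw [gnorm, ← tsum_shift, dnorm, ← ENNReal.tsum_mul_left]
  refine tsum_congr fun β => ?_
  rw [Finset.mul_sum]
  refine Finset.sum_congr rfl fun i _ => ?_
  rw [term, ← ENNReal.ofReal_natCast, ← ENNReal.ofReal_mul (Nat.cast_nonneg _),
    ← ENNReal.ofReal_mul hν]
  congr 1
  have hf : (fact β : ℝ) ≠ 0 := by exact_mod_cast (fact_pos β).ne'
  rw [len_add, len_unit, fact_add_unit]
  push_cast
  field_simp
  ring

theorem tsum_firstOrder (N : ℝ → Seminorm ℝ S.Y) (t : ℝ) {ν M₀ M₁ : ℝ} (hν : 0 ≤ ν)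
    (hM₀ : 0 ≤ M₀) (hM₁ : 0 ≤ M₁) (y : S.Y) :
    ∑' α : Fin n → ℕ, ENNReal.ofReal (ν ^ len α / fact α *
        S.firstOrder N M₀ M₁ t α (S.e (-t) y))
      = ENNReal.ofReal M₀ * S.anorm N t ν y + ENNReal.ofReal M₁ * S.dnorm N t ν y := by
  rw [anorm_eq, dnorm, ← ENNReal.tsum_mul_left, ← ENNReal.tsum_mul_left, ← ENNReal.tsum_add]
  refine tsum_congr fun α => ?_
  rw [firstOrder, mul_add, ENNReal.ofReal_add (by positivity)
    (mul_nonneg (by positivity) (Finset.sum_nonneg fun i _ => by positivity)), Finset.mul_sum,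
    ENNReal.ofReal_sum_of_nonneg fun i _ => by positivity, Finset.mul_sum, term,
    ← ENNReal.ofReal_mul hM₀]
  congr 1
  · rw [conj_apply]; ring_nf
  · refine Finset.sum_congr rfl fun i _ => ?_
    rw [← ENNReal.ofReal_mul hM₁, conj_apply]
    ring_nf

theorem firstOrder_nonneg (N : ℝ → Seminorm ℝ S.Y) {M₀ M₁ : ℝ} (hM₀ : 0 ≤ M₀) (hM₁ : 0 ≤ M₁)
    (t : ℝ) (γ : Fin n → ℕ) (y : S.Y) : 0 ≤ S.firstOrder N M₀ M₁ t γ y :=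
  add_nonneg (by positivity) (Finset.sum_nonneg fun i _ => by positivity)

theorem conj_transf (Q : ℝ → S.Y → S.Y) (t : ℝ) (α : Fin n → ℕ) (y : S.Y) :
    S.conj t α (S.transf Q t y) = S.e t (S.pw α (Q t (S.e (-t) y))) := by
  rw [conj_apply, transf, e_neg_e]

/-- (H3a′) has the form of Leibniz' rule, so with the weights `ν^{|α|}/α!` its sum over `α` factors
into a product, with one derivative lost in one factor. -/
theorem anorm_transf_le {N : ℝ → Seminorm ℝ S.Y} {Q : ℝ → S.Y → S.Y} {ω M₀ M₁ : ℝ}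
    (hM₀ : 0 ≤ M₀) (hM₁ : 0 ≤ M₁) (h3a : S.H3a N Q ω M₀ M₁) {t ν : ℝ} (ht : 0 < t)
    (hν : 0 ≤ ν) (y : S.Y) :
    S.anorm N t ν (S.transf Q t y) ≤ ENNReal.ofReal (Real.exp (-ω * t)) * (S.anorm N t ν y *
      (ENNReal.ofReal M₀ * S.anorm N t ν y + ENNReal.ofReal M₁ * S.dnorm N t ν y)) := by
  rw [← S.tsum_firstOrder N t hν hM₀ hM₁ y]
  have hc := tsum_weighted_convolution hν (p := fun α => N t (S.conj t α y))
    (q := fun α => S.firstOrder N M₀ M₁ t α (S.e (-t) y)) (fun _ => apply_nonneg _ _)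
    (fun α => S.firstOrder_nonneg N hM₀ hM₁ t α _)
  rw [anorm_eq, anorm_eq]
  simp only [term]
  rw [← hc, ← ENNReal.tsum_mul_left]
  refine ENNReal.tsum_le_tsum fun α => ?_
  rw [← ENNReal.ofReal_mul (Real.exp_pos _).le, conj_transf]
  refine ENNReal.ofReal_le_ofReal ?_
  rw [mul_left_comm]
  gcongr
  exact h3a t ht α (S.e (-t) y)

/-- Eliminates the supremum in (H3b′). The sum of the endpoint values, unlike their maximum, is
compatible with the sums over multi-indices. -/
theorem le_add_of_mem_segment (p : Seminorm ℝ S.Y) {x y z : S.Y} (hz : z ∈ segment ℝ x y)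
    (B : Module.End ℝ S.Y) : p (B z) ≤ p (B x) + p (B y) := by
  obtain ⟨a, b, ha, hb, hab, rfl⟩ := hz
  rw [map_add, map_smul, map_smul]
  refine (map_add_le_add _ _ _).trans ?_
  rw [map_smul_eq_mul, map_smul_eq_mul, Real.norm_of_nonneg ha, Real.norm_of_nonneg hb]
  exact add_le_add (mul_le_of_le_one_left (apply_nonneg _ _) (by linarith))
    (mul_le_of_le_one_left (apply_nonneg _ _) (by linarith))

theorem firstOrder_le_add_of_mem_segment (N : ℝ → Seminorm ℝ S.Y) {M₀ M₁ : ℝ} (hM₀ : 0 ≤ M₀)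
    (hM₁ : 0 ≤ M₁) (t : ℝ) (γ : Fin n → ℕ) {x y z : S.Y} (hz : z ∈ segment ℝ x y) :
    S.firstOrder N M₀ M₁ t γ z ≤ S.firstOrder N M₀ M₁ t γ x + S.firstOrder N M₀ M₁ t γ y := by
  have h := fun δ => S.le_add_of_mem_segment (N t) hz (S.e t * S.pw δ)
  simp only [Module.End.mul_apply] at h
  calc S.firstOrder N M₀ M₁ t γ z
      ≤ M₀ * (N t (S.e t (S.pw γ x)) + N t (S.e t (S.pw γ y)))
        + ∑ i, M₁ * (N t (S.e t (S.pw (γ + unit i) x)) + N t (S.e t (S.pw (γ + unit i) y))) := by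
        unfold firstOrder
        gcongr
        · exact h _
        · exact h _
    _ = _ := by
        simp only [firstOrder, mul_add, Finset.sum_add_distrib]
        ring

/-- The Lipschitz bound, with the supremum estimated. -/
theorem norm_transf_sub_le {N : ℝ → Seminorm ℝ S.Y} {Q : ℝ → S.Y → S.Y} {ω M₀ M₁ : ℝ}
    (hM₀ : 0 ≤ M₀) (hM₁ : 0 ≤ M₁) (h3b : S.H3b N Q ω M₀ M₁) {t : ℝ} (ht : 0 < t)
    (α : Fin n → ℕ) (x y : S.Y) :
    N t (S.conj t α (S.transf Q t y - S.transf Q t x)) ≤ Real.exp (-ω * t) *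
      (∑ γ ∈ Finset.Icc 0 α, binom α γ * ((N t (S.conj t (α - γ) x) + N t (S.conj t (α - γ) y))
          * S.firstOrder N M₀ M₁ t γ (S.e (-t) (y - x)))
        + ∑ γ ∈ Finset.Icc 0 α, binom α γ * (N t (S.conj t (α - γ) (y - x)) *
          (S.firstOrder N M₀ M₁ t γ (S.e (-t) x) + S.firstOrder N M₀ M₁ t γ (S.e (-t) y)))) := by
  rw [map_sub, conj_transf, conj_transf, ← map_sub, ← map_sub]
  refine h3b t ht α _ _ _ fun z hz z' hz' => ?_
  rw [← Finset.sum_add_distrib]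
  unfold lipTerm
  refine Finset.sum_le_sum fun γ _ => ?_
  rw [← mul_add, ← map_sub]
  have h1 := S.le_add_of_mem_segment (N t) hz (S.e t * S.pw (α - γ))
  have h2 := S.firstOrder_le_add_of_mem_segment N hM₀ hM₁ t γ hz'
  have h3 := S.firstOrder_nonneg N hM₀ hM₁ t γ (S.e (-t) (y - x))
  simp only [Module.End.mul_apply] at h1
  simp only [conj_apply]
  gcongr

theorem anorm_transf_sub_le {N : ℝ → Seminorm ℝ S.Y} {Q : ℝ → S.Y → S.Y} {ω M₀ M₁ : ℝ}
    (hM₀ : 0 ≤ M₀) (hM₁ : 0 ≤ M₁) (h3b : S.H3b N Q ω M₀ M₁) {t ν : ℝ} (ht : 0 < t)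
    (hν : 0 ≤ ν) (x y : S.Y) :
    S.anorm N t ν (S.transf Q t y - S.transf Q t x) ≤ ENNReal.ofReal (Real.exp (-ω * t)) *
      ((S.anorm N t ν x + S.anorm N t ν y) *
        (ENNReal.ofReal M₀ * S.anorm N t ν (y - x) + ENNReal.ofReal M₁ * S.dnorm N t ν (y - x))
      + S.anorm N t ν (y - x) *
        ((ENNReal.ofReal M₀ * S.anorm N t ν x + ENNReal.ofReal M₁ * S.dnorm N t ν x)
        + (ENNReal.ofReal M₀ * S.anorm N t ν y + ENNReal.ofReal M₁ * S.dnorm N t ν y))) := by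
  simp only [← S.tsum_firstOrder N t hν hM₀ hM₁]
  have hw : ∀ α : Fin n → ℕ, 0 ≤ ν ^ len α / fact α := fun α => by positivity
  have hF := fun α z => S.firstOrder_nonneg N hM₀ hM₁ t α (S.e (-t) z)
  have hsum : ∀ f g : (Fin n → ℕ) → ℝ, (∀ α, 0 ≤ f α) → (∀ α, 0 ≤ g α) →
      ∑' α : Fin n → ℕ, ENNReal.ofReal (ν ^ len α / fact α * f α)
        + ∑' α : Fin n → ℕ, ENNReal.ofReal (ν ^ len α / fact α * g α)
      = ∑' α : Fin n → ℕ, ENNReal.ofReal (ν ^ len α / fact α * (f α + g α)) := by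
    intro f g hf hg
    rw [← ENNReal.tsum_add]
    refine tsum_congr fun α => ?_
    rw [mul_add, ENNReal.ofReal_add (mul_nonneg (hw α) (hf α)) (mul_nonneg (hw α) (hg α))]
  simp only [anorm_eq, term]
  rw [hsum _ _ (fun _ => apply_nonneg _ _) (fun _ => apply_nonneg _ _),
    hsum _ _ (fun α => hF α x) (fun α => hF α y),
    ← tsum_weighted_convolution hν (fun _ => by positivity) (fun α => hF α (y - x)),
    ← tsum_weighted_convolution hν (fun _ => apply_nonneg _ _)
      (fun α => add_nonneg (hF α x) (hF α y)),
    hsum _ _ (fun α => Finset.sum_nonneg fun γ _ => mul_nonneg (by positivity)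
        (mul_nonneg (by positivity) (hF γ (y - x))))
      (fun α => Finset.sum_nonneg fun γ _ => mul_nonneg (by positivity)
        (mul_nonneg (by positivity) (add_nonneg (hF γ x) (hF γ y)))), ← ENNReal.tsum_mul_left]
  refine ENNReal.tsum_le_tsum fun α => ?_
  rw [← ENNReal.ofReal_mul (Real.exp_pos _).le]
  refine ENNReal.ofReal_le_ofReal ?_
  rw [mul_left_comm]
  gcongr
  exact S.norm_transf_sub_le hM₀ hM₁ h3b ht α x y

theorem term_sub_le (N : ℝ → Seminorm ℝ S.Y) (t : ℝ) {ν : ℝ} (hν : 0 ≤ ν) (α : Fin n → ℕ)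
    (x y : S.Y) : S.term N t ν α (x - y) ≤ S.term N t ν α x + S.term N t ν α y := by
  simp only [term]
  rw [← ENNReal.ofReal_add (by positivity) (by positivity), ← mul_add, map_sub]
  gcongr
  exact map_sub_le_add _ _ _

theorem anorm_sub_le (N : ℝ → Seminorm ℝ S.Y) (t : ℝ) {ν : ℝ} (hν : 0 ≤ ν) (x y : S.Y) :
    S.anorm N t ν (x - y) ≤ S.anorm N t ν x + S.anorm N t ν y := by
  simp only [anorm_eq]
  rw [← ENNReal.tsum_add]
  exact ENNReal.tsum_le_tsum fun α => S.term_sub_le N t hν α x y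

theorem anorm_zero (N : ℝ → Seminorm ℝ S.Y) (t ν : ℝ) : S.anorm N t ν 0 = 0 := by
  simp [anorm_eq, term]

/-! ### Estimates integrated in time -/

variable [CompleteSpace X]

theorem lintegral_anorm {N : ℝ → Seminorm ℝ S.Y} (hN : S.AdmissibleNorms N)
    {u : ℝ → S.Y} (hu : S.CL0 u) (μ ω t : ℝ) :
    ∫⁻ s in Ioc 0 t, S.anorm N s (μ * Real.exp (-ω * s)) (u s)
      = ∑' α, S.termInt N μ ω t u α := by
  simp only [anorm_eq]
  rw [MeasureTheory.lintegral_tsum fun α => S.aemeasurable_term hN hu μ ω t α]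
  rfl

theorem lintegral_gnorm {N : ℝ → Seminorm ℝ S.Y} (hN : S.AdmissibleNorms N)
    {u : ℝ → S.Y} (hu : S.CL0 u) (μ ω t : ℝ) :
    ∫⁻ s in Ioc 0 t, S.gnorm N s (μ * Real.exp (-ω * s)) (u s) = S.gint N μ ω t u := by
  simp only [gnorm]
  rw [MeasureTheory.lintegral_tsum fun α => (S.aemeasurable_term hN hu μ ω t α).const_mul _]
  refine tsum_congr fun α => ?_
  rw [MeasureTheory.lintegral_const_mul'' _ (S.aemeasurable_term hN hu μ ω t α)]
  rfl

theorem aemeasurable_gnorm {N : ℝ → Seminorm ℝ S.Y} (hN : S.AdmissibleNorms N)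
    {u : ℝ → S.Y} (hu : S.CL0 u) (μ ω t : ℝ) :
    AEMeasurable (fun s => S.gnorm N s (μ * Real.exp (-ω * s)) (u s))
      (MeasureTheory.volume.restrict (Ioc 0 t)) :=
  AEMeasurable.tsum fun α => (S.aemeasurable_term hN hu μ ω t α).const_mul _

theorem gint_sub_le {N : ℝ → Seminorm ℝ S.Y} (hN : S.AdmissibleNorms N)
    {u v : ℝ → S.Y} (hu : S.CL0 u) {μ : ℝ} (hμ : 0 ≤ μ) (ω t : ℝ) :
    S.gint N μ ω t (fun s => u s - v s) ≤ S.gint N μ ω t u + S.gint N μ ω t v := by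
  simp only [gint]
  rw [← ENNReal.tsum_add]
  refine ENNReal.tsum_le_tsum fun α => ?_
  rw [← mul_add]
  gcongr
  simp only [termInt]
  rw [← MeasureTheory.lintegral_add_left' (S.aemeasurable_term hN hu μ ω t α)]
  exact MeasureTheory.lintegral_mono fun s => S.term_sub_le N s (by positivity) α _ _

/-- The energy estimate for `∂ₜ u = f` in the analytic norms of radius `μ e^{-ωt}`. -/
theorem energy_le {N : ℝ → Seminorm ℝ S.Y} (hN : S.AdmissibleNorms N) (h4 : S.H4 N)
    {C r : ℝ} (hC : 0 ≤ C) (hr : 0 ≤ r) (h2 : S.H2 N C r) {u f : ℝ → S.Y} (hf : S.CL0 f)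
    (hu : ∀ t, 0 ≤ t → HasDerivWithinAt (fun s => (u s : X)) (f t : X) (Ici 0) t)
    {μ ω δ ν₀ : ℝ} (hμ : 0 < μ) (hμν : μ ≤ ν₀) (hω : 0 < ω) (hδ : 0 ≤ δ) (hrν : r * ν₀ < 1)
    (hgap : n * C * r ≤ (1 - δ) * ω * (1 - r * ν₀) ^ n) {t : ℝ} (ht : 0 ≤ t) :
    S.anorm N t (μ * Real.exp (-ω * t)) (u t) + ENNReal.ofReal (δ * ω) * S.gint N μ ω t u
      ≤ S.anorm N 0 μ (u 0) + ∫⁻ s in Ioc 0 t, S.anorm N s (μ * Real.exp (-ω * s)) (f s) := by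
  rw [S.lintegral_anorm hN hf, anorm_eq, anorm_eq, ← ENNReal.tsum_add]
  refine tsum_add_tsum_le (ω := ENNReal.ofReal ω) (c := fun γ => ENNReal.ofReal
    (C * (r * μ) ^ len γ / μ))
    (fun α => S.termInt_ne_top hN (S.CL0_of_hasDeriv hf hu) hμ.le ω ht α) ENNReal.ofReal_ne_top
    (fun α => S.term_add_termInt_le hN h4 hC hr h2 hf hu hμ hω.le ht α) ?_
  have hrμ : r * μ ≤ r * ν₀ := by gcongr
  have hrμ0 : 0 ≤ r * μ := by positivity
  have h1 : ∀ γ : Fin n → ℕ, (if γ = 0 then 0 else ENNReal.ofReal (C * (r * μ) ^ len γ / μ))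
      = ENNReal.ofReal (C / μ) * (if γ = 0 then 0 else ENNReal.ofReal ((r * μ) ^ len γ)) := by
    intro γ
    split_ifs
    · rw [mul_zero]
    · rw [← ENNReal.ofReal_mul (by positivity)]
      congr 1
      ring
  simp only [h1, ENNReal.tsum_mul_left]
  refine (add_le_add (mul_le_mul_right (tsum_pow_len_ne_zero_le hrμ0 (hrμ.trans_lt hrν)) _)
    le_rfl).trans ?_
  have hpos : 0 < (1 - r * ν₀) ^ n := pow_pos (by linarith) n
  have hpos' : 0 < (1 - r * μ) ^ n := pow_pos (by linarith) n
  rw [← ENNReal.ofReal_mul (by positivity), ← ENNReal.ofReal_add (by positivity) (by positivity)]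
  refine ENNReal.ofReal_le_ofReal ?_
  -- The factor `1/μ` cancels against the first power of `rμ` in the Bernoulli bound, so the
  -- estimate is uniform for `μ ≤ ν₀`.
  have h2 : C / μ * (n * (r * μ) / (1 - r * μ) ^ n) = n * C * r / (1 - r * μ) ^ n := by
    field_simp
  have h3 : n * C * r / (1 - r * μ) ^ n ≤ n * C * r / (1 - r * ν₀) ^ n := by
    gcongr
  have h5 : n * C * r / (1 - r * ν₀) ^ n ≤ (1 - δ) * ω := by rwa [div_le_iff₀ hpos]
  rw [h2]
  linarith

omit [CompleteSpace X] in
-- The decay of `Q` matches the decay of the radius: the derivative lost by `Q` becomes, up to the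
-- constant `1/μ`, the quantity gained in the energy estimate.
theorem exp_mul_dnorm (N : ℝ → Seminorm ℝ S.Y) {μ : ℝ} (hμ : 0 < μ) (ω t : ℝ) (y : S.Y) :
    ENNReal.ofReal (Real.exp (-ω * t)) * S.dnorm N t (μ * Real.exp (-ω * t)) y
      = ENNReal.ofReal (1 / μ) * S.gnorm N t (μ * Real.exp (-ω * t)) y := by
  rw [← S.ofReal_mul_dnorm N t (by positivity), ← mul_assoc, ← ENNReal.ofReal_mul (by positivity)]
  congr 2
  field_simp

theorem lintegral_anorm_transf_le {N : ℝ → Seminorm ℝ S.Y} (hN : S.AdmissibleNorms N)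
    {Q : ℝ → S.Y → S.Y} {ω M₀ M₁ : ℝ} (hω : 0 < ω)
    (hM₀ : 0 ≤ M₀) (hM₁ : 0 ≤ M₁) (h3a : S.H3a N Q ω M₀ M₁) {μ t : ℝ} (hμ : 0 < μ)
    {u : ℝ → S.Y} (hu : S.CL0 u) {A : ENNReal}
    (hA : ∀ s, 0 ≤ s → s ≤ t → S.anorm N s (μ * Real.exp (-ω * s)) (u s) ≤ A) :
    ∫⁻ s in Ioc 0 t, S.anorm N s (μ * Real.exp (-ω * s)) (S.transf Q s (u s)) ≤
      A * (ENNReal.ofReal M₀ * A * ENNReal.ofReal (1 / ω)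
        + ENNReal.ofReal (M₁ / μ) * S.gint N μ ω t u) := by
  calc _ ≤ ∫⁻ s in Ioc 0 t, A * (ENNReal.ofReal M₀ * A * ENNReal.ofReal (Real.exp (-ω * s))
        + ENNReal.ofReal (M₁ / μ) * S.gnorm N s (μ * Real.exp (-ω * s)) (u s)) := by
        refine MeasureTheory.lintegral_mono_ae ((MeasureTheory.ae_restrict_iff'
          measurableSet_Ioc).2 (Eventually.of_forall fun s hs => ?_))
        refine (S.anorm_transf_le hM₀ hM₁ h3a hs.1 (by positivity) (u s)).trans ?_
        have h1 := hA s hs.1.le hs.2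
        have h2 := S.exp_mul_dnorm N hμ ω s (u s)
        calc _ ≤ ENNReal.ofReal (Real.exp (-ω * s)) * (A * (ENNReal.ofReal M₀ * A
              + ENNReal.ofReal M₁ * S.dnorm N s (μ * Real.exp (-ω * s)) (u s))) := by gcongr
          _ = A * (ENNReal.ofReal M₀ * A * ENNReal.ofReal (Real.exp (-ω * s))
              + ENNReal.ofReal M₁ * (ENNReal.ofReal (Real.exp (-ω * s))
                * S.dnorm N s (μ * Real.exp (-ω * s)) (u s))) := by ring
          _ = _ := by
              rw [h2, ← mul_assoc (ENNReal.ofReal M₁), ← ENNReal.ofReal_mul hM₁, mul_one_div]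
    _ = A * (ENNReal.ofReal M₀ * A * (∫⁻ s in Ioc 0 t, ENNReal.ofReal (Real.exp (-ω * s)))
        + ENNReal.ofReal (M₁ / μ) * S.gint N μ ω t u) := by
        have hm : Measurable fun s => ENNReal.ofReal (Real.exp (-ω * s)) := by fun_prop
        have hg := S.aemeasurable_gnorm hN hu μ ω t
        rw [MeasureTheory.lintegral_const_mul'' _ ((hm.const_mul _).aemeasurable.fun_add
            (hg.const_mul _)), MeasureTheory.lintegral_add_left (hm.const_mul _),
          MeasureTheory.lintegral_const_mul _ hm, MeasureTheory.lintegral_const_mul'' _ hg,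
          S.lintegral_gnorm hN hu]
    _ ≤ _ := by
        gcongr
        exact lintegral_exp_neg_le hω t

theorem lintegral_anorm_transf_sub_le {N : ℝ → Seminorm ℝ S.Y} (hN : S.AdmissibleNorms N)
    {Q : ℝ → S.Y → S.Y} {ω M₀ M₁ : ℝ} (hω : 0 < ω)
    (hM₀ : 0 ≤ M₀) (hM₁ : 0 ≤ M₁) (h3b : S.H3b N Q ω M₀ M₁) {μ t : ℝ} (hμ : 0 < μ)
    {u v : ℝ → S.Y} (hu : S.CL0 u) (hv : S.CL0 v) {A B : ENNReal}
    (hA : ∀ s, 0 ≤ s → s ≤ t → S.anorm N s (μ * Real.exp (-ω * s)) (u s) ≤ A)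
    (hA' : ∀ s, 0 ≤ s → s ≤ t → S.anorm N s (μ * Real.exp (-ω * s)) (v s) ≤ A)
    (hB : ∀ s, 0 ≤ s → s ≤ t → S.anorm N s (μ * Real.exp (-ω * s)) (v s - u s) ≤ B) :
    ∫⁻ s in Ioc 0 t, S.anorm N s (μ * Real.exp (-ω * s))
        (S.transf Q s (v s) - S.transf Q s (u s)) ≤
      4 * ENNReal.ofReal M₀ * A * B * ENNReal.ofReal (1 / ω)
        + (2 * A * (ENNReal.ofReal (M₁ / μ) * S.gint N μ ω t fun s => v s - u s)
          + B * ENNReal.ofReal (M₁ / μ) * (S.gint N μ ω t u + S.gint N μ ω t v)) := by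
  set ρ : ℝ → ℝ := fun s => μ * Real.exp (-ω * s) with hρ
  calc _ ≤ ∫⁻ s in Ioc 0 t, (4 * ENNReal.ofReal M₀ * A * B * ENNReal.ofReal (Real.exp (-ω * s))
        + (2 * A * (ENNReal.ofReal (M₁ / μ) * S.gnorm N s (ρ s) (v s - u s))
          + B * ENNReal.ofReal (M₁ / μ) *
            (S.gnorm N s (ρ s) (u s) + S.gnorm N s (ρ s) (v s)))) := by
        refine MeasureTheory.lintegral_mono_ae ((MeasureTheory.ae_restrict_iff'
          measurableSet_Ioc).2 (Eventually.of_forall fun s hs => ?_))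
        have hρs : 0 ≤ ρ s := by positivity
        refine (S.anorm_transf_sub_le hM₀ hM₁ h3b hs.1 hρs (u s) (v s)).trans ?_
        have h1 := hA s hs.1.le hs.2
        have h1' := hA' s hs.1.le hs.2
        have h1'' := hB s hs.1.le hs.2
        have h2 := fun y => S.exp_mul_dnorm N hμ ω s y
        have h3 : ∀ y, ENNReal.ofReal (M₁ / μ) * S.gnorm N s (ρ s) y = ENNReal.ofReal M₁ *
            (ENNReal.ofReal (Real.exp (-ω * s)) * S.dnorm N s (ρ s) y) := fun y => by
          rw [h2, ← mul_assoc (ENNReal.ofReal M₁), ← ENNReal.ofReal_mul hM₁, mul_one_div]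
        calc _ ≤ ENNReal.ofReal (Real.exp (-ω * s)) * ((A + A) *
              (ENNReal.ofReal M₀ * B + ENNReal.ofReal M₁ * S.dnorm N s (ρ s) (v s - u s))
              + B * ((ENNReal.ofReal M₀ * A + ENNReal.ofReal M₁ * S.dnorm N s (ρ s) (u s))
                + (ENNReal.ofReal M₀ * A + ENNReal.ofReal M₁ * S.dnorm N s (ρ s) (v s)))) := by
              gcongr
          _ = _ := by
              rw [mul_add (B * ENNReal.ofReal (M₁ / μ)), mul_assoc B, mul_assoc B, h3, h3, h3]
              ring
    _ = 4 * ENNReal.ofReal M₀ * A * B * (∫⁻ s in Ioc 0 t, ENNReal.ofReal (Real.exp (-ω * s)))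
        + (2 * A * (ENNReal.ofReal (M₁ / μ) * S.gint N μ ω t fun s => v s - u s)
          + B * ENNReal.ofReal (M₁ / μ) * (S.gint N μ ω t u + S.gint N μ ω t v)) := by
        have hm : Measurable fun s => ENNReal.ofReal (Real.exp (-ω * s)) := by fun_prop
        have hg := S.aemeasurable_gnorm hN hu μ ω t
        have hg' := S.aemeasurable_gnorm hN hv μ ω t
        have hg'' := S.aemeasurable_gnorm hN (CL0.sub S hv hu) μ ω t
        rw [MeasureTheory.lintegral_add_left (hm.const_mul _),
          MeasureTheory.lintegral_add_left' ((hg''.const_mul _).const_mul _),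
          MeasureTheory.lintegral_const_mul _ hm,
          MeasureTheory.lintegral_const_mul'' _ (hg''.const_mul _),
          MeasureTheory.lintegral_const_mul'' _ hg'',
          MeasureTheory.lintegral_const_mul'' _ (hg.fun_add hg'),
          MeasureTheory.lintegral_add_left' hg,
          S.lintegral_gnorm hN hu, S.lintegral_gnorm hN hv,
          S.lintegral_gnorm hN (CL0.sub S hv hu)]
    _ ≤ _ := by
        gcongr
        exact lintegral_exp_neg_le hω t

end Setting

end AnalyticEvolution

/-! ### Smallness conditions and controlled curves. -/

namespace AnalyticEvolution

namespace Setting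

variable {n : ℕ} {X : Type*} [NormedAddCommGroup X] [NormedSpace ℝ X] (S : Setting n X)

/-- The hypotheses on the evolution equation, with constants `δ` (the gap in the linear part) and
`η` (the smallness of the data). -/
structure Hypotheses (N : ℝ → Seminorm ℝ S.Y) (Q : ℝ → S.Y → S.Y)
    (C r ω M₀ M₁ M₀' M₁' ν₀ δ η : ℝ) : Prop where
  norms : S.AdmissibleNorms N
  acts : S.ActsOnCL0 Q
  hC : 0 ≤ C
  hr : 0 ≤ r
  hω : 0 < ω
  hM₀ : 0 ≤ M₀
  hM₁ : 0 ≤ M₁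
  hM₀' : 0 ≤ M₀'
  hM₁' : 0 ≤ M₁'
  h2 : S.H2 N C r
  h3a : S.H3a N Q ω M₀ M₁
  h3b : S.H3b N Q ω M₀' M₁'
  h4 : S.H4 N
  hrν : r * ν₀ < 1
  hδ : 0 < δ
  hgap : n * C * r ≤ (1 - δ) * ω * (1 - r * ν₀) ^ n
  hη : 0 < η
  growth : η * ((M₀ * ν₀ + 2 * M₁ / δ) / ω) ≤ 1 / 2
  contraction : η * ((4 * M₀' * ν₀ + 6 * M₁' / δ) / ω) ≤ 1 / 2

/-- A curve of class `C⁰_L` bounded by `A` in the analytic norms of radius `μ e^{-ωt}`. -/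
structure Controlled (N : ℝ → Seminorm ℝ S.Y) (μ ω δ A : ℝ) (u : ℝ → S.Y) : Prop where
  regular : S.CL0 u
  anorm_le : ∀ t, 0 ≤ t → S.anorm N t (μ * Real.exp (-ω * t)) (u t) ≤ ENNReal.ofReal A
  gint_le : ∀ t, 0 ≤ t → ENNReal.ofReal (δ * ω) * S.gint N μ ω t u ≤ ENNReal.ofReal (2 * A)

theorem le_ofReal_div_mul {c : ℝ} (hc : 0 < c) {g B : ENNReal}
    (h : ENNReal.ofReal c * g ≤ B) : g ≤ ENNReal.ofReal (1 / c) * B := by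
  calc g = ENNReal.ofReal (1 / c) * (ENNReal.ofReal c * g) := by
        rw [← mul_assoc, ← ENNReal.ofReal_mul (by positivity), one_div_mul_cancel hc.ne',
          ENNReal.ofReal_one, one_mul]
    _ ≤ _ := by gcongr

variable {S}

variable {N : ℝ → Seminorm ℝ S.Y} {Q : ℝ → S.Y → S.Y}
  {C r ω M₀ M₁ M₀' M₁' ν₀ δ η : ℝ}

theorem Controlled.gint_le' {μ A : ℝ} {u : ℝ → S.Y} (hδ : 0 < δ) (hω : 0 < ω)
    (hu : S.Controlled N μ ω δ A u) {t : ℝ} (ht : 0 ≤ t) :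
    S.gint N μ ω t u ≤ ENNReal.ofReal (2 * A / (δ * ω)) := by
  refine (le_ofReal_div_mul (by positivity) (hu.gint_le t ht)).trans (le_of_eq ?_)
  rw [← ENNReal.ofReal_mul (by positivity)]
  congr 1
  ring

variable [CompleteSpace X]

theorem Hypotheses.lintegral_transf_le
    (H : S.Hypotheses N Q C r ω M₀ M₁ M₀' M₁' ν₀ δ η) {μ A : ℝ} (hμ : 0 < μ) (hμν : μ ≤ ν₀)
    (hA : 0 ≤ A) (hAμ : A ≤ η * μ) {u : ℝ → S.Y} (hu : S.Controlled N μ ω δ A u) {t : ℝ}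
    (ht : 0 ≤ t) :
    ∫⁻ s in Ioc 0 t, S.anorm N s (μ * Real.exp (-ω * s)) (S.transf Q s (u s))
      ≤ ENNReal.ofReal (A / 2) := by
  have hω := H.hω
  have hδ := H.hδ
  have hM₀ := H.hM₀
  have hM₁ := H.hM₁
  have hη := H.hη
  refine (S.lintegral_anorm_transf_le H.norms hω hM₀ hM₁ H.h3a hμ hu.regular
    (fun s hs _ => hu.anorm_le s hs)).trans ?_
  refine (mul_le_mul_right (add_le_add le_rfl (mul_le_mul_right
    (hu.gint_le' hδ hω ht) _)) _).trans ?_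
  rw [← ENNReal.ofReal_mul hM₀, ← ENNReal.ofReal_mul (by positivity),
    ← ENNReal.ofReal_mul (by positivity), ← ENNReal.ofReal_add (by positivity) (by positivity),
    ← ENNReal.ofReal_mul hA]
  refine ENNReal.ofReal_le_ofReal ?_
  -- The smallness is used as `A ≤ ημ` in the first-order term, cancelling its `1/μ`, and as `A ≤
  -- ην₀` in the zeroth-order term.
  have h1 : M₀ * A * (1 / ω) + M₁ / μ * (2 * A / (δ * ω)) ≤ 1 / 2 := by
    calc M₀ * A * (1 / ω) + M₁ / μ * (2 * A / (δ * ω))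
        ≤ M₀ * (η * ν₀) * (1 / ω) + M₁ / μ * (2 * (η * μ) / (δ * ω)) := by
          gcongr
          exact hAμ.trans (by gcongr)
      _ = η * ((M₀ * ν₀ + 2 * M₁ / δ) / ω) := by field_simp
      _ ≤ 1 / 2 := H.growth
  calc _ ≤ A * (1 / 2) := by gcongr
    _ = A / 2 := by ring

theorem Hypotheses.lintegral_transf_sub_le
    (H : S.Hypotheses N Q C r ω M₀ M₁ M₀' M₁' ν₀ δ η) {μ A : ℝ} (hμ : 0 < μ) (hμν : μ ≤ ν₀)
    (hA : 0 ≤ A) (hAμ : A ≤ η * μ) {u v : ℝ → S.Y} (hu : S.Controlled N μ ω δ A u)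
    (hv : S.Controlled N μ ω δ A v) {B : ENNReal} {t : ℝ} (ht : 0 ≤ t)
    (hB : ∀ s, 0 ≤ s → s ≤ t → S.anorm N s (μ * Real.exp (-ω * s)) (v s - u s) ≤ B)
    (hB' : ENNReal.ofReal (δ * ω) * S.gint N μ ω t (fun s => v s - u s) ≤ B) :
    ∫⁻ s in Ioc 0 t, S.anorm N s (μ * Real.exp (-ω * s))
        (S.transf Q s (v s) - S.transf Q s (u s)) ≤ ENNReal.ofReal (1 / 2) * B := by
  have hω := H.hω
  have hδ := H.hδ
  have hM₀ := H.hM₀'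
  have hM₁ := H.hM₁'
  have hη := H.hη
  refine (S.lintegral_anorm_transf_sub_le H.norms hω hM₀ hM₁ H.h3b hμ hu.regular hv.regular
    (fun s hs _ => hu.anorm_le s hs) (fun s hs _ => hv.anorm_le s hs) hB).trans ?_
  have h1 := le_ofReal_div_mul (by positivity) hB'
  have h2 := hu.gint_le' hδ hω ht
  have h3 := hv.gint_le' hδ hω ht
  calc _ ≤ 4 * ENNReal.ofReal M₀' * ENNReal.ofReal A * B * ENNReal.ofReal (1 / ω)
        + (2 * ENNReal.ofReal A * (ENNReal.ofReal (M₁' / μ) * (ENNReal.ofReal (1 / (δ * ω)) * B))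
          + B * ENNReal.ofReal (M₁' / μ) * (ENNReal.ofReal (2 * A / (δ * ω))
            + ENNReal.ofReal (2 * A / (δ * ω)))) := by gcongr
    _ = ENNReal.ofReal (4 * M₀' * A * (1 / ω) + (2 * A * (M₁' / μ * (1 / (δ * ω)))
          + M₁' / μ * (2 * A / (δ * ω) + 2 * A / (δ * ω)))) * B := by
        rw [ENNReal.ofReal_add (by positivity) (by positivity),
          ENNReal.ofReal_add (by positivity) (by positivity),
          ENNReal.ofReal_mul (q := 1 / ω) (by positivity), ENNReal.ofReal_mul (q := A)
            (by positivity), ENNReal.ofReal_mul (q := M₀') (by positivity),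
          ENNReal.ofReal_mul (p := 2 * A) (by positivity), ENNReal.ofReal_mul (q := A)
            (by positivity), ENNReal.ofReal_mul (q := 1 / (δ * ω)) (by positivity),
          ENNReal.ofReal_mul (p := M₁' / μ) (by positivity),
          ENNReal.ofReal_add (p := 2 * A / (δ * ω)) (by positivity) (by positivity)]
        simp only [ENNReal.ofReal_ofNat]
        ring
    _ ≤ _ := by
        gcongr
        calc 4 * M₀' * A * (1 / ω) + (2 * A * (M₁' / μ * (1 / (δ * ω)))
              + M₁' / μ * (2 * A / (δ * ω) + 2 * A / (δ * ω)))
            ≤ 4 * M₀' * (η * ν₀) * (1 / ω) + (2 * (η * μ) * (M₁' / μ * (1 / (δ * ω)))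
              + M₁' / μ * (2 * (η * μ) / (δ * ω) + 2 * (η * μ) / (δ * ω))) := by
              have : A ≤ η * ν₀ := hAμ.trans (by gcongr)
              gcongr
          _ = η * ((4 * M₀' * ν₀ + 6 * M₁' / δ) / ω) := by field_simp; ring
          _ ≤ 1 / 2 := H.contraction

/-! ### The Picard iteration -/

/-- Conjugation by the group has removed the linear part of the equation, so a step of the iteration
is an integration in `Y`. -/
theorem exists_picard_step (hQ : S.ActsOnCL0 Q) (u₀ : S.Y) {u : ℝ → S.Y} (hu : S.CL0 u) :
    ∃ v : ℝ → S.Y, v 0 = u₀ ∧ ∀ t, 0 ≤ t →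
      HasDerivWithinAt (fun s => (v s : X)) (S.transf Q t (u t) : X) (Ici 0) t := by
  have hc := S.CL0_iff.1 (hQ u hu)
  choose! z hz using fun t ht => S.exists_integral _ hc (t := t) ht
  have hc0 := hc 0
  simp only [pw_zero, Module.End.one_apply] at hc0
  have hz0 : ∀ t, 0 ≤ t → (z t : X) = ∫ s in (0 : ℝ)..t, (S.transf Q s (u s) : X) := by
    intro t ht
    have := hz t ht 0
    simpa only [pw_zero, Module.End.one_apply] using this
  refine ⟨fun t => u₀ + z t, ?_, fun t ht => ?_⟩
  · have : z 0 = 0 := Subtype.ext (by rw [hz0 0 le_rfl, intervalIntegral.integral_same]; rfl)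
    simp only [this, add_zero]
  · refine ((hasDerivWithinAt_integral hc0 ht).const_add (u₀ : X)).congr (fun s hs => ?_) ?_
    · rw [Submodule.coe_add, hz0 s hs]
    · rw [Submodule.coe_add, hz0 t ht]

theorem Hypotheses.controlled_step (H : S.Hypotheses N Q C r ω M₀ M₁ M₀' M₁' ν₀ δ η) {μ A : ℝ}
    (hμ : 0 < μ) (hμν : μ ≤ ν₀) (hA : 0 ≤ A) (hAμ : A ≤ η * μ) {u v : ℝ → S.Y}
    (hu : S.Controlled N μ ω δ A u) (hv0 : S.anorm N 0 μ (v 0) ≤ ENNReal.ofReal (A / 2))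
    (hv : ∀ t, 0 ≤ t →
      HasDerivWithinAt (fun s => (v s : X)) (S.transf Q t (u t) : X) (Ici 0) t) :
    S.Controlled N μ ω δ A v := by
  have hf := H.acts u hu.regular
  have key : ∀ t, 0 ≤ t → S.anorm N t (μ * Real.exp (-ω * t)) (v t)
      + ENNReal.ofReal (δ * ω) * S.gint N μ ω t v ≤ ENNReal.ofReal A := by
    intro t ht
    refine (S.energy_le H.norms H.h4 H.hC H.hr H.h2 hf hv hμ hμν H.hω H.hδ.le H.hrν H.hgap
      ht).trans ?_
    refine (add_le_add hv0 (H.lintegral_transf_le hμ hμν hA hAμ hu ht)).trans (le_of_eq ?_)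
    rw [← ENNReal.ofReal_add (by positivity) (by positivity), add_halves]
  exact ⟨S.CL0_of_hasDeriv hf hv, fun t ht => le_self_add.trans (key t ht), fun t ht =>
    (le_add_self.trans (key t ht)).trans (ENNReal.ofReal_le_ofReal (by linarith))⟩

/-- The contraction estimate. It serves for successive iterates and, with `v = u` and `v' = u'`, for
two solutions. -/
theorem Hypotheses.energy_sub_le (H : S.Hypotheses N Q C r ω M₀ M₁ M₀' M₁' ν₀ δ η) {μ A : ℝ}
    (hμ : 0 < μ) (hμν : μ ≤ ν₀) (hA : 0 ≤ A) (hAμ : A ≤ η * μ) {u u' v v' : ℝ → S.Y}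
    (hu : S.Controlled N μ ω δ A u) (hu' : S.Controlled N μ ω δ A u')
    (hv : ∀ t, 0 ≤ t →
      HasDerivWithinAt (fun s => (v s : X)) (S.transf Q t (u t) : X) (Ici 0) t)
    (hv' : ∀ t, 0 ≤ t →
      HasDerivWithinAt (fun s => (v' s : X)) (S.transf Q t (u' t) : X) (Ici 0) t)
    {B : ENNReal} {t : ℝ} (ht : 0 ≤ t)
    (hB : ∀ s, 0 ≤ s → s ≤ t → S.anorm N s (μ * Real.exp (-ω * s)) (u' s - u s) ≤ B)
    (hB' : ENNReal.ofReal (δ * ω) * S.gint N μ ω t (fun s => u' s - u s) ≤ B) :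
    S.anorm N t (μ * Real.exp (-ω * t)) (v' t - v t)
      + ENNReal.ofReal (δ * ω) * S.gint N μ ω t (fun s => v' s - v s)
      ≤ S.anorm N 0 μ (v' 0 - v 0) + ENNReal.ofReal (1 / 2) * B := by
  have hf := CL0.sub S (H.acts u' hu'.regular) (H.acts u hu.regular)
  refine (S.energy_le H.norms H.h4 H.hC H.hr H.h2 hf (u := fun s => v' s - v s)
    (fun t ht => (hv' t ht).sub (hv t ht)) hμ hμν H.hω H.hδ.le H.hrν H.hgap ht).trans ?_
  exact add_le_add le_rfl (H.lintegral_transf_sub_le hμ hμν hA hAμ hu hu' ht hB hB')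

theorem controlled_zero {μ A : ℝ} : S.Controlled N μ ω δ A fun _ => 0 := by
  refine ⟨S.CL0_const 0, fun t _ => by rw [anorm_zero]; exact zero_le, fun t _ => ?_⟩
  have : S.gint N μ ω t (fun _ => 0) = 0 := by simp [gint, termInt, term]
  rw [this, mul_zero]
  exact zero_le

/-- The iterates, with the geometric decay of their differences. -/
theorem Hypotheses.exists_iterates (H : S.Hypotheses N Q C r ω M₀ M₁ M₀' M₁' ν₀ δ η) {μ A : ℝ}
    (hμ : 0 < μ) (hμν : μ ≤ ν₀) (hA : 0 ≤ A) (hAμ : A ≤ η * μ) {u₀ : S.Y}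
    (hu₀ : S.anorm N 0 μ u₀ ≤ ENNReal.ofReal (A / 2)) :
    ∃ u : ℕ → ℝ → S.Y, (∀ k, S.Controlled N μ ω δ A (u k)) ∧ (∀ k, u (k + 1) 0 = u₀) ∧
      (∀ k t, 0 ≤ t →
        HasDerivWithinAt (fun s => (u (k + 1) s : X)) (S.transf Q t (u k t) : X) (Ici 0) t) ∧
      ∀ k t, 0 ≤ t → S.anorm N t (μ * Real.exp (-ω * t)) (u (k + 1) t - u k t)
        ≤ ENNReal.ofReal (4 * A / 2 ^ k) := by
  choose! P hP0 hP using fun u hu => exists_picard_step H.acts u₀ (u := u) hu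
  let u : ℕ → ℝ → S.Y := fun k => Nat.rec (fun _ => 0) (fun _ v => P v) k
  have hctl : ∀ k, S.Controlled N μ ω δ A (u k) := by
    intro k
    induction k with
    | zero => exact controlled_zero
    | succ k ih =>
      exact H.controlled_step hμ hμν hA hAμ ih (by
        change S.anorm N 0 μ (P (u k) 0) ≤ _
        rw [hP0 _ ih.regular]; exact hu₀) (hP _ ih.regular)
  have hd : ∀ k t, 0 ≤ t →
      HasDerivWithinAt (fun s => (u (k + 1) s : X)) (S.transf Q t (u k t) : X) (Ici 0) t :=
    fun k => hP _ (hctl k).regular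
  have h0 : ∀ k, u (k + 1) 0 = u₀ := fun k => hP0 _ (hctl k).regular
  refine ⟨u, hctl, h0, hd, ?_⟩
  -- Both the norm and the integrated gain must be carried along, since the contraction uses both.
  -- The initial `4A` comes from the bounds `2A` on the gains of two controlled curves.
  have hdiff : ∀ k t, 0 ≤ t → S.anorm N t (μ * Real.exp (-ω * t)) (u (k + 1) t - u k t)
        ≤ ENNReal.ofReal (4 * A / 2 ^ k) ∧
      ENNReal.ofReal (δ * ω) * S.gint N μ ω t (fun s => u (k + 1) s - u k s)
        ≤ ENNReal.ofReal (4 * A / 2 ^ k) := by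
    intro k
    induction k with
    | zero =>
      intro t ht
      constructor
      · refine (S.anorm_sub_le N t (by positivity) _ _).trans ?_
        refine (add_le_add ((hctl 1).anorm_le t ht) ((hctl 0).anorm_le t ht)).trans ?_
        rw [← ENNReal.ofReal_add hA hA]
        refine ENNReal.ofReal_le_ofReal ?_
        rw [pow_zero]
        linarith
      · refine (mul_le_mul_right (S.gint_sub_le H.norms (hctl 1).regular hμ.le ω t) _).trans ?_
        rw [mul_add]
        refine (add_le_add ((hctl 1).gint_le t ht) ((hctl 0).gint_le t ht)).trans ?_
        rw [← ENNReal.ofReal_add (by positivity) (by positivity)]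
        refine ENNReal.ofReal_le_ofReal ?_
        rw [pow_zero]
        linarith
    | succ k ih =>
      intro t ht
      have h1 := H.energy_sub_le hμ hμν hA hAμ (hctl k) (hctl (k + 1)) (hd k) (hd (k + 1)) ht
        (fun s hs _ => (ih s hs).1) (ih t ht).2
      rw [h0 (k + 1), h0 k, sub_self, anorm_zero, zero_add, ← ENNReal.ofReal_mul (by norm_num)] at h1
      have h2 : 1 / 2 * (4 * A / 2 ^ k) = 4 * A / 2 ^ (k + 1) := by
        rw [pow_succ]; field_simp
      rw [h2] at h1
      exact ⟨le_self_add.trans h1, le_add_self.trans h1⟩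
  exact fun k t ht => (hdiff k t ht).1

omit [CompleteSpace X] in
-- A Cauchy estimate: one term of the series is at most the sum, and up to time `T` the radius is at
-- least `μ e^{-ωT}`.
theorem norm_conj_le_of_anorm_le {μ : ℝ} (hμ : 0 < μ) (hω : 0 ≤ ω) {A : ℝ} (hA : 0 ≤ A)
    {s T : ℝ} (hsT : s ≤ T) {y : S.Y}
    (h : S.anorm N s (μ * Real.exp (-ω * s)) y ≤ ENNReal.ofReal A) (α : Fin n → ℕ) :
    N s (S.conj s α y) ≤ fact α / (μ * Real.exp (-ω * T)) ^ len α * A := by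
  have h1 : S.term N s (μ * Real.exp (-ω * s)) α y ≤ ENNReal.ofReal A :=
    (ENNReal.le_tsum α).trans h
  have h2 := (ENNReal.ofReal_le_ofReal_iff hA).1 h1
  have hf : (0 : ℝ) < fact α := by exact_mod_cast fact_pos α
  have h3 : (μ * Real.exp (-ω * T)) ^ len α / fact α * N s (S.conj s α y) ≤ A := by
    refine le_trans ?_ h2
    have : -ω * T ≤ -ω * s := by nlinarith
    gcongr
  rw [div_mul_eq_mul_div, le_div_iff₀ (by positivity)]
  rw [div_mul_eq_mul_div, div_le_iff₀ hf] at h3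
  linarith

theorem tendsto_firstOrder (hN : S.AdmissibleNorms N) (h4 : S.H4 N) {s : ℝ} (hs : 0 < s)
    {v : ℕ → S.Y} {v₀ : S.Y}
    (hv : ∀ α, Tendsto (fun k => (S.pw α (v k) : X)) atTop (𝓝 (S.pw α v₀ : X)))
    (K₀ K₁ : ℝ) (γ : Fin n → ℕ) :
    Tendsto (fun k => S.firstOrder N K₀ K₁ s γ (S.e (-s) (v k))) atTop
      (𝓝 (S.firstOrder N K₀ K₁ s γ (S.e (-s) v₀))) := by
  have h1 := S.e_tendsto (tendsto_const_nhds (x := -s)) hv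
  have h2 : ∀ β, Tendsto (fun k => N s (S.e s (S.pw β (S.e (-s) (v k))))) atTop
      (𝓝 (N s (S.e s (S.pw β (S.e (-s) v₀))))) := fun β =>
    S.norm_tendsto hN h4 hs (S.e_tendsto (tendsto_const_nhds (x := s)) fun α => by
      simp only [← Module.End.mul_apply (S.pw α), ← pw_add]
      exact h1 _)
  exact ((h2 γ).const_mul _).add (tendsto_finsetSum _ fun i _ => (h2 _).const_mul _)

theorem tendsto_norm_conj (hN : S.AdmissibleNorms N) (h4 : S.H4 N) {s : ℝ} (hs : 0 < s)
    {v : ℕ → S.Y} {v₀ : S.Y}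
    (hv : ∀ α, Tendsto (fun k => (S.pw α (v k) : X)) atTop (𝓝 (S.pw α v₀ : X)))
    (γ : Fin n → ℕ) :
    Tendsto (fun k => N s (S.conj s γ (v k))) atTop (𝓝 (N s (S.conj s γ v₀))) := by
  have := tendsto_firstOrder hN h4 hs hv 1 0 γ
  simpa [firstOrder, conj_apply] using this

/-- The nonlinearity is sequentially continuous from the Fréchet space `Y` to `X`, for `t > 0`. -/
theorem Hypotheses.tendsto_transf (H : S.Hypotheses N Q C r ω M₀ M₁ M₀' M₁' ν₀ δ η)
    {s : ℝ} (hs : 0 < s) {v : ℕ → S.Y} {v₀ : S.Y}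
    (hv : ∀ α, Tendsto (fun k => (S.pw α (v k) : X)) atTop (𝓝 (S.pw α v₀ : X))) :
    Tendsto (fun k => (S.transf Q s (v k) : X)) atTop (𝓝 (S.transf Q s v₀ : X)) := by
  obtain ⟨c, hc0, hc⟩ := S.norm_le_uniform H.norms H.h4 hs.le
  have hd : ∀ α, Tendsto (fun k => (S.pw α (v₀ - v k) : X)) atTop (𝓝 (S.pw α (0 : S.Y) : X)) := by
    intro α
    have := (hv α).const_sub (S.pw α v₀ : X)
    simpa using this
  have hlim : Tendsto (fun k => c * (Real.exp (-ω * s) *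
      (∑ γ ∈ Finset.Icc 0 (0 : Fin n → ℕ), binom 0 γ *
          ((N s (S.conj s (0 - γ) (v k)) + N s (S.conj s (0 - γ) v₀))
          * S.firstOrder N M₀' M₁' s γ (S.e (-s) (v₀ - v k)))
        + ∑ γ ∈ Finset.Icc 0 (0 : Fin n → ℕ), binom 0 γ * (N s (S.conj s (0 - γ) (v₀ - v k)) *
          (S.firstOrder N M₀' M₁' s γ (S.e (-s) (v k))
            + S.firstOrder N M₀' M₁' s γ (S.e (-s) v₀)))))) atTop
      (𝓝 (c * (Real.exp (-ω * s) * (∑ γ ∈ Finset.Icc 0 (0 : Fin n → ℕ), binom 0 γ *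
          ((N s (S.conj s (0 - γ) v₀) + N s (S.conj s (0 - γ) v₀))
          * S.firstOrder N M₀' M₁' s γ (S.e (-s) (0 : S.Y)))
        + ∑ γ ∈ Finset.Icc 0 (0 : Fin n → ℕ), binom 0 γ * (N s (S.conj s (0 - γ) (0 : S.Y)) *
          (S.firstOrder N M₀' M₁' s γ (S.e (-s) v₀)
            + S.firstOrder N M₀' M₁' s γ (S.e (-s) v₀))))))) := by
    have t1 := fun γ => tendsto_norm_conj H.norms H.h4 hs hv γ
    have t2 := fun γ => tendsto_norm_conj H.norms H.h4 hs hd γ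
    have t3 := fun γ => tendsto_firstOrder H.norms H.h4 hs hv M₀' M₁' γ
    have t4 := fun γ => tendsto_firstOrder H.norms H.h4 hs hd M₀' M₁' γ
    refine ((Tendsto.add (tendsto_finsetSum _ fun γ _ => ?_)
      (tendsto_finsetSum _ fun γ _ => ?_)).const_mul _).const_mul _
    · exact (((t1 _).add_const _).mul (t4 γ)).const_mul _
    · exact ((t2 _).mul ((t3 γ).add_const _)).const_mul _
  have hz : ∀ γ, S.firstOrder N M₀' M₁' s γ (0 : S.Y) = 0 := by
    intro γ
    simp [firstOrder]
  simp only [map_zero, hz, mul_zero, zero_mul, Finset.sum_const_zero, add_zero] at hlim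
  rw [tendsto_iff_norm_sub_tendsto_zero]
  refine squeeze_zero (fun _ => norm_nonneg _) (fun k => ?_) hlim
  rw [norm_sub_rev]
  refine (hc s hs.le le_rfl (S.transf Q s v₀ - S.transf Q s (v k))).trans ?_
  gcongr
  have := S.norm_transf_sub_le H.hM₀' H.hM₁' H.h3b hs 0 (v k) v₀
  rwa [conj_zero_right] at this

end Setting

end AnalyticEvolution

namespace AnalyticEvolution

namespace Setting

variable {n : ℕ} {X : Type*} [NormedAddCommGroup X] [NormedSpace ℝ X] {S : Setting n X}
  {N : ℝ → Seminorm ℝ S.Y} {Q : ℝ → S.Y → S.Y}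
  {C r ω M₀ M₁ M₀' M₁' ν₀ δ η : ℝ}

/-! ### Existence -/

/-- The term `α = 0` is `‖y‖_{X_t}`, also at `ν = 0` because `0 ^ 0 = 1`. Definiteness comes from
domination of the norm of `X`. -/
theorem eq_zero_of_anorm_le_zero (hN : S.AdmissibleNorms N) {t ν : ℝ} (ht : 0 ≤ t) {y : S.Y}
    (h : S.anorm N t ν y ≤ 0) : y = 0 := by
  have h1 : S.term N t ν 0 y ≤ 0 := (ENNReal.le_tsum 0).trans h
  have h2 : N t y ≤ 0 := by
    rw [term, conj_zero_right] at h1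
    have := ENNReal.ofReal_eq_zero.1 (le_antisymm h1 zero_le)
    simpa [len, fact] using this
  obtain ⟨c, hc⟩ := hN.stronger t ht
  have h3 : N t y = 0 := le_antisymm h2 (apply_nonneg _ _)
  have h4 := hc y
  rw [h3, mul_zero] at h4
  exact Subtype.ext (norm_le_zero_iff.1 h4)

variable [CompleteSpace X]

/-- Iterates with geometrically decaying differences converge in `C⁰_L`. -/
theorem exists_limit (hN : S.AdmissibleNorms N) (h4 : S.H4 N) {μ A : ℝ} (hμ : 0 < μ)
    (hω : 0 ≤ ω) (hA : 0 ≤ A) {u : ℕ → ℝ → S.Y} (hu : ∀ k, S.CL0 (u k))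
    (hd : ∀ k t, 0 ≤ t → S.anorm N t (μ * Real.exp (-ω * t)) (u (k + 1) t - u k t)
        ≤ ENNReal.ofReal (4 * A / 2 ^ k)) :
    ∃ v : ℝ → S.Y, S.CL0 v ∧ ∀ t, 0 ≤ t → ∀ α,
      Tendsto (fun k => (S.pw α (u k t) : X)) atTop (𝓝 (S.pw α (v t) : X)) := by
  -- For each `α` the rate is uniform on `[0, T]`: it gives the pointwise limits and, by locally
  -- uniform convergence, their continuity in time.
  have hrate : ∀ T, 0 ≤ T → ∀ α, ∃ K : ℝ, ∀ t, 0 ≤ t → t ≤ T → ∀ k,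
      dist (S.conj t α (u k t) : X) (S.conj t α (u (k + 1) t)) ≤ K / 2 / 2 ^ k := by
    intro T hT α
    obtain ⟨c, hc0, hc⟩ := S.norm_le_uniform hN h4 hT
    refine ⟨2 * (c * (fact α / (μ * Real.exp (-ω * T)) ^ len α * (4 * A))),
      fun t ht htT k => ?_⟩
    rw [dist_comm, dist_eq_norm, ← Submodule.coe_sub, ← map_sub]
    refine (hc t ht htT _).trans ?_
    have := norm_conj_le_of_anorm_le hμ hω (by positivity) htT (hd k t ht) α
    calc _ ≤ c * (fact α / (μ * Real.exp (-ω * T)) ^ len α * (4 * A / 2 ^ k)) := by gcongr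
      _ = _ := by ring
  have hlim : ∀ t, 0 ≤ t → ∃ y : S.Y, ∀ α,
      Tendsto (fun k => (S.pw α (S.e (-t) (u k t)) : X)) atTop (𝓝 (S.pw α y : X)) := by
    intro t ht
    have hex : ∀ α, ∃ z : X, Tendsto (fun k => (S.pw α (S.e (-t) (u k t)) : X)) atTop (𝓝 z) := by
      intro α
      obtain ⟨K, hK⟩ := hrate t ht α
      obtain ⟨z, hz⟩ := cauchySeq_tendsto_of_complete
        (cauchySeq_of_le_geometric_two (hK t ht le_rfl))
      refine ⟨S.G.op (-t) z, ?_⟩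
      refine (((S.G.op (-t)).continuous.tendsto z).comp hz).congr fun k => ?_
      simp only [Function.comp, conj_apply, ← e_coe, e_neg_e]
    choose z hz using hex
    obtain ⟨y, hy⟩ := S.complete _ z hz
    exact ⟨y, fun α => by
      have h1 : (S.pw α y : X) = z α := hy α
      rw [h1]; exact hz α⟩
  choose! y hy using hlim
  have hconj : ∀ t, 0 ≤ t → ∀ α, Tendsto (fun k => (S.conj t α (u k t) : X)) atTop
      (𝓝 (S.conj t α (S.e t (y t)) : X)) := by
    intro t ht α
    have := ((S.G.op t).continuous.tendsto _).comp (hy t ht α)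
    rw [conj_apply, e_neg_e]
    exact this
  refine ⟨fun t => S.e t (y t), fun α t ht => ?_, fun t ht α => ?_⟩
  · obtain ⟨K, hK⟩ := hrate (t + 1) (by linarith [mem_Ici.1 ht]) α
    have hunif : TendstoUniformlyOn (fun k s => (S.conj s α (u k s) : X))
        (fun s => (S.conj s α (S.e s (y s)) : X)) atTop (Icc 0 (t + 1)) := by
      rw [Metric.tendstoUniformlyOn_iff]
      intro ε hε
      have h0 : Tendsto (fun k : ℕ => K / 2 ^ k) atTop (𝓝 0) := by
        have := (tendsto_pow_atTop_nhds_zero_of_lt_one (r := (1 / 2 : ℝ)) (by norm_num)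
          (by norm_num)).const_mul K
        rw [mul_zero] at this
        refine this.congr fun k => ?_
        rw [one_div, inv_pow, div_eq_mul_inv]
      filter_upwards [h0.eventually_lt_const hε] with k hk s hs
      rw [dist_comm]
      exact (dist_le_of_le_geometric_two_of_tendsto (hK s hs.1 hs.2)
        (hconj s hs.1 α) k).trans_lt hk
    have hc := hunif.continuousOn (Frequently.of_forall fun k =>
      (hu k α).mono Icc_subset_Ici_self)
    refine (hc t ⟨ht, by linarith⟩).mono_of_mem_nhdsWithin ?_
    rw [← Ici_inter_Iic]
    exact inter_mem_nhdsWithin _ (Iic_mem_nhds (by linarith))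
  · have := S.e_tendsto (tendsto_const_nhds (x := t)) (hy t ht) α
    simpa only [e_e_neg] using this

omit [CompleteSpace X] in
theorem transf_zero_of_pos (hN : S.AdmissibleNorms N) (h3a : S.H3a N Q ω M₀ M₁) {t : ℝ}
    (ht : 0 < t) : S.transf Q t 0 = 0 := by
  have h1 := h3a t ht 0 0
  have h2 : N t (S.transf Q t 0) ≤ 0 := by
    have h3 : S.e t (S.pw 0 (Q t 0)) = S.transf Q t 0 := by
      rw [transf, map_zero, pw_zero, Module.End.one_apply]
    rw [h3] at h1
    simpa using h1
  obtain ⟨c, hc⟩ := hN.stronger t ht.le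
  have h3 : N t (S.transf Q t 0) = 0 := le_antisymm h2 (apply_nonneg _ _)
  have h4 := hc (S.transf Q t 0)
  rw [h3, mul_zero] at h4
  exact Subtype.ext (norm_le_zero_iff.1 h4)

/-- This settles the radius `ν = 0`. (H3a′) gives `Q_t(0) = 0` only for `t > 0`; the value at `t =
0` follows by continuity in time. -/
theorem isStrongSolution_zero (hN : S.AdmissibleNorms N) (hQ : S.ActsOnCL0 Q)
    (h3a : S.H3a N Q ω M₀ M₁) : S.IsStrongSolution Q 0 fun _ => 0 := by
  refine ⟨S.CL0_const 0, rfl, fun t ht => ?_⟩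
  have hz : (S.transf Q t 0 : X) = 0 := by
    rcases ht.eq_or_lt with rfl | ht
    · have hc := S.CL0_iff.1 (hQ _ (S.CL0_const 0)) 0
      simp only [pw_zero, Module.End.one_apply] at hc
      have h1 : Tendsto (fun s => (S.transf Q s 0 : X)) (𝓝[>] 0) (𝓝 (S.transf Q 0 0 : X)) :=
        (hc 0 self_mem_Ici).mono_left (nhdsWithin_mono _ Ioi_subset_Ici_self)
      refine tendsto_nhds_unique h1 (tendsto_const_nhds.congr' ?_)
      filter_upwards [self_mem_nhdsWithin] with s hs
      rw [transf_zero_of_pos hN h3a hs]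
      rfl
    · rw [transf_zero_of_pos hN h3a ht]
      rfl
  rw [hz]
  exact hasDerivWithinAt_const _ _ _

/-- A uniform bound for the nonlinearity in `X` along curves bounded in the analytic norms. -/
theorem Hypotheses.exists_bound_transf (H : S.Hypotheses N Q C r ω M₀ M₁ M₀' M₁' ν₀ δ η)
    {μ A : ℝ} (hμ : 0 < μ) (hA : 0 ≤ A) {T : ℝ} (hT : 0 ≤ T) :
    ∃ K : ℝ, ∀ s, 0 < s → s ≤ T → ∀ y : S.Y,
      S.anorm N s (μ * Real.exp (-ω * s)) y ≤ ENNReal.ofReal A →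
      ‖(S.transf Q s y : X)‖ ≤ K := by
  obtain ⟨c, hc0, hc⟩ := S.norm_le_uniform H.norms H.h4 hT
  have hM₀ := H.hM₀
  have hM₁ := H.hM₁
  set b : (Fin n → ℕ) → ℝ := fun α => fact α / (μ * Real.exp (-ω * T)) ^ len α * A with hb
  have hb0 : ∀ α, 0 ≤ b α := fun α => by positivity
  refine ⟨c * (1 * ∑ γ ∈ Finset.Icc 0 (0 : Fin n → ℕ), binom 0 γ *
    (b (0 - γ) * (M₀ * b γ + ∑ i, M₁ * b (γ + unit i)))), fun s hs hsT y hy => ?_⟩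
  refine (hc s hs.le hsT _).trans ?_
  have h1 := H.h3a s hs 0 (S.e (-s) y)
  rw [← conj_transf, conj_zero_right] at h1
  have h2 : ∀ α, N s (S.e s (S.pw α (S.e (-s) y))) ≤ b α := fun α =>
    norm_conj_le_of_anorm_le hμ H.hω.le hA hsT hy α
  gcongr
  refine h1.trans ?_
  have h3 : Real.exp (-ω * s) ≤ 1 := Real.exp_le_one_iff.2 (by nlinarith [H.hω])
  have h4 := S.firstOrder_nonneg N hM₀ hM₁ s
  unfold firstOrder
  gcongr
  · exact h2 _
  · exact h2 _
  · exact h2 _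

/-- Dominated convergence passes to the limit in the integral equation of the iterates. The analytic
bound survives because every finite partial sum of the norm converges. -/
theorem Hypotheses.exists_solution (H : S.Hypotheses N Q C r ω M₀ M₁ M₀' M₁' ν₀ δ η) {μ A : ℝ}
    (hμ : 0 < μ) (hμν : μ ≤ ν₀) (hA : 0 ≤ A) (hAμ : A ≤ η * μ) {u₀ : S.Y}
    (hu₀ : S.anorm N 0 μ u₀ ≤ ENNReal.ofReal (A / 2)) :
    ∃ u : ℝ → S.Y, S.IsStrongSolution Q u₀ u ∧
      ∀ t, 0 ≤ t → S.anorm N t (μ * Real.exp (-ω * t)) (u t) ≤ ENNReal.ofReal A := by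
  obtain ⟨u, hctl, h0, hderiv, hdiff⟩ := H.exists_iterates hμ hμν hA hAμ hu₀
  obtain ⟨v, hv, hlim⟩ := exists_limit H.norms H.h4 hμ H.hω.le hA (fun k => (hctl k).regular) hdiff
  have hlim0 : ∀ t, 0 ≤ t → Tendsto (fun k => (u k t : X)) atTop (𝓝 (v t : X)) := by
    intro t ht
    have := hlim t ht 0
    simpa only [pw_zero, Module.End.one_apply] using this
  have hv0 : v 0 = u₀ := by
    refine Subtype.ext (tendsto_nhds_unique ((hlim0 0 le_rfl).comp (tendsto_add_atTop_nat 1)) ?_)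
    refine tendsto_const_nhds.congr fun k => ?_
    simp only [Function.comp, h0]
  have hfc : ∀ w : ℝ → S.Y, S.CL0 w → ContinuousOn (fun s => (S.transf Q s (w s) : X)) (Ici 0) := by
    intro w hw
    have := S.CL0_iff.1 (H.acts w hw) 0
    simpa only [pw_zero, Module.End.one_apply] using this
  have hint : ∀ t, 0 ≤ t → (v t : X) = u₀ + ∫ s in (0 : ℝ)..t, (S.transf Q s (v s) : X) := by
    intro t ht
    have h1 : Tendsto (fun k => (u₀ : X) + ∫ s in (0 : ℝ)..t, (S.transf Q s (u k s) : X)) atTop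
        (𝓝 (v t : X)) := by
      refine ((hlim0 t ht).comp (tendsto_add_atTop_nat 1)).congr fun k => ?_
      have := eq_add_integral (hderiv k) (hfc _ (hctl k).regular) ht
      rw [h0] at this
      exact this
    refine tendsto_nhds_unique h1 (Tendsto.const_add _ ?_)
    obtain ⟨K, hK⟩ := H.exists_bound_transf hμ hA ht
    refine intervalIntegral.tendsto_integral_filter_of_dominated_convergence (fun _ => K)
      (Eventually.of_forall fun k => ?_) (Eventually.of_forall fun k => ?_)
      intervalIntegrable_const ?_
    · rw [uIoc_of_le ht]
      exact ((hfc _ (hctl k).regular).mono fun s hs => hs.1.le).aestronglyMeasurable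
        measurableSet_Ioc
    · refine Eventually.of_forall fun s hs => ?_
      rw [uIoc_of_le ht] at hs
      exact hK s hs.1 hs.2 _ ((hctl k).anorm_le s hs.1.le)
    · refine Eventually.of_forall fun s hs => ?_
      rw [uIoc_of_le ht] at hs
      exact H.tendsto_transf hs.1 (hlim s hs.1.le)
  refine ⟨v, ⟨hv, hv0, fun t ht => ?_⟩, fun t ht => ?_⟩
  · exact ((hasDerivWithinAt_integral (hfc v hv) ht).const_add (u₀ : X)).congr
      (fun s hs => hint s hs) (hint t ht)
  -- Continuity of the norm on `Y` is known only for positive times; at `t = 0` the bound is the one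
  -- on the datum.
  · rcases ht.eq_or_lt with rfl | ht
    · rw [hv0, mul_zero, Real.exp_zero, mul_one]
      exact hu₀.trans (ENNReal.ofReal_le_ofReal (by linarith))
    · rw [anorm_eq, ENNReal.tsum_eq_iSup_sum]
      refine iSup_le fun s => ?_
      refine le_of_tendsto' (f := fun k => ∑ α ∈ s, S.term N t (μ * Real.exp (-ω * t)) α (u k t))
        (x := atTop) (tendsto_finsetSum _ fun α _ => ?_) fun k =>
          (ENNReal.sum_le_tsum s).trans ((hctl k).anorm_le t ht.le)
      exact ENNReal.tendsto_ofReal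
        ((tendsto_norm_conj H.norms H.h4 ht (hlim t ht.le) α).const_mul _)

/-! ### Stability -/

omit [CompleteSpace X] in
theorem anorm_mono {t ν ν' : ℝ} (hν : 0 ≤ ν) (h : ν ≤ ν') (y : S.Y) :
    S.anorm N t ν y ≤ S.anorm N t ν' y := by
  refine ENNReal.tsum_le_tsum fun α => ENNReal.ofReal_le_ofReal ?_
  gcongr

omit [CompleteSpace X] in
-- Shrinking the radius buys a derivative: `m θ^m ≤ 1 + θ + ⋯ + θ^{m-1} ≤ 1/(1-θ)`.
theorem gnorm_le_of_lt_one {t ν θ : ℝ} (hν : 0 ≤ ν) (hθ : 0 ≤ θ) (hθ1 : θ < 1) (y : S.Y) :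
    S.gnorm N t (θ * ν) y ≤ ENNReal.ofReal (1 / (1 - θ)) * S.anorm N t ν y := by
  rw [gnorm, anorm_eq, ← ENNReal.tsum_mul_left]
  refine ENNReal.tsum_le_tsum fun α => ?_
  have h1 : 0 < 1 - θ := by linarith
  rw [term, term, ← ENNReal.ofReal_natCast, ← ENNReal.ofReal_mul (Nat.cast_nonneg _),
    ← ENNReal.ofReal_mul (by positivity)]
  refine ENNReal.ofReal_le_ofReal ?_
  have hgeo : (len α : ℝ) * θ ^ len α ≤ 1 / (1 - θ) := by
    have h2 : ∀ m : ℕ, (m : ℝ) * θ ^ m ≤ ∑ i ∈ Finset.range m, θ ^ i := by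
      intro m
      calc (m : ℝ) * θ ^ m = ∑ i ∈ Finset.range m, θ ^ m := by simp
        _ ≤ _ := Finset.sum_le_sum fun i hi =>
            pow_le_pow_of_le_one hθ hθ1.le (Finset.mem_range.1 hi).le
    refine (h2 _).trans ?_
    have h3 := (summable_geometric_of_lt_one hθ hθ1).sum_le_tsum (Finset.range (len α))
      fun i _ => by positivity
    rwa [tsum_geometric_of_lt_one hθ hθ1, ← one_div] at h3
  calc (len α : ℝ) * ((θ * ν) ^ len α / fact α * N t (S.conj t α y))
      = (len α * θ ^ len α) * (ν ^ len α / fact α * N t (S.conj t α y)) := by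
        rw [mul_pow]; ring
    _ ≤ _ := by gcongr

/-- Strong solutions that are bounded at the larger radius `ν` are controlled at the radius
`θ ν`. -/
theorem Hypotheses.controlled_of_isStrongSolution
    (H : S.Hypotheses N Q C r ω M₀ M₁ M₀' M₁' ν₀ δ η) {ν θ A : ℝ}
    (hν : 0 < ν) (hνν : ν ≤ ν₀) (hθ : 0 < θ) (hθ1 : θ < 1) (hA : 0 ≤ A) (hAμ : A ≤ η * (θ * ν))
    {u₀ : S.Y} {u : ℝ → S.Y} (hu : S.IsStrongSolution Q u₀ u)
    (hu₀ : S.anorm N 0 ν u₀ ≤ ENNReal.ofReal (A / 2))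
    (hb : ∀ t, 0 ≤ t → S.anorm N t (ν * Real.exp (-ω * t)) (u t) ≤ ENNReal.ofReal A) :
    S.Controlled N (θ * ν) ω δ A u := by
  have hω := H.hω
  have hδ := H.hδ
  have hη := H.hη
  have hM₀ := H.hM₀
  have hM₁ := H.hM₁
  have hμ : 0 < θ * ν := by positivity
  have hθν : θ * ν ≤ ν := mul_le_of_le_one_left hν.le hθ1.le
  have hμν : θ * ν ≤ ν₀ := hθν.trans hνν
  have hν₀ : 0 < ν₀ := hν.trans_le hνν
  have hb' : ∀ t, 0 ≤ t → S.anorm N t (θ * ν * Real.exp (-ω * t)) (u t) ≤ ENNReal.ofReal A :=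
    fun t ht => (anorm_mono (by positivity) (by gcongr) _).trans (hb t ht)
  refine ⟨hu.regular, hb', fun t ht => ?_⟩
  -- Finiteness is what allows absorbing the first-order term below, and the reason for working at
  -- `θ < 1`. The bound found here degenerates as `θ → 1`; the final one does not.
  have hfin : S.gint N (θ * ν) ω t u ≠ ⊤ := by
    rw [← S.lintegral_gnorm H.norms hu.regular]
    refine ne_top_of_le_ne_top ?_ (MeasureTheory.lintegral_mono_ae
      (g := fun _ => ENNReal.ofReal (1 / (1 - θ)) * ENNReal.ofReal A)
      ((MeasureTheory.ae_restrict_iff' measurableSet_Ioc).2 (Eventually.of_forall fun s hs => ?_)))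
    · rw [MeasureTheory.lintegral_const]
      refine ENNReal.mul_ne_top (by finiteness) ?_
      simp
    · rw [mul_assoc]
      refine (gnorm_le_of_lt_one (by positivity) hθ.le hθ1 (u s)).trans ?_
      gcongr
      exact hb s hs.1.le
  have h1 := S.energy_le H.norms H.h4 H.hC H.hr H.h2 (H.acts u hu.regular) hu.eqn hμ hμν hω hδ.le
    H.hrν H.hgap ht
  have h2 := S.lintegral_anorm_transf_le H.norms hω hM₀ hM₁ H.h3a hμ hu.regular (t := t)
    (fun s hs _ => hb' s hs)
  have h3 : S.anorm N 0 (θ * ν) (u 0) ≤ ENNReal.ofReal (A / 2) := by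
    rw [hu.initial]
    exact (anorm_mono hμ.le hθν _).trans hu₀
  have h5 := (le_add_self.trans h1).trans (add_le_add h3 h2)
  obtain ⟨g, hg⟩ : ∃ g : NNReal, S.gint N (θ * ν) ω t u = ENNReal.ofReal (g : ℝ) :=
    ⟨(S.gint N (θ * ν) ω t u).toNNReal, by
      rw [ENNReal.ofReal_coe_nnreal, ENNReal.coe_toNNReal hfin]⟩
  have hg0 : (0 : ℝ) ≤ g := g.2
  rw [hg] at h5 ⊢
  rw [← ENNReal.ofReal_mul (by positivity), ← ENNReal.ofReal_mul hM₀,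
    ← ENNReal.ofReal_mul (by positivity), ← ENNReal.ofReal_mul (by positivity),
    ← ENNReal.ofReal_add (by positivity) (by positivity), ← ENNReal.ofReal_mul hA,
    ← ENNReal.ofReal_add (by positivity) (by positivity),
    ENNReal.ofReal_le_ofReal_iff (by positivity)] at h5
  rw [← ENNReal.ofReal_mul (by positivity)]
  refine ENNReal.ofReal_le_ofReal ?_
  have hgr := H.growth
  have hsplit : η * ((M₀ * ν₀ + 2 * M₁ / δ) / ω) = M₀ * (η * ν₀) * (1 / ω)
      + 2 * (η * M₁ / (δ * ω)) := by field_simp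
  have hp1 : 0 ≤ M₀ * (η * ν₀) * (1 / ω) := by positivity
  have hp2 : 0 ≤ η * M₁ / (δ * ω) := by positivity
  have h6 : M₀ * A * (1 / ω) ≤ 1 / 2 := by
    have : M₀ * A * (1 / ω) ≤ M₀ * (η * ν₀) * (1 / ω) := by
      gcongr
      exact hAμ.trans (by gcongr)
    linarith
  have h7 : A * (M₁ / (θ * ν)) ≤ 1 / 4 * (δ * ω) := by
    have e1 : A * (M₁ / (θ * ν)) ≤ η * (θ * ν) * (M₁ / (θ * ν)) := by gcongr
    have e2 : η * (θ * ν) * (M₁ / (θ * ν)) = η * M₁ / (δ * ω) * (δ * ω) := by field_simp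
    have e3 : η * M₁ / (δ * ω) * (δ * ω) ≤ 1 / 4 * (δ * ω) := by
      exact mul_le_mul_of_nonneg_right (by linarith) (by have := H.hδ; have := H.hω; positivity)
    linarith
  have h8 : A * (M₀ * A * (1 / ω)) ≤ A * (1 / 2) := by gcongr
  have h9 : A * (M₁ / (θ * ν)) * g ≤ 1 / 4 * (δ * ω) * g := by gcongr
  have h10 : 0 ≤ δ * ω * g := by positivity
  -- The estimates combine to `δωg ≤ A/2 + A/2 + δωg/4`, so `δωg ≤ 4A/3`. The constant `2A` in
  -- `Controlled` leaves room for this.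
  nlinarith

/-- Solutions are fixed points of the Picard map. The supremum `B` over time of norm plus integrated
gain of the difference satisfies `B ≤ D + B/2`, and being finite it is at most `2D`. -/
theorem Hypotheses.anorm_sub_le_of_lt_one
    (H : S.Hypotheses N Q C r ω M₀ M₁ M₀' M₁' ν₀ δ η) {ν θ A : ℝ}
    (hν : 0 < ν) (hνν : ν ≤ ν₀) (hθ : 0 < θ) (hθ1 : θ < 1) (hA : 0 ≤ A) (hAμ : A ≤ η * (θ * ν))
    {u₀ w₀ : S.Y} {u w : ℝ → S.Y} (hu : S.IsStrongSolution Q u₀ u)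
    (hw : S.IsStrongSolution Q w₀ w)
    (hu₀ : S.anorm N 0 ν u₀ ≤ ENNReal.ofReal (A / 2))
    (hw₀ : S.anorm N 0 ν w₀ ≤ ENNReal.ofReal (A / 2))
    (hub : ∀ t, 0 ≤ t → S.anorm N t (ν * Real.exp (-ω * t)) (u t) ≤ ENNReal.ofReal A)
    (hwb : ∀ t, 0 ≤ t → S.anorm N t (ν * Real.exp (-ω * t)) (w t) ≤ ENNReal.ofReal A)
    {t : ℝ} (ht : 0 ≤ t) :
    S.anorm N t (θ * ν * Real.exp (-ω * t)) (u t - w t) ≤ 2 * S.anorm N 0 ν (u₀ - w₀) := by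
  have hμ : 0 < θ * ν := by positivity
  have hθν : θ * ν ≤ ν := mul_le_of_le_one_left hν.le hθ1.le
  have hcu := H.controlled_of_isStrongSolution hν hνν hθ hθ1 hA hAμ hu hu₀ hub
  have hcw := H.controlled_of_isStrongSolution hν hνν hθ hθ1 hA hAμ hw hw₀ hwb
  set a : ℝ → ENNReal := fun s => S.anorm N s (θ * ν * Real.exp (-ω * s)) (u s - w s)
    + ENNReal.ofReal (δ * ω) * S.gint N (θ * ν) ω s (fun s => u s - w s) with ha
  set B : ENNReal := ⨆ s : Ici (0 : ℝ), a s with hB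
  have haB : ∀ s, 0 ≤ s → a s ≤ B := fun s hs => le_iSup (fun s : Ici (0 : ℝ) => a s) ⟨s, hs⟩
  have hBfin : B ≠ ⊤ := by
    refine ne_top_of_le_ne_top (b := (ENNReal.ofReal A + ENNReal.ofReal A)
      + (ENNReal.ofReal (2 * A) + ENNReal.ofReal (2 * A))) (by finiteness)
      (iSup_le fun ⟨s, hs⟩ => ?_)
    refine add_le_add ((S.anorm_sub_le N s (by positivity) _ _).trans
      (add_le_add (hcu.anorm_le s hs) (hcw.anorm_le s hs))) ?_
    refine (mul_le_mul_right (S.gint_sub_le H.norms hcu.regular hμ.le ω s) _).trans ?_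
    rw [mul_add]
    exact add_le_add (hcu.gint_le s hs) (hcw.gint_le s hs)
  set D := S.anorm N 0 ν (u₀ - w₀) with hD
  have hstep : B ≤ D + ENNReal.ofReal (1 / 2) * B := by
    refine iSup_le fun ⟨s, hs⟩ => ?_
    refine (H.energy_sub_le hμ (hθν.trans hνν) hA hAμ hcw hcu hw.eqn hu.eqn hs
      (fun τ hτ _ => le_self_add.trans (haB τ hτ)) (le_add_self.trans (haB s hs))).trans ?_
    rw [hu.initial, hw.initial]
    exact add_le_add (anorm_mono hμ.le hθν _) le_rfl
  have hhalf : ENNReal.ofReal (1 / 2) * B + ENNReal.ofReal (1 / 2) * B = B := by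
    rw [← add_mul, ← ENNReal.ofReal_add (by norm_num) (by norm_num), add_halves,
      ENNReal.ofReal_one, one_mul]
  have hle : ENNReal.ofReal (1 / 2) * B ≤ D := by
    refine (ENNReal.add_le_add_iff_right (a := ENNReal.ofReal (1 / 2) * B) (by finiteness)).1 ?_
    rw [hhalf]
    exact hstep
  calc _ ≤ B := le_self_add.trans (haB t ht)
    _ ≤ D + D := by rw [← hhalf]; gcongr
    _ = 2 * D := (two_mul D).symm

/-- Let `θ → 1` in the bound at radius `θν`: its right-hand side does not depend on `θ`, and finite
partial sums of the norm are continuous in the radius. The smallness at `ν/2` covers all `θ > 1/2`.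
-/
theorem Hypotheses.anorm_sub_le
    (H : S.Hypotheses N Q C r ω M₀ M₁ M₀' M₁' ν₀ δ η) {ν A : ℝ}
    (hν : 0 < ν) (hνν : ν ≤ ν₀) (hA : 0 ≤ A) (hAμ : A ≤ η * (ν / 2))
    {u₀ w₀ : S.Y} {u w : ℝ → S.Y} (hu : S.IsStrongSolution Q u₀ u)
    (hw : S.IsStrongSolution Q w₀ w)
    (hu₀ : S.anorm N 0 ν u₀ ≤ ENNReal.ofReal (A / 2))
    (hw₀ : S.anorm N 0 ν w₀ ≤ ENNReal.ofReal (A / 2))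
    (hub : ∀ t, 0 ≤ t → S.anorm N t (ν * Real.exp (-ω * t)) (u t) ≤ ENNReal.ofReal A)
    (hwb : ∀ t, 0 ≤ t → S.anorm N t (ν * Real.exp (-ω * t)) (w t) ≤ ENNReal.ofReal A)
    {t : ℝ} (ht : 0 ≤ t) :
    S.anorm N t (ν * Real.exp (-ω * t)) (u t - w t) ≤ 2 * S.anorm N 0 ν (u₀ - w₀) := by
  have hη := H.hη
  rw [anorm_eq, ENNReal.tsum_eq_iSup_sum]
  refine iSup_le fun s => ?_
  have hc : Continuous fun θ : ℝ =>
      ∑ α ∈ s, S.term N t (θ * ν * Real.exp (-ω * t)) α (u t - w t) := by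
    unfold term
    exact continuous_finsetSum _ fun α _ => ENNReal.continuous_ofReal.comp (by fun_prop)
  have hlim := (hc.tendsto 1).mono_left (nhdsWithin_le_nhds (s := Iio 1))
  rw [one_mul] at hlim
  refine le_of_tendsto hlim ?_
  filter_upwards [Ioo_mem_nhdsLT (show (1 / 2 : ℝ) < 1 by norm_num)] with θ hθ
  have hθ0 : 0 < θ := lt_trans (by norm_num) hθ.1
  refine (ENNReal.sum_le_tsum s).trans ?_
  refine H.anorm_sub_le_of_lt_one hν hνν hθ0 hθ.2 hA (hAμ.trans ?_) hu hw hu₀ hw₀ hub hwb ht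
  have := hθ.1
  gcongr
  nlinarith

end Setting

end AnalyticEvolution

/-! ### Choice of the constants and conclusion. -/

namespace AnalyticEvolution

/-- Taking `n`-th powers, the hypothesis becomes `nCr/ω < (1 - rν₀)^n`; `δ` is chosen to give
equality. -/
theorem exists_gap {n : ℕ} (hn : 1 ≤ n) {C r ω ν₀ : ℝ} (hC : 0 ≤ C) (hr : 0 ≤ r) (hω : 0 < ω)
    (h : r * ν₀ < 1 - (n * C * r / ω) ^ (1 / (n : ℝ))) :
    r * ν₀ < 1 ∧ ∃ δ : ℝ, 0 < δ ∧ n * C * r ≤ (1 - δ) * ω * (1 - r * ν₀) ^ n := by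
  have hx : 0 ≤ n * C * r / ω := by positivity
  have hroot : 0 ≤ (n * C * r / ω) ^ (1 / (n : ℝ)) := Real.rpow_nonneg hx _
  have h1 : r * ν₀ < 1 := by linarith
  have hb : 0 < 1 - r * ν₀ := by linarith
  have h2 : n * C * r / ω < (1 - r * ν₀) ^ n := by
    have h3 := pow_lt_pow_left₀ (show (n * C * r / ω) ^ (1 / (n : ℝ)) < 1 - r * ν₀ by linarith)
      hroot (show n ≠ 0 by omega)
    rwa [one_div, Real.rpow_inv_natCast_pow hx (by omega)] at h3
  rw [div_lt_iff₀ hω] at h2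
  refine ⟨h1, 1 - n * C * r / (ω * (1 - r * ν₀) ^ n), ?_, le_of_eq ?_⟩
  · rw [sub_pos, div_lt_one (by positivity)]
    linarith
  · have := pow_pos hb n
    field_simp
    ring

theorem exists_pos_mul_le_half {K K' : ℝ} (hK : 0 ≤ K) (hK' : 0 ≤ K') :
    ∃ η : ℝ, 0 < η ∧ η * K ≤ 1 / 2 ∧ η * K' ≤ 1 / 2 := by
  refine ⟨1 / (2 * (K + K' + 1)), by positivity, ?_, ?_⟩ <;>
  · rw [one_div_mul_eq_div, div_le_div_iff₀ (by positivity) (by norm_num)]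
    linarith

end AnalyticEvolution

theorem theorem4 {n : ℕ} (hn : 1 ≤ n)
    {X : Type*} [NormedAddCommGroup X] [NormedSpace ℝ X] [CompleteSpace X]
    (S : AnalyticEvolution.Setting n X)
    (N : ℝ → Seminorm ℝ S.Y) (hN : S.AdmissibleNorms N)
    (Q : ℝ → S.Y → S.Y) (hQ : S.ActsOnCL0 Q)
    (C r ω M₀ M₁ M₀' M₁' : ℝ) (hC : 0 ≤ C) (hr : 0 ≤ r) (hω : C * r < ω)
    (hM₀ : 0 ≤ M₀) (hM₁ : 0 ≤ M₁) (hM₀' : 0 ≤ M₀') (hM₁' : 0 ≤ M₁')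
    (h2 : S.H2 N C r) (h3a : S.H3a N Q ω M₀ M₁) (h3b : S.H3b N Q ω M₀' M₁') (h4 : S.H4 N)
    (ν₀ : ℝ) (hν₀ : 0 < ν₀) (hν₀r : r * ν₀ < 1 - (n * C * r / ω) ^ (1 / (n : ℝ))) :
    ∃ ε : ℝ, 0 < ε ∧ ∀ ν : ℝ, 0 ≤ ν → ν ≤ ν₀ →
      (∀ u₀ : S.Y, S.anorm N 0 ν u₀ ≤ ENNReal.ofReal (ε * ν) →
        ∃ u : ℝ → S.Y, S.IsStrongSolution Q u₀ u ∧
          ∀ t, 0 ≤ t →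
            S.anorm N t (ν * Real.exp (-ω * t)) (u t) ≤ ENNReal.ofReal (2 * ε * ν)) ∧
      (∀ (u₀ w₀ : S.Y) (u w : ℝ → S.Y),
        S.anorm N 0 ν u₀ ≤ ENNReal.ofReal (ε * ν) →
        S.anorm N 0 ν w₀ ≤ ENNReal.ofReal (ε * ν) →
        S.IsStrongSolution Q u₀ u →
        S.IsStrongSolution Q w₀ w →
        (∀ t, 0 ≤ t →
          S.anorm N t (ν * Real.exp (-ω * t)) (u t) ≤ ENNReal.ofReal (2 * ε * ν)) →
        (∀ t, 0 ≤ t →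
          S.anorm N t (ν * Real.exp (-ω * t)) (w t) ≤ ENNReal.ofReal (2 * ε * ν)) →
        ∀ t, 0 ≤ t →
          S.anorm N t (ν * Real.exp (-ω * t)) (u t - w t) ≤ 2 * S.anorm N 0 ν (u₀ - w₀)) := by
  have hω' : 0 < ω := lt_of_le_of_lt (mul_nonneg hC hr) hω
  obtain ⟨hrν, δ, hδ, hgap⟩ := AnalyticEvolution.exists_gap hn hC hr hω' hν₀r
  obtain ⟨η, hη, hgrowth, hcontr⟩ := AnalyticEvolution.exists_pos_mul_le_half
    (show 0 ≤ (M₀ * ν₀ + 2 * M₁ / δ) / ω by positivity)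
    (show 0 ≤ (4 * M₀' * ν₀ + 6 * M₁' / δ) / ω by positivity)
  have H : S.Hypotheses N Q C r ω M₀ M₁ M₀' M₁' ν₀ δ η :=
    ⟨hN, hQ, hC, hr, hω', hM₀, hM₁, hM₀', hM₁', h2, h3a, h3b, h4, hrν, hδ, hgap, hη,
      hgrowth, hcontr⟩
  -- With `ε = η/4` the bound on solutions is `A = 2εν = ην/2`: the data are bounded by `A/2`, and
  -- `A ≤ η(ν/2)` as the limit `θ → 1` requires.
  refine ⟨η / 4, by positivity, fun ν hν hνν => ?_⟩
  -- At `ν = 0` the smallness conditions force data and solutions to vanish.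
  rcases hν.eq_or_lt with rfl | hν
  · simp only [zero_mul, mul_zero, ENNReal.ofReal_zero]
    constructor
    · intro u₀ hu₀
      obtain rfl := AnalyticEvolution.Setting.eq_zero_of_anorm_le_zero hN le_rfl hu₀
      exact ⟨fun _ => 0, AnalyticEvolution.Setting.isStrongSolution_zero hN hQ h3a,
        fun t _ => (S.anorm_zero N t 0).le⟩
    · intro u₀ w₀ u w _ _ _ _ hu hw t ht
      rw [AnalyticEvolution.Setting.eq_zero_of_anorm_le_zero hN ht (hu t ht),
        AnalyticEvolution.Setting.eq_zero_of_anorm_le_zero hN ht (hw t ht), sub_self,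
        S.anorm_zero]
      exact zero_le
  · have hA : η / 4 * ν = 2 * (η / 4) * ν / 2 := by ring
    have hA0 : 0 ≤ 2 * (η / 4) * ν := by positivity
    have hAη : 2 * (η / 4) * ν ≤ η * (ν / 2) := le_of_eq (by ring)
    rw [hA]
    refine ⟨fun u₀ hu₀ => H.exists_solution hν hνν hA0 (hAη.trans ?_) hu₀,
      fun u₀ w₀ u w hu₀ hw₀ hu hw hub hwb t ht =>
        H.anorm_sub_le hν hνν hA0 hAη hu hw hu₀ hw₀ hub hwb ht⟩
    gcongr
    linarith
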